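/- **Setting.** Let $d,\tau\ge 1$ be integers, $T>0$, $H=L_2(\Omega,\mathcal F,P)$ (complex), and let $\xi:\mathbb R\to H$ be a strongly measurable process with $\int_{-R}^{R}E|\xi(t)|^2dt<\infty$ for all $R$. Put $\xi^{(d)}(t,s)=\sum_{l=0}^d(-1)^l\binom dl\xi(t-ls)$. Assume that the increments of step $\tau T$ are periodically stationary with period $T$: $E\xi^{(d)}(t,\tau T)$ and $E\,\xi^{(d)}(t,\tau T)\overline{\xi^{(d)}(s,\tau T)}$ do not change when $T$ is added to all time arguments. Let $e_k(u)=T^{-1/2}e^{2\pi i(-1)^k[k/2]u/T}$, $k\ge1$, be the Fourier basis of $L_2([0,T))$, and let $$\xi_{kj}=\int_0^T\xi^{(d)}(u+jT,\tau T)\overline{e_k(u)}\,du,\qquad k\ge1,\ j\in\mathbb Z,$$ be the generated infinite-dimensional vector stationary increment sequence. Let $\varphi(\lambda)=(1-e^{-i\lambda\tau})^d(i\lambda)^{-d}$ and $w=|\varphi|^{-2}=\lambda^{2d}|1-e^{i\lambda\tau}|^{-2d}$. *Spectral density.* Suppose the sequence has a spectral density $f$: for almost every $\lambda\in[-\pi,\pi)$,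 $f(\lambda)$ is a positive trace class operator in $\ell_2$, $f_{kn}=\langle f\delta_k,\delta_n\rangle$ is measurable, $\int_{-\pi}^{\pi}|\varphi|^2\operatorname{Tr}f\,d\lambda<\infty$, and $E\,\xi_{kl}\overline{\xi_{nm}}=\frac1{2\pi}\int_{-\pi}^{\pi}e^{i(l-m)\lambda}|\varphi(\lambda)|^2f_{kn}(\lambda)\,d\lambda$. *Minimality condition.* Suppose $\int_{-\pi}^{\pi}w(\lambda)\langle f^{-1}(\lambda)\delta_k,\delta_k\rangle d\lambda<\infty$ for every $k$; here and below $\langle f^{-1}x,x'\rangle=\langle f^{-1/2}x,f^{-1/2}x'\rangle$ for $x,x'$ in the range of $f^{1/2}$. *The functional.* Let $A\xi=\int_0^\infty a(t)\xi(t)dt$ with $a:[0,\infty)\to\mathbb C$ measurable. Let $\sum_kd(k)x^k=(\sum_jx^j)^d$ and $\sum_kd_\tau(k)x^k=(\sum_jx^{\tau j})^d$. Suppose that the integrals and series involved converge absolutely: $\sum_kd(k)|a(t+\tau Tk)|$ is integrable in $t$ over bounded intervals of $[0,\infty)$, and $\int_0^\infty\sum_kd(k)|a(t+\tau Tk)|\,\|\xi(t-l\tau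 T)\|_H\,dt<\infty$ for $0\le l\le d$. Put $$b^\tau(t)=\sum_{k\ge0}a(t+\tau Tk)d(k),\quad v^\tau(t)=\sum_{l=\lceil -t/(\tau T)\rceil}^d(-1)^l\binom dl b^\tau(t+l\tau T),$$ $$B\xi=\int_0^\infty b^\tau(t)\xi^{(d)}(t,\tau T)dt,\qquad V\xi=\int_{-\tau Td}^0v^\tau(t)\xi(t)dt.$$ Let $a_{kj}=\int_0^Ta(u+jT)\overline{e_k(u)}du$, $\vec a_j=(a_{1j},a_{3j},a_{2j},a_{5j},a_{4j},\dots)^\top$, $\mathbf a=(\vec a_0,\vec a_1,\dots)$ and $\mathbf b=D^\tau\mathbf a$, that is, $\vec b_j=\sum_{m\ge j}d_\tau(m-j)\vec a_m$. Suppose $\vec b_j\in\ell_2$ and $\sum_{j\ge0}(j+1)\|\vec b_j\|<\infty$. *Spectral process and $L_2(f)$.* $L_2(f)$ is the completion of the $\ell_2$-valued functions $g$ for the norm given by $\int_{-\pi}^\pi\langle fg,g\rangle d\lambda=\int_{-\pi}^{\pi}\|f^{1/2}g\|^2d\lambda$; its elements $h$ are described by the square integrable functions $f^{1/2}h$. $\vec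 Z=\{Z_k\}$ denotes a process with uncorrelated increments with spectral density $f$ (the covariance of the increments of $Z_k$ over $\Delta$ and of $Z_n$ over $\Delta'$ is $\frac1{2\pi}\int_{\Delta\cap\Delta'}f_{kn}d\lambda$, for intervals $\Delta$, $\Delta'$ on which $f_{kk}$, respectively $f_{nn}$, is integrable) such that $\xi_{kj}=\int_{-\pi}^{\pi}e^{ij\lambda}\varphi(\lambda)\,dZ_k(\lambda)$. *The operator $\mathbf F_\tau$.* For $c=(\vec c_0,\vec c_1,\dots)$ in the space $\ell_2$ of sequences of vectors put $C(\lambda)=\sum_{j\ge0}\vec c_je^{ij\lambda}$. $\mathbf F_\tau$ is the positive self-adjoint operator in $\ell_2$ associated with the closed form $\langle\mathbf F_\tau c,x\rangle=\frac1{2\pi}\int_{-\pi}^\pi w\langle f^{-1}C,X\rangle d\lambda$, whose domain consists of the $c$ with $\frac1{2\pi}\int_{-\pi}^\pi w\langle f^{-1}C,C\rangle d\lambda<\infty$. *Optimal estimates.* $H^{0-}$ and $H(\xi^{(d)})$ are the closed linear spans in $H$ of $\{\xi_{kj}:j\le-1\}$ and of all $\xi_{kj}$. $\widehat B\xi$ is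 the element of $H^{0-}$ closest to $B\xi$. $\widehat A\xi$, the optimal linear estimate of $A\xi$ from observations at $t<0$, is the element closest to $A\xi$ among all estimates $\eta-V\xi$, $\eta\in H^{0-}$, which use the known values of $\xi$ on $[-\tau Td,0)$ through $V\xi$ and the increments before time $0$. **Theorem.** All coordinate sequences lie in the form domain of $\mathbf F_\tau$, and the matrix of the form consists of the Fourier coefficients $F^\tau_{j,l}=\frac1{2\pi}\int_{-\pi}^{\pi}e^{-i\lambda(j-l)}w(\lambda)f^{-1}(\lambda)d\lambda$, $j,l\ge0$. A process $\vec Z$ as above exists. The equation $\mathbf F_\tau c=D^\tau\mathbf a$ has a unique solution $c=\mathbf F_\tau^{-1}D^\tau\mathbf a$ in $\ell_2$. With $\vec B_\tau(e^{i\lambda})=\sum_{j\ge0}\vec b_je^{ij\lambda}$ and $\vec C_\tau(e^{i\lambda})=\sum_{j\ge0}(\mathbf F_\tau^{-1}D^\tau\mathbf a)_je^{ij\lambda}$, the optimal estimates are $$\widehat B\xi=\int_{-\pi}^{\pi}\vec h_\tau^{\,\top}d\vec Z,\qquad \widehat A\xi=\int_{-\pi}^{\pi}\vec h_\tau^{\,\top}d\vec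 Z-\int_{-\tau Td}^0v^\tau(t)\xi(t)dt,$$ with the spectral characteristic $$\vec h_\tau^{\,\top}=\vec B_\tau(e^{i\lambda})^\top\frac{(1-e^{-i\lambda\tau})^d}{(i\lambda)^d}-\frac{(-i\lambda)^d}{(1-e^{i\lambda\tau})^d}\,\vec C_\tau(e^{i\lambda})^\top f^{-1}(\lambda)\in L_2(f)$$ (the row $g^\top f$ formed with the matrix $\{f_{kn}\}$ is the vector $fg$), and the mean square error is $$E|A\xi-\widehat A\xi|^2=E|B\xi-\widehat B\xi|^2=\frac1{2\pi}\int_{-\pi}^{\pi}\frac{\lambda^{2d}}{|1-e^{i\lambda\tau}|^{2d}}\langle f^{-1}\vec C_\tau,\vec C_\tau\rangle d\lambda=\langle D^\tau\mathbf a,\mathbf F_\tau^{-1}D^\tau\mathbf a\rangle .$$ If moreover every $\xi(t)$, $t<0$, is orthogonal to $H(\xi^{(d)})\ominus H^{0-}$, then $\widehat A\xi$ is also the element closest to $A\xi$ in the closed linear span of all $\xi(t)$, $t<0$. -/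

import Mathlib

open MeasureTheory Filter Topology
open scoped ENNReal ComplexConjugate

noncomputable section

namespace PCIncrements

/-! ### Sequence spaces -/

/-- The Hilbert space `ℓ₂` of infinite-dimensional vectors. Components are numbered from `0`, so
the component `k` here is the component `k + 1` in the usual numbering from `1`. -/
abbrev Vec : Type := lp (fun _ : ℕ => ℂ) 2

/-- The Hilbert space `ℓ₂` of sequences `(c_0, c_1, …)` of infinite-dimensional vectors. -/
abbrev BlockVec : Type := lp (fun _ : ℕ => Vec) 2

/-- The coordinate vector `δ_k` of `ℓ₂`. -/
def unitVec (k : ℕ) : Vec := lp.single 2 k (1 : ℂ)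

/-- The block sequence whose only nonzero block is `δ_k`, at place `j`. -/
def unitBlock (j k : ℕ) : BlockVec := lp.single 2 j (unitVec k)

/-! ### The Fourier basis of `L₂([0,T))` -/

/-- The frequency `(-1)^k [k/2]` of the `k`-th basis function, `k = 1, 2, …` (shifted by one). -/
def freq (k : ℕ) : ℤ := (-1) ^ (k + 1) * (((k + 1) / 2 : ℕ) : ℤ)

/-- The orthonormal basis `e_k(u) = T^{-1/2} exp(2πi (-1)^k [k/2] u / T)` of `L₂([0,T))`. -/
def basisFun (T : ℝ) (k : ℕ) (u : ℝ) : ℂ :=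
  ((1 / Real.sqrt T : ℝ) : ℂ) * Complex.exp (2 * Real.pi * Complex.I * (freq k : ℂ) * u / T)

/-- The involution `1 ↦ 1`, `2l ↔ 2l+1` (`l ≥ 1`) of the indices, shifted by one; it exchanges the
basis functions of opposite frequencies. -/
def swapIdx (k : ℕ) : ℕ := if k = 0 then 0 else if k % 2 = 1 then k + 1 else k - 1

/-! ### Increments and the generated vector sequence -/

section Increments

variable {E : Type*} [NormedAddCommGroup E] [NormedSpace ℂ E]

/-- The increment `ξ^{(d)}(t, s) = ∑_{l=0}^d (-1)^l C(d,l) ξ(t - l s)` of order `d` and step `s`. -/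
def incr (d : ℕ) (s : ℝ) (ξ : ℝ → E) (t : ℝ) : E :=
  ∑ l ∈ Finset.range (d + 1), ((-1 : ℂ) ^ l * (d.choose l : ℂ)) • ξ (t - l * s)

/-- The component `ξ^{(d)}_{kj} = ∫_0^T ξ^{(d)}(u + jT, τT) conj (e_k(u)) du` of the generated
increment sequence. -/
def comp (d : ℕ) (T : ℝ) (ξ : ℝ → E) (τ : ℕ) (k : ℕ) (j : ℤ) : E :=
  ∫ u in Set.Ico 0 T, conj (basisFun T k u) • incr d (τ * T) ξ (u + j * T)

/-- `H^{0-}(ξ^{(d)})`: the closed linear span of `ξ^{(d)}_{kj}`, `j ≤ -1`. -/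
def pastSpace (d : ℕ) (T : ℝ) (ξ : ℝ → E) (τ : ℕ) : Submodule ℂ E :=
  (Submodule.span ℂ {x | ∃ (k : ℕ) (j : ℤ), j ≤ -1 ∧ x = comp d T ξ τ k j}).topologicalClosure

/-- `H(ξ^{(d)})`: the closed linear span of all `ξ^{(d)}_{kj}`. -/
def fullSpace (d : ℕ) (T : ℝ) (ξ : ℝ → E) (τ : ℕ) : Submodule ℂ E :=
  (Submodule.span ℂ {x | ∃ (k : ℕ) (j : ℤ), x = comp d T ξ τ k j}).topologicalClosure

/-- The closed linear span of the observed values `ξ(t)`, `t < 0`. -/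
def obsSpace (ξ : ℝ → E) : Submodule ℂ E :=
  (Submodule.span ℂ {x | ∃ t : ℝ, t < 0 ∧ x = ξ t}).topologicalClosure

/-- `Y` is an element of `S` with the least mean square distance to `X` (in `E = L₂(Ω, P)` the norm
is the mean square norm). -/
def IsBestApprox (S : Set E) (X Y : E) : Prop := Y ∈ S ∧ ∀ W ∈ S, ‖X - Y‖ ≤ ‖X - W‖

end Increments

/-- Periodically stationary (periodically correlated) increments of order `d`, step `τT` and period
`T`: the mean value and the structural function of the increments are `T`-periodic. -/
def HasPeriodicIncrements {Ω : Type*} [MeasurableSpace Ω] (P : Measure Ω) (d τ : ℕ) (T : ℝ)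
    (ξ : ℝ → Lp ℂ 2 P) : Prop :=
  (∀ t : ℝ,
    ∫ ω, (incr d (τ * T) ξ (t + T) : Lp ℂ 2 P) ω ∂P = ∫ ω, (incr d (τ * T) ξ t : Lp ℂ 2 P) ω ∂P) ∧
  (∀ t s : ℝ,
    ∫ ω, (incr d (τ * T) ξ (t + T) : Lp ℂ 2 P) ω *
        conj ((incr d (τ * T) ξ (s + T) : Lp ℂ 2 P) ω) ∂P =
      ∫ ω, (incr d (τ * T) ξ t : Lp ℂ 2 P) ω * conj ((incr d (τ * T) ξ s : Lp ℂ 2 P) ω) ∂P)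

/-! ### Spectral density -/

/-- Lebesgue measure on `[-π, π)`. -/
def circ : Measure ℝ := volume.restrict (Set.Ico (-Real.pi) Real.pi)

/-- The matrix element `f_{kn} = ⟨f δ_k, δ_n⟩` (with the inner product linear in its first
argument). With this convention the row vector `g^⊤ f` built from the matrix `{f_{kn}}` is the
vector `f g` built from the operator `f`. -/
def entry (A : Vec →L[ℂ] Vec) (k n : ℕ) : ℂ := inner ℂ (unitVec n) (A (unitVec k))

/-- `φ(λ) = (1 - e^{-iλτ})^d / (iλ)^d`. -/
def phi (d τ : ℕ) (x : ℝ) : ℂ :=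
  (1 - Complex.exp (-(Complex.I * x * τ))) ^ d / (Complex.I * x) ^ d

/-- `w(λ) = λ^{2d} / |1 - e^{iλτ}|^{2d}`. -/
def weight (d τ : ℕ) (x : ℝ) : ℝ := x ^ (2 * d) / ‖1 - Complex.exp (Complex.I * x * τ)‖ ^ (2 * d)

/-- `f` is a spectral density of the increment sequence (of step `τ`) generated by `ξ`: for almost
every `λ` it is a positive kernel (trace class) operator in `ℓ₂`, with
`∫ |1 - e^{iτλ}|^{2d} λ^{-2d} Tr f(λ) dλ < ∞`, and
`E ξ_{kl} conj (ξ_{nm})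
  = (1/2π) ∫ e^{i(l-m)λ} (1 - e^{-iτλ})^d (1 - e^{iτλ})^d λ^{-2d} f_{kn}(λ) dλ`. -/
structure IsSpectralDensity {Ω : Type*} [MeasurableSpace Ω] (P : Measure Ω) (d τ : ℕ) (T : ℝ)
    (ξ : ℝ → Lp ℂ 2 P) (f : ℝ → Vec →L[ℂ] Vec) : Prop where
  measurable_entry : ∀ k n, AEStronglyMeasurable (fun x => entry (f x) k n) circ
  positive : ∀ᵐ x ∂circ, (f x).IsPositive
  kernel : ∫⁻ x, ∑' k, ENNReal.ofReal (‖phi d τ x‖ ^ 2 * (entry (f x) k k).re) ∂circ < ∞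
  correlation : ∀ (k n : ℕ) (l m : ℤ),
    inner ℂ (comp d T ξ τ n m) (comp d T ξ τ k l) =
      (1 / (2 * Real.pi) : ℂ) * ∫ x, Complex.exp (Complex.I * (l - m) * x) *
        (1 - Complex.exp (-(Complex.I * τ * x))) ^ d *
        (1 - Complex.exp (Complex.I * τ * x)) ^ d / (x : ℂ) ^ (2 * d) * entry (f x) k n ∂circ

/-- The positive square root `A^{1/2}` of a positive bounded operator in a Hilbert space. -/
def sqrtOp {H : Type*} [NormedAddCommGroup H] [InnerProductSpace ℂ H] [CompleteSpace H]
    (A : H →L[ℂ] H) : H →L[ℂ] H := CFC.sqrt A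

/-- `y = f^{-1/2} C` as functions on `[-π, π)` with `∫ w ‖y‖² dλ < ∞`. The integrand
`w ‖f^{-1/2} C‖²` is `w ⟨f^{-1} C, C⟩`, the form of the (unbounded) positive operator `w f^{-1}`. -/
structure IsInvSqrt (d τ : ℕ) (f : ℝ → Vec →L[ℂ] Vec) (C y : ℝ → Vec) : Prop where
  measurable : AEStronglyMeasurable y circ
  sqrt_eq : ∀ᵐ x ∂circ, sqrtOp (f x) (y x) = C x
  finite : ∫⁻ x, ENNReal.ofReal (weight d τ x * ‖y x‖ ^ 2) ∂circ < ∞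

/-- The minimality condition, component by component: for every `k` the `k`-th summand
`∫ w ⟨f^{-1} δ_k, δ_k⟩ dλ` of `∫ Tr (w f^{-1}) dλ` is finite. -/
def IsMinimal (d τ : ℕ) (f : ℝ → Vec →L[ℂ] Vec) : Prop :=
  ∀ k, ∃ y, IsInvSqrt d τ f (fun _ => unitVec k) y

/-- `C(λ) = ∑_{j ≥ 0} c_j e^{ijλ}`, the series converging in mean square on `[-π, π)`. -/
structure IsFourierSum (c : BlockVec) (C : ℝ → Vec) : Prop where
  measurable : AEStronglyMeasurable C circ
  tendsto : Tendsto (fun N : ℕ => ∫⁻ x, ‖C x -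
      ∑ j ∈ Finset.range N, Complex.exp (Complex.I * j * x) • c j‖ₑ ^ 2 ∂circ) atTop (𝓝 0)

/-! ### The operator `F_τ` -/

/-- `y = f^{-1/2} C` where `C(λ) = ∑_{j ≥ 0} c_j e^{ijλ}`; such `c` form the domain of the
quadratic form of `F_τ`. -/
def IsFormElement (d τ : ℕ) (f : ℝ → Vec →L[ℂ] Vec) (c : BlockVec) (y : ℝ → Vec) : Prop :=
  ∃ C, IsFourierSum c C ∧ IsInvSqrt d τ f C y

/-- `(1/2π) ∫ w ⟨y, z⟩ dλ` (linear in `y`). For `y = f^{-1/2} C`, `z = f^{-1/2} X` this is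
`(1/2π) ∫ w ⟨f^{-1} C, X⟩ dλ`, the form of `F_τ`. -/
def formPairing (d τ : ℕ) (y z : ℝ → Vec) : ℂ :=
  (1 / (2 * Real.pi) : ℂ) * ∫ x, (weight d τ x : ℂ) * inner ℂ (z x) (y x) ∂circ

/-- `F_τ c = b`, where `F_τ` is the positive self-adjoint operator in `ℓ₂` associated with the
closed form `⟨F_τ c, x⟩ = (1/2π) ∫ w ⟨f^{-1} C, X⟩ dλ`. -/
def IsFApply (d τ : ℕ) (f : ℝ → Vec →L[ℂ] Vec) (c b : BlockVec) : Prop :=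
  ∃ y, IsFormElement d τ f c y ∧
    ∀ x z, IsFormElement d τ f x z → formPairing d τ y z = inner ℂ x b

/-- A value of `A^{-1/2} x`: the `y` with `A^{1/2} y = x` (unique if `A` is injective; `0` if there
is none). -/
def invSqrtVec (A : Vec →L[ℂ] Vec) (x : Vec) : Vec :=
  open Classical in if h : ∃ y, sqrtOp A y = x then h.choose else 0

/-- The elements
`⟨F^τ_{j,l} δ_n, δ_k⟩ = (1/2π) ∫ e^{-iλ(j-l)} w(λ) ⟨f(λ)^{-1} δ_n, δ_k⟩ dλ`
of the blocks `F^τ_{j,l}`, the Fourier coefficients of `w f^{-1}`. -/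
def fMatrix (d τ : ℕ) (f : ℝ → Vec →L[ℂ] Vec) (j l k n : ℕ) : ℂ :=
  (1 / (2 * Real.pi) : ℂ) * ∫ x, Complex.exp (-(Complex.I * x * ((j : ℂ) - l))) *
    (weight d τ x : ℂ) * inner ℂ (invSqrtVec (f x) (unitVec k)) (invSqrtVec (f x) (unitVec n)) ∂circ

/-! ### The spectral stochastic process and integrals with respect to it -/

section Spectral

variable {Ω : Type*} [MeasurableSpace Ω] {P : Measure Ω}

/-- `[α, β) ⊆ [-π, π)` and `f_{kk}` is integrable on `[α, β)`, so that `Z_k(β) - Z_k(α)` has a finite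
variance. (If `f_{kk}` is integrable on `[-π, π)`, these are all subintervals; in general `f_{kk}`
may be non-integrable at the zeros of `1 - e^{iλτ}` other than `0`.) -/
def IsAdmissible (f : ℝ → Vec →L[ℂ] Vec) (k : ℕ) (α β : ℝ) : Prop :=
  -Real.pi ≤ α ∧ α ≤ β ∧ β ≤ Real.pi ∧ IntegrableOn (fun x => entry (f x) k k) (Set.Ico α β)

/-- The vector step function `∑ z · 1_{[α, β)} δ_k`, the sum over the data `(k, α, β) ↦ z`. -/
def stepFun (s : (ℕ × ℝ × ℝ) →₀ ℂ) (x : ℝ) : Vec :=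
  s.sum fun p z => (Set.Ico p.2.1 p.2.2).indicator (fun _ => z • unitVec p.1) x

/-- Its integral `∑ z (Z_k(β) - Z_k(α))`. -/
def stepIntegral (Z : ℕ → ℝ → Lp ℂ 2 P) (s : (ℕ × ℝ × ℝ) →₀ ℂ) : Lp ℂ 2 P :=
  s.sum fun p z => z • (Z p.1 p.2.2 - Z p.1 p.2.1)

/-- `γ = ∫ h^⊤ dZ` for `h ∈ L₂(f)`: the mean square limit of integrals of step functions which
converge to `h` in `L₂(f)`. Here `L₂(f)` is the completion of the vector functions for the norm
`∫ ⟨f g, g⟩ dλ = ∫ ‖f^{1/2} g‖² dλ`, and an element `h` of it is given by the square integrable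
function `u = f^{1/2} h`. -/
def IsSpectralIntegral (f : ℝ → Vec →L[ℂ] Vec) (Z : ℕ → ℝ → Lp ℂ 2 P) (u : ℝ → Vec)
    (γ : Lp ℂ 2 P) : Prop :=
  AEStronglyMeasurable u circ ∧ ∃ s : ℕ → ((ℕ × ℝ × ℝ) →₀ ℂ),
    (∀ n, ∀ p ∈ (s n).support, IsAdmissible f p.1 p.2.1 p.2.2) ∧
    Tendsto (fun n => ∫⁻ x, ‖sqrtOp (f x) (stepFun (s n) x) - u x‖ₑ ^ 2 ∂circ) atTop (𝓝 0) ∧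
    Tendsto (fun n => stepIntegral Z (s n)) atTop (𝓝 γ)

/-- `Z = (Z_k)` is the spectral stochastic process of the generated increment sequence: it has
uncorrelated increments with the spectral density `f`, and
`ξ_{kj} = ∫ e^{ijλ} (1 - e^{-iλτ})^d (iλ)^{-d} dZ_k(λ)`. -/
structure IsSpectralProcess (d τ : ℕ) (T : ℝ) (ξ : ℝ → Lp ℂ 2 P) (f : ℝ → Vec →L[ℂ] Vec)
    (Z : ℕ → ℝ → Lp ℂ 2 P) : Prop where
  increments : ∀ (k n : ℕ) (α β α' β' : ℝ), IsAdmissible f k α β → IsAdmissible f n α' β' →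
    inner ℂ (Z n β' - Z n α') (Z k β - Z k α) =
      (1 / (2 * Real.pi) : ℂ) * ∫ x in Set.Ico α β ∩ Set.Ico α' β', entry (f x) k n
  representation : ∀ (k : ℕ) (j : ℤ), IsSpectralIntegral f Z
    (fun x => sqrtOp (f x) ((Complex.exp (Complex.I * j * x) * phi d τ x) • unitVec k))
    (comp d T ξ τ k j)

end Spectral

/-! ### The functional and its coefficients -/

/-- `d(k)`, given by `∑ d(k) x^k = (∑ x^j)^d`. -/
def dCoef (d k : ℕ) : ℕ := PowerSeries.coeff k ((PowerSeries.mk fun _ => (1 : ℕ)) ^ d)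

/-- `d_τ(k)`, given by `∑ d_τ(k) x^k = (∑ x^{τ j})^d`. -/
def dTauCoef (d τ k : ℕ) : ℕ :=
  PowerSeries.coeff k ((PowerSeries.mk fun n => if τ ∣ n then (1 : ℕ) else 0) ^ d)

/-- `b^τ(t) = ∑_k a(t + τTk) d(k)`. -/
def bFun (d τ : ℕ) (T : ℝ) (a : ℝ → ℂ) (t : ℝ) : ℂ := ∑' k : ℕ, a (t + τ * T * k) * dCoef d k

/-- `∑_k |a(t + τTk)| d(k)`. -/
def bAbs (d τ : ℕ) (T : ℝ) (a : ℝ → ℂ) (t : ℝ) : ℝ≥0∞ :=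
  ∑' k : ℕ, ‖a (t + τ * T * k)‖ₑ * dCoef d k

/-- `v^τ(t) = ∑_{l = ⌈-t/(τT)⌉}^d (-1)^l C(d,l) b^τ(t + lτT)`. -/
def vFun (d τ : ℕ) (T : ℝ) (a : ℝ → ℂ) (t : ℝ) : ℂ :=
  ∑ l ∈ Finset.Icc ⌈-t / (τ * T)⌉₊ d,
    (-1 : ℂ) ^ l * (d.choose l : ℂ) * bFun d τ T a (t + l * (τ * T))

/-- The `k`-th component of the vector `a_j = (a_{1j}, a_{3j}, a_{2j}, …)^⊤`, where
`a_{kj} = ∫_0^T a(u + jT) conj (e_k(u)) du`. -/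
def aVec (T : ℝ) (a : ℝ → ℂ) (j k : ℕ) : ℂ :=
  ∫ u in Set.Ico 0 T, a (u + j * T) * conj (basisFun T (swapIdx k) u)

/-- The `k`-th component of `(D^τ a)_j = ∑_{m ≥ j} d_τ(m - j) a_m`. -/
def dTauVec (d τ : ℕ) (T : ℝ) (a : ℝ → ℂ) (j k : ℕ) : ℂ :=
  ∑' m : ℕ, (dTauCoef d τ m : ℂ) * aVec T a (j + m) k

section Functionals

variable {E : Type*} [NormedAddCommGroup E] [NormedSpace ℂ E]

/-- `Aξ = ∫_0^∞ a(t) ξ(t) dt`. -/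
def funA (a : ℝ → ℂ) (ξ : ℝ → E) : E := ∫ t in Set.Ici (0 : ℝ), a t • ξ t

/-- `Bξ = ∫_0^∞ b^τ(t) ξ^{(d)}(t, τT) dt`. -/
def funB (d τ : ℕ) (T : ℝ) (a : ℝ → ℂ) (ξ : ℝ → E) : E :=
  ∫ t in Set.Ici (0 : ℝ), bFun d τ T a t • incr d (τ * T) ξ t

/-- `Vξ = ∫_{-τTd}^0 v^τ(t) ξ(t) dt`. -/
def funV (d τ : ℕ) (T : ℝ) (a : ℝ → ℂ) (ξ : ℝ → E) : E :=
  ∫ t in Set.Ico (-(τ * T * d)) (0 : ℝ), vFun d τ T a t • ξ t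

end Functionals

/-- The function `f^{1/2} h_τ` that represents in `L₂(f)` the spectral characteristic
`h_τ = (1 - e^{-iλτ})^d (iλ)^{-d} B_τ(e^{iλ}) - (-iλ)^d (1 - e^{iλτ})^{-d} f^{-1} C_τ(e^{iλ})`,
where `B_τ(e^{iλ}) = ∑_j b_j e^{ijλ}` and `y = f^{-1/2} C_τ(e^{iλ})`. -/
def spectralChar (d τ : ℕ) (f : ℝ → Vec →L[ℂ] Vec) (b : BlockVec) (y : ℝ → Vec) (x : ℝ) : Vec :=
  ((1 - Complex.exp (-(Complex.I * x * τ))) ^ d / (Complex.I * x) ^ d) •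
      sqrtOp (f x) (∑' j : ℕ, Complex.exp (Complex.I * j * x) • b j) -
    ((-(Complex.I * x)) ^ d / (1 - Complex.exp (Complex.I * x * τ)) ^ d) • y x

end PCIncrements

end

open PCIncrements

/-!
The increment sequence is studied in the frequency domain. By the formula for the covariances, the
correspondence `e^{ijλ} φ f^{1/2} δ_k ↦ ξ_{kj}` multiplies inner products by `1/2π`, and it extends
to an operator `J` of `L₂([-π, π); ℓ₂)` into `H` with the same property (`exists_isometry`,
`IsSpectralProcess.exists_isometry`). The minimality condition makes `f^{1/2}`
injective almost everywhere, and therefore both the functions `e^{ijλ} φ f^{1/2} δ_k` and the step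
functions `1_{[α,β)} f^{1/2} δ_k` are total (`IsSymbol.span_element_eq_top`, `span_cutElem_eq_top`).
Consequently a spectral process exists, and the integral with respect to any spectral process is `J`.

The functional `Bξ` is `J (φ f^{1/2} B_τ)` (`map_series_eq_funB`): on each period `b^τ` is expanded
in the Fourier basis. Let `M_n` be the closed span of the functions with `j < n`, and let `v` be the
component of `φ f^{1/2} B_τ` orthogonal to `M_0`. Then `B̂ξ = J (φ f^{1/2} B_τ - v)`, and the point is
to identify `v`. An element `ε` of `M_{n+1} ⊖ M_n` is orthogonal to all its shifts `e^{ijλ} ε`,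
`j ≠ 0`, so that `‖ε(λ)‖` is constant (`IsSymbol.norm_innovation`). The `j`-th term of the series
for `v` is a sum of `j + 1` such innovations, hence it is bounded by a multiple of `(j + 1) ‖b_j‖`,
and `v` is bounded. Therefore `C = conj φ f^{1/2} v` is square integrable; its Fourier coefficients
of negative index vanish because `v` is orthogonal to `M_0`, and `C = ∑_{j ≥ 0} c_j e^{ijλ}` with
`c ∈ ℓ₂` (`IsSymbol.exists_projection`).

The substitution `y = conj φ · z` turns the form of `F_τ` into the inner product of
`L₂([-π, π); ℓ₂)` (`formPairing_eq`), and for a form element `x` the corresponding `z` is orthogonal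
to `M_0`. Hence the form at `(c, x)` is `⟨φ f^{1/2} B_τ, z⟩ / 2π = ⟨b, x⟩`, that is, `F_τ c = b`
(`isFApply_of_projection`). Solutions are unique because the form is positive definite, so `c` is
the only solution and `y = f^{-1/2} C` is `conj φ v`. The formulas for the estimates
and the error follow, and `Aξ = Bξ - Vξ` (`funA_eq`) transfers them from `Bξ` to `Aξ`.
-/

noncomputable section

namespace PCIncrements

/-! ### Two general tools: uniqueness of Fourier coefficients, isometric extension -/

/-- Uniqueness of Fourier coefficients in `L₁` of a period: trigonometric polynomials are uniformly
dense in the continuous periodic functions, and these contain the test functions. -/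
theorem ae_eq_zero_of_fourier_eq_zero {a T : ℝ} (hT : 0 < T) {g : ℝ → ℂ}
    (hg : IntegrableOn g (Set.Ico a (a + T)))
    (h0 : ∀ n : ℤ, ∫ x in Set.Ico a (a + T),
      Complex.exp (2 * Real.pi * Complex.I * n * x / T) * g x = 0) :
    ∀ᵐ x ∂volume.restrict (Set.Ico a (a + T)), g x = 0 := by
  have : Fact (0 < T) := ⟨hT⟩
  set μ := volume.restrict (Set.Ico a (a + T)) with hμ
  have hgi : Integrable g μ := hg
  have hcont : ∀ h : C(AddCircle T, ℂ), Continuous fun x : ℝ => h (x : AddCircle T) :=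
    fun h => h.continuous.comp (AddCircle.continuous_mk' T)
  have hint : ∀ h : C(AddCircle T, ℂ), Integrable (fun x : ℝ => h (x : AddCircle T) * g x) μ :=
    fun h => hgi.bdd_mul (hcont h).aestronglyMeasurable
      (Eventually.of_forall fun x => h.norm_coe_le_norm _)
  let Λ : C(AddCircle T, ℂ) →ₗ[ℂ] ℂ :=
    { toFun := fun h => ∫ x, h (x : AddCircle T) * g x ∂μ
      map_add' := fun h k => by
        simp only [ContinuousMap.add_apply, add_mul]
        exact integral_add (hint h) (hint k)
      map_smul' := fun c h => by
        simp only [ContinuousMap.smul_apply, smul_eq_mul, mul_assoc, RingHom.id_apply]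
        exact integral_const_mul _ _ }
  let Λc : C(AddCircle T, ℂ) →L[ℂ] ℂ := Λ.mkContinuous (∫ x, ‖g x‖ ∂μ) fun h => by
    rw [mul_comm, ← integral_const_mul]
    refine norm_integral_le_of_norm_le (hgi.norm.const_mul _) (Eventually.of_forall fun x => ?_)
    rw [norm_mul]
    gcongr
    exact h.norm_coe_le_norm _
  -- the functional `h ↦ ∫ h g` vanishes on trigonometric polynomials, hence on all of `C(AddCircle T)`
  have hker : ∀ h, Λc h = 0 := by
    have hle : (Submodule.span ℂ (Set.range (@fourier T))).topologicalClosure ≤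
        LinearMap.ker (Λc : C(AddCircle T, ℂ) →ₗ[ℂ] ℂ) := by
      refine Submodule.topologicalClosure_minimal _ ?_ Λc.isClosed_ker
      rw [Submodule.span_le]
      rintro _ ⟨n, rfl⟩
      change ∫ x : ℝ, fourier n (x : AddCircle T) * g x ∂μ = 0
      simpa only [fourier_coe_apply] using h0 n
    rw [span_fourier_closure_eq_top] at hle
    intro h
    exact hle (Submodule.mem_top : h ∈ ⊤)
  have hloc : LocallyIntegrableOn g (Set.Ioo a (a + T)) :=
    (hg.mono_set Set.Ioo_subset_Ico_self).locallyIntegrableOn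
  have hIoo := isOpen_Ioo.ae_eq_zero_of_integral_contDiff_smul_eq_zero hloc ?_
  · rw [hμ, restrict_Ioo_eq_restrict_Ico.symm, ae_restrict_iff' measurableSet_Ioo]
    exact hIoo
  · intro φ hφ _ hsupp
    have hz : ∀ x, x ∉ Set.Ioo a (a + T) → φ x = 0 := fun x hx => by
      by_contra h
      exact hx (hsupp (subset_tsupport _ h))
    -- the test function extended periodically
    let h : C(AddCircle T, ℂ) := ⟨AddCircle.liftIco T a fun x => (φ x : ℂ), by
      refine AddCircle.liftIco_continuous ?_ ?_
      · rw [hz a (by simp), hz (a + T) (by simp)]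
      · exact (Complex.continuous_ofReal.comp hφ.continuous).continuousOn⟩
    have := hker h
    change ∫ x : ℝ, AddCircle.liftIco T a (fun x => (φ x : ℂ)) (x : AddCircle T) * g x ∂μ = 0
      at this
    rw [← setIntegral_eq_integral_of_forall_compl_eq_zero (s := Set.Ico a (a + T)), ← this]
    · refine setIntegral_congr_fun measurableSet_Ico fun x hx => ?_
      simp only [AddCircle.liftIco_coe_apply hx, Complex.real_smul]
    · intro x hx
      rw [hz x fun h => hx (Set.Ioo_subset_Ico_self h), zero_smul]

/-- A total family and a family with proportional Gram matrix: the correspondence extends to a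
bounded operator that multiplies all inner products by the same factor. -/
theorem exists_extension_of_gram {ι E F : Type*} [NormedAddCommGroup E] [InnerProductSpace ℂ E]
    [NormedAddCommGroup F] [InnerProductSpace ℂ F] [CompleteSpace F] (x : ι → E) (y : ι → F)
    (r : ℝ) (hr : 0 ≤ r) (hx : (Submodule.span ℂ (Set.range x)).topologicalClosure = ⊤)
    (hxy : ∀ i j, inner ℂ (y i) (y j) = (r : ℂ) * inner ℂ (x i) (x j)) :
    ∃ J : E →L[ℂ] F, (∀ i, J (x i) = y i) ∧
      ∀ a b, inner ℂ (J a) (J b) = (r : ℂ) * inner ℂ a b := by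
  let X := Finsupp.linearCombination ℂ x
  let Y := Finsupp.linearCombination ℂ y
  have hXY : ∀ s t, inner ℂ (Y s) (Y t) = (r : ℂ) * inner ℂ (X s) (X t) := by
    intro s t
    simp only [X, Y, Finsupp.linearCombination_apply, Finsupp.sum, sum_inner, inner_sum,
      inner_smul_left, inner_smul_right, hxy, Finset.mul_sum]
    refine Finset.sum_congr rfl fun i _ => Finset.sum_congr rfl fun j _ => ?_
    ring
  have hd : DenseRange X := by
    have h1 : (LinearMap.range X).topologicalClosure = ⊤ := by
      rw [Finsupp.range_linearCombination]; exact hx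
    have := Submodule.dense_iff_topologicalClosure_eq_top.2 h1
    rwa [LinearMap.coe_range] at this
  have hn : ∀ s, ‖Y s‖ ≤ Real.sqrt r * ‖X s‖ := by
    intro s
    have h := hXY s s
    rw [inner_self_eq_norm_sq_to_K, inner_self_eq_norm_sq_to_K] at h
    have h' : ‖Y s‖ ^ 2 = r * ‖X s‖ ^ 2 := by
      apply Complex.ofReal_injective
      push_cast
      exact h
    refine le_of_sq_le_sq ?_ (by positivity)
    rw [h', mul_pow, Real.sq_sqrt hr]
  let J := Y.extendOfNorm X
  have hJ : ∀ s, J (X s) = Y s := LinearMap.extendOfNorm_eq hd ⟨_, hn⟩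
  refine ⟨J, fun i => ?_, fun a b => ?_⟩
  · simpa [X, Y] using hJ (Finsupp.single i 1)
  · refine hd.induction_on₂ (p := fun a b => inner ℂ (J a) (J b) = (r : ℂ) * inner ℂ a b) ?_ ?_ a b
    · exact isClosed_eq (by fun_prop) (by fun_prop)
    · intro s t
      rw [hJ, hJ, hXY]

/-! ### Vectors and positive operators in `ℓ₂` -/

/-- A single sequence of polynomials approximates the square root on all positive operators: the
`n`-th one is uniformly close to the square root on `[0, n]`. -/
theorem exists_polynomial_tendsto_sqrtOp (H : Type*) [NormedAddCommGroup H]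
    [InnerProductSpace ℂ H] [CompleteSpace H] : ∃ p : ℕ → Polynomial ℝ,
    ∀ A : H →L[ℂ] H, A.IsPositive →
      Tendsto (fun n => Polynomial.aeval A (p n)) atTop (𝓝 (sqrtOp A)) := by
  have h1 : ∀ n : ℕ, ∃ p : Polynomial ℝ, ∀ x ∈ Set.Icc (0 : ℝ) n,
      |Polynomial.eval x p - Real.sqrt x| < 1 / ((n : ℝ) + 1) := fun n =>
    exists_polynomial_near_of_continuousOn 0 n Real.sqrt Real.continuous_sqrt.continuousOn _
      (by positivity)
  choose p hp using h1
  refine ⟨p, fun A hA => ?_⟩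
  have hA0 : 0 ≤ A := (ContinuousLinearMap.nonneg_iff_isPositive A).2 hA
  have hsa : IsSelfAdjoint A := hA.isSelfAdjoint
  rw [tendsto_iff_norm_sub_tendsto_zero]
  refine squeeze_zero' (Eventually.of_forall fun _ => norm_nonneg _) ?_
    (tendsto_one_div_add_atTop_nhds_zero_nat (𝕜 := ℝ))
  filter_upwards [eventually_ge_atTop ⌈‖A‖⌉₊] with n hn
  have hnA : ‖A‖ ≤ n := (Nat.le_ceil _).trans (by exact_mod_cast hn)
  have hs : sqrtOp A = cfc Real.sqrt A := by
    rw [sqrtOp, CFC.sqrt_eq_real_sqrt A hA0, cfcₙ_eq_cfc]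
  rw [hs, ← cfc_polynomial (p n) A hsa, ← cfc_sub _ _ A]
  refine norm_cfc_le (by positivity) fun x hx => ?_
  have hx0 : 0 ≤ x := spectrum_nonneg_of_nonneg hA0 hx
  have hx1 : x ≤ n := by
    refine (le_abs_self x).trans ((spectrum.norm_le_norm_mul_of_mem hx).trans (le_trans ?_ hnA))
    exact mul_le_of_le_one_right (norm_nonneg _) ContinuousLinearMap.norm_id_le
  exact (hp n x ⟨hx0, hx1⟩).le

theorem sqrtOp_symm {H : Type*} [NormedAddCommGroup H] [InnerProductSpace ℂ H]
    [CompleteSpace H] (A : H →L[ℂ] H) (v w : H) :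
    inner ℂ (sqrtOp A v) w = inner ℂ v (sqrtOp A w) := by
  have h : IsSelfAdjoint (sqrtOp A) := IsSelfAdjoint.of_nonneg (CFC.sqrt_nonneg A)
  exact (ContinuousLinearMap.isSelfAdjoint_iff_isSymmetric.1 h) v w

theorem sqrtOp_sqrtOp {H : Type*} [NormedAddCommGroup H] [InnerProductSpace ℂ H]
    [CompleteSpace H] {A : H →L[ℂ] H} (hA : A.IsPositive) (v : H) :
    sqrtOp A (sqrtOp A v) = A v := by
  have h := CFC.sqrt_mul_sqrt_self A ((ContinuousLinearMap.nonneg_iff_isPositive A).2 hA)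
  exact congrArg (fun B : H →L[ℂ] H => B v) h

theorem inner_unitVec_left (k : ℕ) (v : Vec) : inner ℂ (unitVec k) v = v k := by
  rw [unitVec, lp.inner_single_left]
  simp

theorem norm_unitVec (k : ℕ) : ‖unitVec k‖ = 1 := by
  rw [unitVec, lp.norm_single (by norm_num)]
  simp

theorem hasSum_unitVec (v : Vec) : HasSum (fun k => v k • unitVec k) v := by
  have := lp.hasSum_single (E := fun _ : ℕ => ℂ) (p := 2) (by simp) v
  have h : (fun k => v k • unitVec k) = fun k => lp.single (E := fun _ : ℕ => ℂ) 2 k (v k) := by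
    funext k
    rw [unitVec, ← lp.single_smul, smul_eq_mul, mul_one]
  rwa [h]

theorem vec_ext {v w : Vec} (h : ∀ k, inner ℂ (unitVec k) v = inner ℂ (unitVec k) w) : v = w := by
  refine lp.ext (funext fun k => ?_)
  simpa only [inner_unitVec_left] using h k

theorem aestronglyMeasurable_of_inner_unitVec {α : Type*} [MeasurableSpace α] {μ : Measure α}
    {v : α → Vec} (h : ∀ k, AEStronglyMeasurable (fun x => inner ℂ (unitVec k) (v x)) μ) :
    AEStronglyMeasurable v μ := by
  refine aestronglyMeasurable_of_tendsto_ae atTop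
    (f := fun (n : ℕ) x => ∑ k ∈ Finset.range n, inner ℂ (unitVec k) (v x) • unitVec k) ?_ ?_
  · intro n
    exact Finset.aestronglyMeasurable_fun_sum _ fun k _ => (h k).smul_const _
  · refine Eventually.of_forall fun x => ?_
    simp only [inner_unitVec_left]
    exact (hasSum_unitVec (v x)).tendsto_sum_nat

/-- A field of operators that maps measurable vector functions to measurable ones. -/
def ActsMeasurably (A : ℝ → Vec →L[ℂ] Vec) : Prop :=
  ∀ v : ℝ → Vec, AEStronglyMeasurable v circ → AEStronglyMeasurable (fun x => A x (v x)) circ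

/-- Measurability of the matrix elements suffices: `⟨A v, δ_n⟩ = ∑_k v_k ⟨A δ_k, δ_n⟩`. -/
theorem actsMeasurably_of_entry {A : ℝ → Vec →L[ℂ] Vec}
    (h : ∀ k n, AEStronglyMeasurable (fun x => entry (A x) k n) circ) : ActsMeasurably A := by
  intro v hv
  refine aestronglyMeasurable_of_inner_unitVec fun n => ?_
  refine aestronglyMeasurable_of_tendsto_ae atTop
    (f := fun (N : ℕ) x => ∑ k ∈ Finset.range N, inner ℂ (unitVec k) (v x) * entry (A x) k n) ?_ ?_
  · intro N
    exact Finset.aestronglyMeasurable_fun_sum _ fun k _ =>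
      (aestronglyMeasurable_const.inner hv).mul (h k n)
  · refine Eventually.of_forall fun x => ?_
    have h1 := ((hasSum_unitVec (v x)).mapL (A x)).mapL (innerSL ℂ (unitVec n))
    simp only [map_smul, innerSL_apply_apply, smul_eq_mul] at h1
    simpa only [inner_unitVec_left, entry] using h1.tendsto_sum_nat

theorem ActsMeasurably.pow {A : ℝ → Vec →L[ℂ] Vec} (hA : ActsMeasurably A) (n : ℕ) :
    ActsMeasurably fun x => A x ^ n := by
  induction n with
  | zero => intro v hv; simpa using hv
  | succ n ih =>
    intro v hv
    simpa only [pow_succ, mul_apply_eq_comp] using ih _ (hA v hv)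

theorem ActsMeasurably.aeval {A : ℝ → Vec →L[ℂ] Vec} (hA : ActsMeasurably A)
    (p : Polynomial ℝ) : ActsMeasurably fun x => Polynomial.aeval (A x) p := by
  intro v hv
  simp only [Polynomial.aeval_eq_sum_range, sum_apply,
    smul_apply]
  exact Finset.aestronglyMeasurable_fun_sum _ fun i _ =>
    (hA.pow i v hv).const_smul (p.coeff i)

theorem ActsMeasurably.sqrtOp {A : ℝ → Vec →L[ℂ] Vec} (hA : ActsMeasurably A)
    (hpos : ∀ᵐ x ∂circ, (A x).IsPositive) : ActsMeasurably fun x => sqrtOp (A x) := by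
  obtain ⟨p, hp⟩ := exists_polynomial_tendsto_sqrtOp Vec
  intro v hv
  refine aestronglyMeasurable_of_tendsto_ae atTop (fun n => hA.aeval (p n) v hv) ?_
  filter_upwards [hpos] with x hx
  exact ((ContinuousLinearMap.apply ℂ Vec (v x)).continuous.tendsto _).comp (hp _ hx)

theorem inner_sqrtOp_unitVec {A : Vec →L[ℂ] Vec} (hA : A.IsPositive) (k n : ℕ) :
    inner ℂ (sqrtOp A (unitVec n)) (sqrtOp A (unitVec k)) = entry A k n := by
  rw [sqrtOp_symm, sqrtOp_sqrtOp hA, entry]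

/-- If the range of the square root contains the coordinate vectors, the square root is
injective. -/
theorem sqrtOp_injective {A : Vec →L[ℂ] Vec} (h : ∀ k, ∃ y, sqrtOp A y = unitVec k) :
    Function.Injective (sqrtOp A) := by
  refine (injective_iff_map_eq_zero _).2 fun v hv => vec_ext fun k => ?_
  obtain ⟨y, hy⟩ := h k
  rw [← hy, sqrtOp_symm, hv, inner_zero_right, inner_zero_right]

/-- The square root is bounded by the trace: `‖A^{1/2} v‖² ≤ (Tr A) ‖v‖²`. -/
theorem norm_sqrtOp_sq_le {A : Vec →L[ℂ] Vec} (hA : A.IsPositive) {S : ℝ}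
    (hS : HasSum (fun k => (entry A k k).re) S) (v : Vec) :
    ‖sqrtOp A v‖ ^ 2 ≤ S * ‖v‖ ^ 2 := by
  have hk : ∀ k, ‖sqrtOp A (unitVec k)‖ ^ 2 = (entry A k k).re := by
    intro k
    rw [← inner_sqrtOp_unitVec hA]
    exact norm_sq_eq_re_inner (𝕜 := ℂ) _
  have hv : HasSum (fun k => ‖v k‖ ^ 2) (‖v‖ ^ 2) := by
    have := lp.hasSum_norm (p := 2) (by norm_num) v
    simpa using this
  have hsum := (hasSum_unitVec v).mapL (sqrtOp A)
  refine le_of_tendsto ((hsum.norm).pow 2) (Eventually.of_forall fun s => ?_)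
  have h1 : ‖∑ k ∈ s, sqrtOp A (v k • unitVec k)‖ ≤
      ∑ k ∈ s, ‖sqrtOp A (unitVec k)‖ * ‖v k‖ := by
    refine (norm_sum_le _ _).trans (Finset.sum_le_sum fun k _ => ?_)
    rw [map_smul, norm_smul, mul_comm]
  calc _ ≤ (∑ k ∈ s, ‖sqrtOp A (unitVec k)‖ * ‖v k‖) ^ 2 := by gcongr
    _ ≤ (∑ k ∈ s, ‖sqrtOp A (unitVec k)‖ ^ 2) * ∑ k ∈ s, ‖v k‖ ^ 2 :=
        Finset.sum_mul_sq_le_sq_mul_sq _ _ _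
    _ ≤ S * ‖v‖ ^ 2 := by
        have h2 : ∑ k ∈ s, ‖sqrtOp A (unitVec k)‖ ^ 2 ≤ S := by
          simp only [hk]
          exact sum_le_hasSum s (fun k _ => by rw [← hk]; positivity) hS
        have h3 := sum_le_hasSum s (fun k _ => by positivity) hv
        exact mul_le_mul h2 h3 (Finset.sum_nonneg fun _ _ => by positivity)
          ((Finset.sum_nonneg fun _ _ => by positivity).trans h2)

/-! ### Square integrable vector functions on `[-π, π)` and their Fourier series -/

instance : IsFiniteMeasure circ := by
  rw [circ]
  infer_instance

/-- The Hilbert space `L₂([-π, π); ℓ₂)`. -/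
abbrev CircL2 : Type := Lp Vec 2 circ

/-- The character `e^{ijλ}`. -/
def char (j : ℤ) (x : ℝ) : ℂ := Complex.exp (Complex.I * j * x)

theorem norm_char (j : ℤ) (x : ℝ) : ‖char j x‖ = 1 := by
  have : Complex.I * j * x = ((j * x : ℝ) : ℂ) * Complex.I := by push_cast; ring
  rw [char, this, Complex.norm_exp_ofReal_mul_I]

theorem char_zero (x : ℝ) : char 0 x = 1 := by simp [char]

theorem char_add (j k : ℤ) (x : ℝ) : char (j + k) x = char j x * char k x := by
  rw [char, char, char, ← Complex.exp_add]
  push_cast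
  ring_nf

theorem conj_char (j : ℤ) (x : ℝ) : conj (char j x) = char (-j) x := by
  rw [char, char, ← Complex.exp_conj]
  simp

theorem char_continuous (j : ℤ) : Continuous (char j) := by
  unfold char
  fun_prop

theorem char_aestronglyMeasurable (j : ℤ) : AEStronglyMeasurable (char j) circ :=
  (char_continuous j).aestronglyMeasurable

theorem integral_circ_const {E : Type*} [NormedAddCommGroup E] [NormedSpace ℝ E]
    [CompleteSpace E] (c : E) :
    ∫ _x, c ∂circ = (2 * Real.pi) • c := by
  rw [integral_const, circ, measureReal_restrict_apply_univ, Real.volume_real_Ico_of_le]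
  · ring_nf
  · linarith [Real.pi_pos]

theorem integral_char {j : ℤ} (hj : j ≠ 0) : ∫ x, char j x ∂circ = 0 := by
  have hI : (Complex.I * j : ℂ) ≠ 0 := mul_ne_zero Complex.I_ne_zero (by exact_mod_cast hj)
  rw [circ, integral_Ico_eq_integral_Ioc, ← intervalIntegral.integral_of_le
    (by linarith [Real.pi_pos])]
  simp only [char]
  rw [integral_exp_mul_complex hI]
  have h : Complex.exp (Complex.I * j * (Real.pi : ℝ)) =
      Complex.exp (Complex.I * j * ((-Real.pi : ℝ) : ℂ)) := by
    rw [Complex.exp_eq_exp_iff_exists_int]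
    exact ⟨j, by push_cast; ring⟩
  rw [h, sub_self, zero_div]

/-- Uniqueness of Fourier coefficients for the characters `e^{ijλ}` on `[-π, π)`. -/
theorem circ_ae_eq_zero {g : ℝ → ℂ} (hg : Integrable g circ)
    (h0 : ∀ j : ℤ, ∫ x, char j x * g x ∂circ = 0) : ∀ᵐ x ∂circ, g x = 0 := by
  have hs : Set.Ico (-Real.pi) (-Real.pi + 2 * Real.pi) = Set.Ico (-Real.pi) Real.pi := by
    congr 1; ring
  have := ae_eq_zero_of_fourier_eq_zero (a := -Real.pi) (T := 2 * Real.pi) (g := g)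
    (by positivity) (by rw [hs]; exact hg) (fun n => by
      rw [hs, ← h0 n]
      refine integral_congr_ae (Eventually.of_forall fun x => ?_)
      simp only [char]
      congr 2
      push_cast
      have : (Real.pi : ℂ) ≠ 0 := by exact_mod_cast Real.pi_ne_zero
      field_simp)
  rwa [hs] at this

/-- An integrable function on `[-π, π)` all of whose Fourier coefficients of nonzero index vanish
is constant. -/
theorem circ_ae_eq_const {g : ℝ → ℂ} (hg : Integrable g circ)
    (h0 : ∀ j : ℤ, j ≠ 0 → ∫ x, char j x * g x ∂circ = 0) :
    ∀ᵐ x ∂circ, g x = (∫ y, g y ∂circ) / (2 * Real.pi) := by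
  set c := (∫ y, g y ∂circ) / (2 * Real.pi) with hc
  have hpi : (2 * Real.pi : ℂ) ≠ 0 := by exact_mod_cast (by positivity : (2 * Real.pi) ≠ 0)
  have := circ_ae_eq_zero (g := fun x => g x - c) (hg.sub (integrable_const _)) (fun j => by
    have hi : Integrable (fun x => char j x * g x) circ :=
      hg.bdd_mul (char_aestronglyMeasurable j) (Eventually.of_forall fun x => (norm_char j x).le)
    have hi2 : Integrable (fun x => char j x * c) circ :=
      (integrable_const c).bdd_mul (char_aestronglyMeasurable j)
        (Eventually.of_forall fun x => (norm_char j x).le)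
    simp only [mul_sub]
    rw [integral_sub hi hi2, integral_mul_const]
    by_cases hj : j = 0
    · subst hj
      simp only [char_zero, one_mul, integral_circ_const, hc]
      rw [Complex.real_smul]
      push_cast
      field_simp
      ring
    · rw [h0 j hj, integral_char hj, zero_mul, sub_zero])
  filter_upwards [this] with x hx
  exact sub_eq_zero.1 hx

theorem lintegral_enorm_sq (w : CircL2) : ∫⁻ x, ‖w x‖ₑ ^ 2 ∂circ = ‖w‖ₑ ^ 2 := by
  have h := eLpNorm_nnreal_pow_eq_lintegral (p := 2) (μ := circ) (f := w) (by norm_num)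
  rw [Lp.enorm_def]
  simpa using h.symm

theorem memLp_two_iff {w : ℝ → Vec} (hw : AEStronglyMeasurable w circ) :
    MemLp w 2 circ ↔ ∫⁻ x, ‖w x‖ₑ ^ 2 ∂circ < ∞ := by
  have h := eLpNorm_nnreal_pow_eq_lintegral (p := 2) (μ := circ) (f := w) (by norm_num)
  have h2 : ∫⁻ x, ‖w x‖ₑ ^ 2 ∂circ = eLpNorm w 2 circ ^ 2 := by
    simpa using h.symm
  rw [h2, ENNReal.pow_lt_top_iff]
  simp only [MemLp, hw, true_and, OfNat.ofNat_ne_zero, or_false]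

theorem tendsto_lintegral_iff {ι : Type*} {l : Filter ι} {w : ι → CircL2} {u : CircL2} :
    Tendsto (fun n => ∫⁻ x, ‖w n x - u x‖ₑ ^ 2 ∂circ) l (𝓝 0) ↔ Tendsto w l (𝓝 u) := by
  have h : ∀ n, ∫⁻ x, ‖w n x - u x‖ₑ ^ 2 ∂circ = ‖w n - u‖ₑ ^ 2 := fun n => by
    rw [← lintegral_enorm_sq]
    refine lintegral_congr_ae ?_
    filter_upwards [Lp.coeFn_sub (w n) u] with x hx
    rw [hx, Pi.sub_apply]
  simp only [h]
  rw [tendsto_iff_edist_tendsto_0]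
  simp only [edist_eq_enorm_sub]
  constructor
  · intro h0
    have h1 := ((ENNReal.continuous_rpow_const (y := (1 / 2 : ℝ))).tendsto 0).comp h0
    rw [ENNReal.zero_rpow_of_pos (by norm_num)] at h1
    refine h1.congr fun n => ?_
    rw [Function.comp_apply, ← ENNReal.rpow_natCast, ← ENNReal.rpow_mul]
    norm_num
  · intro h0
    have h1 := ((ENNReal.continuous_pow 2).tendsto 0).comp h0
    rwa [zero_pow (by norm_num)] at h1

theorem memLp_char_smul {w : ℝ → Vec} (hw : MemLp w 2 circ) (j : ℤ) :
    MemLp (fun x => char j x • w x) 2 circ := by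
  refine hw.of_le ((char_aestronglyMeasurable j).smul hw.1) (Eventually.of_forall fun x => ?_)
  rw [norm_smul, norm_char, one_mul]

/-- Multiplication by `e^{ijλ}` in `L₂([-π, π); ℓ₂)`. -/
def mulChar (j : ℤ) : CircL2 →ₗᵢ[ℂ] CircL2 where
  toFun w := (memLp_char_smul (Lp.memLp w) j).toLp _
  map_add' w u := by
    rw [← MemLp.toLp_add, MemLp.toLp_eq_toLp_iff]
    filter_upwards [Lp.coeFn_add w u] with x hx
    rw [hx, Pi.add_apply, Pi.add_apply, smul_add]
  map_smul' c w := by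
    rw [RingHom.id_apply, ← MemLp.toLp_const_smul, MemLp.toLp_eq_toLp_iff]
    filter_upwards [Lp.coeFn_smul c w] with x hx
    rw [hx, Pi.smul_apply, Pi.smul_apply, smul_comm]
  norm_map' w := by
    refine (Lp.norm_toLp _ (memLp_char_smul (Lp.memLp w) j)).trans ?_
    rw [Lp.norm_def]
    congr 1
    refine eLpNorm_congr_norm_ae (Eventually.of_forall fun x => ?_)
    rw [norm_smul, norm_char, one_mul]

theorem coeFn_mulChar (j : ℤ) (w : CircL2) :
    ∀ᵐ x ∂circ, mulChar j w x = char j x • w x :=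
  MemLp.coeFn_toLp (memLp_char_smul (Lp.memLp w) j)

/-- The embedding `v ↦ e^{ijλ} v` of `ℓ₂` into `L₂([-π, π); ℓ₂)`. -/
def charVec (j : ℤ) : Vec →L[ℂ] CircL2 :=
  (mulChar j).toContinuousLinearMap ∘L
    (Lp.constL 2 circ ℂ : Vec →L[ℂ] CircL2)

theorem coeFn_charVec (j : ℤ) (v : Vec) : ∀ᵐ x ∂circ, charVec j v x = char j x • v := by
  filter_upwards [coeFn_mulChar j (Lp.const 2 circ v), Lp.coeFn_const 2 circ v] with x hx hx2
  rw [hx2] at hx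
  exact hx

theorem inner_charVec_left (j : ℤ) (v : Vec) (w : CircL2) :
    inner ℂ (charVec j v) w = ∫ x, char (-j) x * inner ℂ v (w x) ∂circ := by
  rw [L2.inner_def]
  refine integral_congr_ae ?_
  filter_upwards [coeFn_charVec j v] with x hx
  rw [hx, inner_smul_left, conj_char]

theorem inner_charVec_charVec (j k : ℤ) (v w : Vec) :
    inner ℂ (charVec j v) (charVec k w) = if j = k then 2 * Real.pi * inner ℂ v w else 0 := by
  rw [inner_charVec_left]
  have : ∫ x, char (-j) x * inner ℂ v (charVec k w x) ∂circ =
      ∫ x, char (k - j) x * inner ℂ v w ∂circ := by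
    refine integral_congr_ae ?_
    filter_upwards [coeFn_charVec k w] with x hx
    rw [hx, inner_smul_right, ← mul_assoc, ← char_add]
    ring_nf
  rw [this]
  split_ifs with h
  · subst h
    simp only [sub_self, char_zero, one_mul, integral_circ_const, Complex.real_smul]
    push_cast
    ring
  · rw [integral_mul_const, integral_char (by omega), zero_mul]

theorem norm_charVec (j : ℤ) (v : Vec) : ‖charVec j v‖ = Real.sqrt (2 * Real.pi) * ‖v‖ := by
  have h := inner_charVec_charVec j j v v
  rw [if_pos rfl, inner_self_eq_norm_sq_to_K, inner_self_eq_norm_sq_to_K] at h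
  have h' : ‖charVec j v‖ ^ 2 = 2 * Real.pi * ‖v‖ ^ 2 := by
    apply Complex.ofReal_injective
    push_cast
    exact h
  rw [← Real.sqrt_sq (norm_nonneg (charVec j v)), h', Real.sqrt_mul (by positivity),
    Real.sqrt_sq (norm_nonneg _)]

theorem char_natCast (j : ℕ) (x : ℝ) : char (j : ℤ) x = Complex.exp (Complex.I * j * x) := by
  simp [char]

theorem coeFn_sum_charVec (c : BlockVec) (N : ℕ) :
    ∀ᵐ x ∂circ, (∑ j ∈ Finset.range N, charVec j (c j) : CircL2) x =
      ∑ j ∈ Finset.range N, Complex.exp (Complex.I * j * x) • c j := by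
  filter_upwards [Lp.coeFn_finsetSum (Finset.range N) fun j : ℕ => charVec j (c j),
    ae_all_iff.2 fun j : ℕ => coeFn_charVec j (c j)] with x hx hx2
  rw [hx, Finset.sum_apply]
  refine Finset.sum_congr rfl fun j _ => ?_
  rw [hx2, char_natCast]

/-- The Fourier series of a square integrable function, as a limit in `L₂([-π, π); ℓ₂)`. -/
theorem isFourierSum_iff {c : BlockVec} {C : ℝ → Vec} : IsFourierSum c C ↔
    ∃ h : MemLp C 2 circ,
      Tendsto (fun N => ∑ j ∈ Finset.range N, charVec j (c j)) atTop (𝓝 (h.toLp C)) := by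
  have key : ∀ N : ℕ, ∀ W : CircL2, C =ᵐ[circ] W → ∫⁻ x, ‖C x -
      ∑ j ∈ Finset.range N, Complex.exp (Complex.I * j * x) • c j‖ₑ ^ 2 ∂circ =
      ∫⁻ x, ‖(∑ j ∈ Finset.range N, charVec j (c j) : CircL2) x - W x‖ₑ ^ 2 ∂circ := by
    intro N W hW
    refine lintegral_congr_ae ?_
    filter_upwards [hW, coeFn_sum_charVec c N] with x h1 h2
    rw [h1, h2, ← enorm_neg, neg_sub]
  constructor
  · rintro ⟨hm, ht⟩
    obtain ⟨N, hN⟩ := (ht.eventually_lt_const (show (0 : ℝ≥0∞) < ∞ by simp)).exists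
    have h1 : MemLp (fun x => C x -
        ∑ j ∈ Finset.range N, Complex.exp (Complex.I * j * x) • c j) 2 circ := by
      refine (memLp_two_iff (hm.sub ?_)).2 hN
      exact Continuous.aestronglyMeasurable (by fun_prop)
    have h2 : MemLp (fun x : ℝ => ∑ j ∈ Finset.range N, Complex.exp (Complex.I * j * x) • c j)
        2 circ := (memLp_congr_ae (coeFn_sum_charVec c N)).1 (Lp.memLp _)
    have h : MemLp C 2 circ := 
      (h1.add h2).ae_eq (Eventually.of_forall fun x => by simp)
    refine ⟨h, tendsto_lintegral_iff.1 ?_⟩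
    simpa only [key _ _ h.coeFn_toLp.symm] using ht
  · rintro ⟨h, ht⟩
    refine ⟨h.1, ?_⟩
    simpa only [key _ _ h.coeFn_toLp.symm] using tendsto_lintegral_iff.2 ht

/-- The coefficients of a Fourier series with nonnegative indices. -/
theorem IsFourierSum.inner_charVec {c : BlockVec} {C : ℝ → Vec} (hC : IsFourierSum c C)
    (h : MemLp C 2 circ) (v : Vec) (j : ℤ) :
    inner ℂ (charVec j v) (h.toLp C) =
      if 0 ≤ j then 2 * Real.pi * inner ℂ v (c j.toNat) else 0 := by
  obtain ⟨h', ht⟩ := isFourierSum_iff.1 hC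
  refine tendsto_nhds_unique ((tendsto_const_nhds (x := charVec j v)).inner ht) ?_
  refine tendsto_const_nhds.congr' ?_
  filter_upwards [eventually_gt_atTop j.toNat] with N hN
  rw [inner_sum]
  simp only [inner_charVec_charVec]
  split_ifs with hj
  · rw [Finset.sum_eq_single j.toNat]
    · rw [if_pos (by omega)]
    · intro i _ hi
      rw [if_neg (by omega)]
    · intro hi
      exact absurd (Finset.mem_range.2 hN) hi
  · refine (Finset.sum_eq_zero fun i _ => ?_).symm
    rw [if_neg (by omega)]

theorem eq_zero_of_inner_charVec {w : CircL2}
    (h : ∀ (j : ℤ) (k : ℕ), inner ℂ (charVec j (unitVec k)) w = 0) : w = 0 := by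
  have h1 : ∀ k, ∀ᵐ x ∂circ, (inner ℂ (unitVec k) (w x) : ℂ) = 0 := by
    intro k
    refine circ_ae_eq_zero ?_ fun j => ?_
    · exact ((Lp.memLp w).integrable (by norm_num)).const_inner _
    · rw [← h (-j) k, inner_charVec_left, neg_neg]
  rw [Lp.eq_zero_iff_ae_eq_zero]
  filter_upwards [ae_all_iff.2 h1] with x hx
  exact vec_ext fun k => by rw [hx, Pi.zero_apply, inner_zero_right]

/-- The spaces `e^{ijλ} ℓ₂` are orthogonal; the normalizing factor is `(2π)^{-1/2}`. -/
theorem orthogonalFamily_charVec : OrthogonalFamily ℂ (fun _ : ℕ => Vec)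
    fun j : ℕ => (⟨(((Real.sqrt (2 * Real.pi))⁻¹ : ℝ) : ℂ) • (charVec j).toLinearMap, fun v => by
      have : Real.sqrt (2 * Real.pi) ≠ 0 := by positivity
      simp only [LinearMap.smul_apply, ContinuousLinearMap.coe_coe]
      rw [norm_smul, norm_charVec, Complex.norm_real, Real.norm_of_nonneg (by positivity)]
      field_simp⟩ : Vec →ₗᵢ[ℂ] CircL2) := by
  intro i j hij v w
  change inner ℂ ((((Real.sqrt (2 * Real.pi))⁻¹ : ℝ) : ℂ) • charVec i v)
    ((((Real.sqrt (2 * Real.pi))⁻¹ : ℝ) : ℂ) • charVec j w) = 0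
  rw [inner_smul_left, inner_smul_right, inner_charVec_charVec, if_neg (by exact_mod_cast hij),
    mul_zero, mul_zero]

/-- A square integrable function without Fourier coefficients of negative index is a Fourier sum
with nonnegative indices. -/
theorem exists_isFourierSum (w : CircL2)
    (h : ∀ (j : ℤ) (k : ℕ), j < 0 → inner ℂ (charVec j (unitVec k)) w = 0) :
    ∃ c : BlockVec, IsFourierSum c w := by
  set q : ℂ := (((Real.sqrt (2 * Real.pi))⁻¹ : ℝ) : ℂ) with hq
  have hV := orthogonalFamily_charVec
  set K := (⨆ j : ℕ, LinearMap.range (q • (charVec (j : ℤ)).toLinearMap)).topologicalClosure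
    with hK
  have hrange : LinearMap.range hV.linearIsometry.toLinearMap = K := hV.range_linearIsometry
  have hq0 : q ≠ 0 := by
    rw [hq]; exact_mod_cast (by positivity : (Real.sqrt (2 * Real.pi))⁻¹ ≠ 0)
  have hmem : ∀ (j : ℕ) (v : Vec), charVec j v ∈ K := by
    intro j v
    refine Submodule.le_topologicalClosure _ (Submodule.mem_iSup_of_mem j ⟨q⁻¹ • v, ?_⟩)
    simp [hq0]
  have hneg : ∀ (j : ℤ) (k : ℕ), j < 0 → K ≤ (ℂ ∙ charVec j (unitVec k))ᗮ := by
    intro j k hj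
    refine Submodule.topologicalClosure_minimal _ (iSup_le fun i => ?_)
      (Submodule.isClosed_orthogonal _)
    rintro _ ⟨v, rfl⟩
    rw [Submodule.mem_orthogonal_singleton_iff_inner_right]
    change inner ℂ (charVec j (unitVec k)) (q • charVec i v) = 0
    rw [inner_smul_right, inner_charVec_charVec, if_neg (by omega), mul_zero]
  have : CompleteSpace K := (Submodule.isClosed_topologicalClosure _).completeSpace_coe
  -- the component of `w` orthogonal to the span of the `e^{ijλ} ℓ₂`, `j ≥ 0`, has no Fourier
  -- coefficients at all
  have hz : w - K.starProjection w = 0 := by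
    refine eq_zero_of_inner_charVec fun j k => ?_
    by_cases hj : j < 0
    · rw [inner_sub_right, h j k hj,
        Submodule.mem_orthogonal_singleton_iff_inner_right.1
          (hneg j k hj (K.starProjection_apply_mem w)), sub_zero]
    · obtain ⟨i, rfl⟩ := Int.eq_ofNat_of_zero_le (not_lt.1 hj)
      exact (K.sub_starProjection_mem_orthogonal w) _ (hmem i _)
  have hw : w ∈ LinearMap.range hV.linearIsometry.toLinearMap := by
    rw [hrange, sub_eq_zero.1 hz]
    exact K.starProjection_apply_mem w
  obtain ⟨c, hc⟩ := hw
  refine ⟨q • c, isFourierSum_iff.2 ⟨Lp.memLp w, ?_⟩⟩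
  rw [Lp.toLp_coeFn, ← hc]
  refine (hV.hasSum_linearIsometry c).tendsto_sum_nat.congr fun N => ?_
  refine Finset.sum_congr rfl fun j _ => ?_
  change q • charVec j (c j) = charVec j (q • c j)
  rw [map_smul]

section

/-! ### Stationary sequences in the frequency domain and their innovations -/

/-- `G` is the factor of a nondegenerate spectral density `G* G` of trace class with integrable
trace: `‖G(λ) v‖² ≤ S(λ) ‖v‖²` with `S` integrable. The field `G'` is the field of adjoints, and
`G'(λ)` is injective. The stationary sequence is `e^{ijλ} G(λ) δ_k`. -/
structure IsSymbol (G G' : ℝ → Vec →L[ℂ] Vec) (S : ℝ → ℝ) : Prop where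
  meas : ActsMeasurably G
  meas_adj : ActsMeasurably G'
  adj : ∀ᵐ x ∂circ, ∀ v w, (inner ℂ (G x v) w : ℂ) = inner ℂ v (G' x w)
  inj : ∀ᵐ x ∂circ, Function.Injective (G' x)
  integrable : Integrable S circ
  bound : ∀ᵐ x ∂circ, ∀ v, ‖G x v‖ ^ 2 ≤ S x * ‖v‖ ^ 2

variable {G G' : ℝ → Vec →L[ℂ] Vec} {S : ℝ → ℝ}

namespace IsSymbol

/-- The adjoints satisfy the same bound: `‖G' v‖² = ⟨G G' v, v⟩ ≤ S^{1/2} ‖G' v‖ ‖v‖`. -/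
theorem bound_adj (hG : IsSymbol G G' S) : ∀ᵐ x ∂circ, ∀ v, ‖G' x v‖ ^ 2 ≤ S x * ‖v‖ ^ 2 := by
  filter_upwards [hG.adj, hG.bound] with x hadj hb v
  have h1 : ‖G' x v‖ ^ 2 ≤ ‖G x (G' x v)‖ * ‖v‖ := by
    have h := norm_inner_le_norm (𝕜 := ℂ) (G x (G' x v)) v
    rw [hadj, inner_self_eq_norm_sq_to_K] at h
    simpa using h
  have h2 := hb (G' x v)
  by_cases h0 : ‖G' x v‖ = 0
  · rw [h0] at h2 ⊢
    have h3 := hb v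
    nlinarith [sq_nonneg ‖G x v‖]
  · have hpos : 0 < ‖G' x v‖ ^ 2 := by positivity
    have h3 : (‖G' x v‖ ^ 2) ^ 2 ≤ (S x * ‖v‖ ^ 2) * ‖G' x v‖ ^ 2 := by
      calc (‖G' x v‖ ^ 2) ^ 2 ≤ (‖G x (G' x v)‖ * ‖v‖) ^ 2 := by gcongr
        _ = ‖G x (G' x v)‖ ^ 2 * ‖v‖ ^ 2 := by ring
        _ ≤ (S x * ‖G' x v‖ ^ 2) * ‖v‖ ^ 2 := by gcongr
        _ = _ := by ring
    rw [sq (‖G' x v‖ ^ 2)] at h3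
    exact le_of_mul_le_mul_right h3 hpos

theorem memLp_apply (hG : IsSymbol G G' S) (v : Vec) : MemLp (fun x => G x v) 2 circ := by
  have hm : AEStronglyMeasurable (fun x => G x v) circ :=
    hG.meas (fun _ => v) aestronglyMeasurable_const
  rw [memLp_two_iff_integrable_sq_norm hm]
  refine (hG.integrable.mul_const (‖v‖ ^ 2)).mono' (hm.norm.pow 2) ?_
  filter_upwards [hG.bound] with x hx
  rw [Real.norm_of_nonneg (by positivity)]
  exact hx v

/-- The element `e^{ijλ} G(λ) v` of `L₂([-π, π); ℓ₂)`, linear in `v`. -/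
def element (hG : IsSymbol G G' S) (j : ℤ) : Vec →L[ℂ] CircL2 :=
  (mulChar j).toContinuousLinearMap ∘L LinearMap.mkContinuous
    { toFun := fun v => (hG.memLp_apply v).toLp _
      map_add' := fun v w => by
        rw [← MemLp.toLp_add, MemLp.toLp_eq_toLp_iff]
        exact Eventually.of_forall fun x => map_add _ _ _
      map_smul' := fun c v => by
        rw [RingHom.id_apply, ← MemLp.toLp_const_smul, MemLp.toLp_eq_toLp_iff]
        exact Eventually.of_forall fun x => map_smul _ _ _ }
    (Real.sqrt (∫ x, S x ∂circ)) fun v => by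
      have hS : 0 ≤ ∫ x, S x ∂circ := by
        refine integral_nonneg_of_ae ?_
        filter_upwards [hG.bound] with x hx
        have := hx (unitVec 0)
        rw [norm_unitVec, one_pow, mul_one] at this
        exact (sq_nonneg _).trans this
      refine le_of_sq_le_sq ?_ (by positivity)
      rw [mul_pow, Real.sq_sqrt hS, ← integral_mul_const]
      change ‖(hG.memLp_apply v).toLp _‖ ^ 2 ≤ _
      rw [@norm_sq_eq_re_inner ℂ, L2.inner_def]
      have h1 : ∫ x, inner ℂ ((hG.memLp_apply v).toLp _ x) ((hG.memLp_apply v).toLp _ x) ∂circ =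
          ((∫ x, ‖G x v‖ ^ 2 ∂circ : ℝ) : ℂ) := by
        rw [← integral_complex_ofReal]
        refine integral_congr_ae ?_
        filter_upwards [(hG.memLp_apply v).coeFn_toLp] with x hx
        rw [hx, inner_self_eq_norm_sq_to_K]
        norm_cast
      rw [h1]
      change ∫ x, ‖G x v‖ ^ 2 ∂circ ≤ _
      refine integral_mono_ae ((memLp_two_iff_integrable_sq_norm (hG.memLp_apply v).1).1
        (hG.memLp_apply v)) (hG.integrable.mul_const _) ?_
      filter_upwards [hG.bound] with x hx
      exact hx v

theorem coeFn_element (hG : IsSymbol G G' S) (j : ℤ) (v : Vec) :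
    ∀ᵐ x ∂circ, hG.element j v x = char j x • G x v := by
  filter_upwards [coeFn_mulChar j ((hG.memLp_apply v).toLp _), (hG.memLp_apply v).coeFn_toLp]
    with x hx hx2
  rw [hx2] at hx
  exact hx

theorem mulChar_element (hG : IsSymbol G G' S) (i j : ℤ) (v : Vec) :
    mulChar i (hG.element j v) = hG.element (i + j) v := by
  refine Lp.ext ?_
  filter_upwards [coeFn_mulChar i (hG.element j v), hG.coeFn_element j v,
    hG.coeFn_element (i + j) v] with x h1 h2 h3
  rw [h1, h2, h3, smul_smul, char_add]

theorem norm_element (hG : IsSymbol G G' S) (j : ℤ) (v : Vec) :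
    ‖hG.element j v‖ = ‖hG.element 0 v‖ := by
  rw [← LinearIsometry.norm_map (mulChar j) (hG.element 0 v), mulChar_element, add_zero]

theorem inner_element_left (hG : IsSymbol G G' S) (j : ℤ) (v : Vec) (w : CircL2) :
    inner ℂ (hG.element j v) w = ∫ x, char (-j) x * inner ℂ v (G' x (w x)) ∂circ := by
  rw [L2.inner_def]
  refine integral_congr_ae ?_
  filter_upwards [hG.coeFn_element j v, hG.adj] with x hx hadj
  rw [hx, inner_smul_left, conj_char, hadj]

theorem hasSum_element (hG : IsSymbol G G' S) (j : ℤ) (v : Vec) :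
    HasSum (fun k => v k • hG.element j (unitVec k)) (hG.element j v) := by
  simpa only [map_smul] using (hasSum_unitVec v).mapL (hG.element j)

theorem eq_zero_of_inner_element (hG : IsSymbol G G' S) {w : CircL2}
    (h : ∀ (j : ℤ) (k : ℕ), inner ℂ (hG.element j (unitVec k)) w = 0) : w = 0 := by
  have h1 : ∀ k, ∀ᵐ x ∂circ, (inner ℂ (unitVec k) (G' x (w x)) : ℂ) = 0 := by
    intro k
    refine circ_ae_eq_zero ?_ fun j => ?_
    · refine (L2.integrable_inner (𝕜 := ℂ) (hG.element 0 (unitVec k)) w).congr ?_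
      filter_upwards [hG.coeFn_element 0 (unitVec k), hG.adj] with x hx hadj
      rw [hx, char_zero, one_smul, hadj]
    · rw [← h (-j) k, inner_element_left, neg_neg]
  rw [Lp.eq_zero_iff_ae_eq_zero]
  filter_upwards [ae_all_iff.2 h1, hG.inj] with x hx hinj
  refine hinj (vec_ext fun k => ?_)
  rw [hx, Pi.zero_apply, map_zero, inner_zero_right]

/-- The sequence is total in `L₂([-π, π); ℓ₂)`. -/
theorem span_element_eq_top (hG : IsSymbol G G' S) :
    (Submodule.span ℂ (Set.range fun p : ℕ × ℤ => hG.element p.2 (unitVec p.1))).topologicalClosure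
      = ⊤ := by
  rw [Submodule.topologicalClosure_eq_top_iff, Submodule.eq_bot_iff]
  intro w hw
  refine hG.eq_zero_of_inner_element fun j k => ?_
  exact (Submodule.mem_orthogonal _ _).1 hw _ (Submodule.subset_span ⟨(k, j), rfl⟩)

/-- The past `M_n` of the sequence before the time `n`. -/
def past (hG : IsSymbol G G' S) (n : ℤ) : Submodule ℂ CircL2 :=
  (Submodule.span ℂ {w | ∃ (k : ℕ) (j : ℤ), j < n ∧ w = hG.element j (unitVec k)}).topologicalClosure

theorem isClosed_past (hG : IsSymbol G G' S) (n : ℤ) : IsClosed (hG.past n : Set CircL2) :=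
  Submodule.isClosed_topologicalClosure _

instance (hG : IsSymbol G G' S) (n : ℤ) : CompleteSpace (hG.past n) :=
  (hG.isClosed_past n).completeSpace_coe

theorem past_mono (hG : IsSymbol G G' S) {m n : ℤ} (h : m ≤ n) : hG.past m ≤ hG.past n := by
  refine Submodule.topologicalClosure_mono (Submodule.span_mono ?_)
  rintro _ ⟨k, j, hj, rfl⟩
  exact ⟨k, j, hj.trans_le h, rfl⟩

theorem element_mem_past (hG : IsSymbol G G' S) {j n : ℤ} (h : j < n) (v : Vec) :
    hG.element j v ∈ hG.past n := by
  refine (hG.isClosed_past n).mem_of_tendsto (hG.hasSum_element j v)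
    (Eventually.of_forall fun s => Submodule.sum_mem _ fun k _ => Submodule.smul_mem _ _ ?_)
  exact Submodule.le_topologicalClosure _ (Submodule.subset_span ⟨k, j, h, rfl⟩)

theorem mem_past_orthogonal_iff (hG : IsSymbol G G' S) {n : ℤ} {w : CircL2} :
    w ∈ (hG.past n)ᗮ ↔ ∀ (j : ℤ) (k : ℕ), j < n → inner ℂ (hG.element j (unitVec k)) w = 0 := by
  constructor
  · intro h j k hj
    exact (Submodule.mem_orthogonal _ _).1 h _ (hG.element_mem_past hj _)
  · intro h
    rw [past, Submodule.orthogonal_closure, Submodule.mem_orthogonal]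
    intro u hu
    induction hu using Submodule.span_induction with
    | mem u hu => obtain ⟨k, j, hj, rfl⟩ := hu; exact h j k hj
    | zero => exact inner_zero_left _
    | add u v _ _ hu hv => rw [inner_add_left, hu, hv, add_zero]
    | smul c u _ hu => rw [inner_smul_left, hu, mul_zero]

theorem mulChar_mem_past (hG : IsSymbol G G' S) {n : ℤ} (i : ℤ) {w : CircL2}
    (hw : w ∈ hG.past n) : mulChar i w ∈ hG.past (i + n) := by
  refine map_mem_closure (mulChar i).continuous hw fun u hu => ?_
  induction hu using Submodule.span_induction with
  | mem u hu =>
    obtain ⟨k, j, hj, rfl⟩ := hu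
    rw [mulChar_element]
    exact Submodule.subset_span ⟨k, i + j, by omega, rfl⟩
  | zero => rw [map_zero]; exact Submodule.zero_mem _
  | add u v _ _ hu hv => rw [map_add]; exact Submodule.add_mem _ hu hv
  | smul c u _ hu => rw [map_smul]; exact Submodule.smul_mem _ c hu

/-- An innovation `ε ∈ M_{n+1} ⊖ M_n` is white noise under the shift, so that its density
`‖ε(λ)‖²` is constant. -/
theorem norm_innovation (hG : IsSymbol G G' S) {n : ℤ} {w : CircL2} (h1 : w ∈ hG.past (n + 1))
    (h2 : w ∈ (hG.past n)ᗮ) : ∀ᵐ x ∂circ, ‖w x‖ = ‖w‖ / Real.sqrt (2 * Real.pi) := by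
  -- for `j < 0` the shifted innovation lies in `M_{n+1+j} ≤ M_n`
  have horth : ∀ j : ℤ, j < 0 → inner ℂ (mulChar j w) w = 0 := fun j hj =>
    (Submodule.mem_orthogonal _ _).1 h2 _ (hG.past_mono (by omega) (hG.mulChar_mem_past j h1))
  have hin : ∀ j : ℤ, inner ℂ w (mulChar j w) = ∫ x, char j x * ((‖w x‖ ^ 2 : ℝ) : ℂ) ∂circ := by
    intro j
    rw [L2.inner_def]
    refine integral_congr_ae ?_
    filter_upwards [coeFn_mulChar j w] with x hx
    rw [hx, inner_smul_right, inner_self_eq_norm_sq_to_K]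
    norm_cast
  have hint : Integrable (fun x => ((‖w x‖ ^ 2 : ℝ) : ℂ)) circ :=
    ((memLp_two_iff_integrable_sq_norm (Lp.memLp w).1).1 (Lp.memLp w)).ofReal
  -- `∫ e^{ijλ} ‖w(λ)‖² dλ = ⟨e^{ijλ} w, w⟩ = 0` for `j ≠ 0`
  have hc := circ_ae_eq_const hint fun j hj => by
    rw [← hin]
    rcases lt_or_gt_of_ne hj with hj | hj
    · rw [← inner_conj_symm, horth j hj, map_zero]
    · rw [← LinearIsometry.inner_map_map (mulChar (-j))]
      have : mulChar (-j) (mulChar j w) = w := by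
        refine Lp.ext ?_
        filter_upwards [coeFn_mulChar (-j) (mulChar j w), coeFn_mulChar j w] with x h3 h4
        rw [h3, h4, smul_smul, ← char_add, neg_add_cancel, char_zero, one_smul]
      rw [this]
      exact horth (-j) (by omega)
  have h0 := hin 0
  have hid : mulChar 0 w = w := by
    refine Lp.ext ?_
    filter_upwards [coeFn_mulChar 0 w] with x h3
    rw [h3, char_zero, one_smul]
  simp only [char_zero, one_mul, hid, inner_self_eq_norm_sq_to_K] at h0
  rw [← h0] at hc
  filter_upwards [hc] with x hx
  have hx' : ‖w x‖ ^ 2 = ‖w‖ ^ 2 / (2 * Real.pi) := by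
    apply Complex.ofReal_injective
    rw [hx]
    push_cast
    rfl
  rw [← Real.sqrt_sq (norm_nonneg (w x)), hx', Real.sqrt_div (by positivity),
    Real.sqrt_sq (norm_nonneg _)]

/-- An element of `M_n ⊖ M_0` is the sum of `n` innovations, hence bounded. -/
theorem norm_le_of_mem_past (hG : IsSymbol G G' S) (n : ℕ) {w : CircL2} (h1 : w ∈ hG.past n)
    (h2 : w ∈ (hG.past 0)ᗮ) : ∀ᵐ x ∂circ, ‖w x‖ ≤ n * (‖w‖ / Real.sqrt (2 * Real.pi)) := by
  induction n generalizing w with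
  | zero =>
    have : w = 0 := by
      have := (Submodule.mem_orthogonal _ _).1 h2 w (by simpa using h1)
      exact inner_self_eq_zero.1 this
    subst this
    filter_upwards [Lp.coeFn_zero Vec 2 circ] with x hx
    rw [hx]
    simp
  | succ n ih =>
    -- `w - p` is an innovation at the time `n`, and `p` is a sum of `n` innovations
    set p := (hG.past n).starProjection w with hp
    have hpm : p ∈ hG.past n := Submodule.starProjection_apply_mem _ w
    have hwp : w - p ∈ (hG.past n)ᗮ := Submodule.sub_starProjection_mem_orthogonal w
    have hp0 : p ∈ (hG.past 0)ᗮ := by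
      have : p = w - (w - p) := by abel
      rw [this]
      exact Submodule.sub_mem _ h2
        (Submodule.orthogonal_le (hG.past_mono (Int.natCast_nonneg n)) hwp)
    have hε := hG.norm_innovation (n := n) (w := w - p)
      (Submodule.sub_mem _ (by exact_mod_cast h1) (hG.past_mono (by omega) hpm)) hwp
    have hle : ‖p‖ ≤ ‖w‖ := Submodule.norm_starProjection_apply_le _ w
    have hle2 : ‖w - p‖ ≤ ‖w‖ := by
      have h3 : w - p = (hG.past n)ᗮ.starProjection w := by
        rw [Submodule.starProjection_orthogonal_val]
      rw [h3]
      exact Submodule.norm_starProjection_apply_le _ w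
    filter_upwards [hε, ih hpm hp0, Lp.coeFn_sub w p] with x hx1 hx2 hx3
    have hx4 : w x = (w - p) x + p x := by
      rw [hx3, Pi.sub_apply, sub_add_cancel]
    calc ‖w x‖ ≤ ‖(w - p) x‖ + ‖p x‖ := by rw [hx4]; exact norm_add_le _ _
      _ ≤ ‖w - p‖ / Real.sqrt (2 * Real.pi) + n * (‖p‖ / Real.sqrt (2 * Real.pi)) := by
          rw [hx1]; gcongr
      _ ≤ ‖w‖ / Real.sqrt (2 * Real.pi) + n * (‖w‖ / Real.sqrt (2 * Real.pi)) := by gcongr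
      _ = _ := by push_cast; ring

end IsSymbol

end

section

/-! ### The projection of the functional on the future and its boundedness -/

variable {G G' : ℝ → Vec →L[ℂ] Vec} {S : ℝ → ℝ}

/-- Convergence in mean square implies convergence almost everywhere along a subsequence. -/
theorem exists_subseq_tendsto_ae {w : ℕ → CircL2} {u : CircL2} (h : Tendsto w atTop (𝓝 u)) :
    ∃ ns : ℕ → ℕ, StrictMono ns ∧
      ∀ᵐ x ∂circ, Tendsto (fun i => w (ns i) x) atTop (𝓝 (u x)) :=
  (tendstoInMeasure_of_tendsto_Lp h).exists_seq_tendsto_ae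

namespace IsSymbol

/-- The element `G(λ) ∑_j e^{ijλ} b_j`. -/
def series (hG : IsSymbol G G' S) (b : BlockVec) : CircL2 := ∑' j : ℕ, hG.element j (b j)

theorem norm_element_le (hG : IsSymbol G G' S) (j : ℤ) (v : Vec) :
    ‖hG.element j v‖ ≤ ‖hG.element 0‖ * ‖v‖ := by
  rw [norm_element]
  exact (hG.element 0).le_opNorm v

theorem summable_element (hG : IsSymbol G G' S) {b : BlockVec} (hb : Summable fun j => ‖b j‖) :
    Summable fun j : ℕ => hG.element j (b j) :=
  Summable.of_norm_bounded (hb.mul_left _) fun j => hG.norm_element_le j (b j)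

theorem coeFn_series (hG : IsSymbol G G' S) {b : BlockVec} (hb : Summable fun j => ‖b j‖) :
    ∀ᵐ x ∂circ, hG.series b x = G x (∑' j : ℕ, Complex.exp (Complex.I * j * x) • b j) := by
  obtain ⟨ns, hns, hlim⟩ :=
    exists_subseq_tendsto_ae (hG.summable_element hb).hasSum.tendsto_sum_nat
  filter_upwards [hlim, ae_all_iff.2 fun j : ℕ => hG.coeFn_element j (b j),
    ae_all_iff.2 fun N : ℕ => Lp.coeFn_finsetSum (Finset.range N)
      fun j : ℕ => hG.element j (b j)] with x h1 h2 h3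
  have hsum : Summable fun j : ℕ => Complex.exp (Complex.I * j * x) • b j := by
    refine Summable.of_norm_bounded hb fun j => ?_
    rw [← char_natCast, norm_smul, norm_char, one_mul]
  have h4 := (hsum.hasSum.mapL (G x)).tendsto_sum_nat.comp hns.tendsto_atTop
  refine tendsto_nhds_unique h1 (h4.congr fun i => ?_)
  rw [Function.comp_apply, h3, Finset.sum_apply]
  refine Finset.sum_congr rfl fun j _ => ?_
  rw [h2, map_smul, char_natCast]

theorem inner_element_of_ae_eq (hG : IsSymbol G G' S) {z : CircL2} {X : ℝ → Vec}
    (hX : MemLp X 2 circ) (hz : ∀ᵐ x ∂circ, G' x (z x) = X x) (j : ℤ) (v : Vec) :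
    inner ℂ (hG.element j v) z = inner ℂ (charVec j v) (hX.toLp X) := by
  rw [inner_element_left, inner_charVec_left]
  refine integral_congr_ae ?_
  filter_upwards [hz, hX.coeFn_toLp] with x h1 h2
  rw [h1, h2]

/-- `z` is orthogonal to the past if `G' z` has only Fourier coefficients of nonnegative index. -/
theorem mem_past_orthogonal_of_isFourierSum (hG : IsSymbol G G' S) {z : CircL2} {X : ℝ → Vec}
    {c : BlockVec} (hX : IsFourierSum c X) (hz : ∀ᵐ x ∂circ, G' x (z x) = X x) :
    z ∈ (hG.past 0)ᗮ := by
  obtain ⟨hm, _⟩ := isFourierSum_iff.1 hX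
  rw [mem_past_orthogonal_iff]
  intro j k hj
  rw [hG.inner_element_of_ae_eq hm hz, hX.inner_charVec, if_neg (by omega)]

theorem inner_series_right (hG : IsSymbol G G' S) {z : CircL2} {X : ℝ → Vec}
    {c b : BlockVec} (hb : Summable fun j => ‖b j‖) (hX : IsFourierSum c X)
    (hz : ∀ᵐ x ∂circ, G' x (z x) = X x) :
    inner ℂ z (hG.series b) = 2 * Real.pi * inner ℂ c b := by
  obtain ⟨hm, _⟩ := isFourierSum_iff.1 hX
  have h1 := (hG.summable_element hb).hasSum.mapL (innerSL ℂ z)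
  have h2 := (lp.hasSum_inner c b).mul_left (2 * Real.pi : ℂ)
  have h3 : ∀ j : ℕ, innerSL ℂ z (hG.element j (b j)) = 2 * Real.pi * inner ℂ (c j) (b j) := by
    intro j
    rw [innerSL_apply_apply, ← inner_conj_symm, hG.inner_element_of_ae_eq hm hz, hX.inner_charVec,
      if_pos (Int.natCast_nonneg j), map_mul, inner_conj_symm, Int.toNat_natCast]
    simp [map_ofNat]
  simp only [h3] at h1
  exact h1.unique h2

/-- The part `v` of `G(λ) ∑_j e^{ijλ} b_j` orthogonal to the past. The summability of
`(j + 1) ‖b_j‖` makes `v` bounded, since its `j`-th term is a sum of `j + 1` innovations;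
therefore `G' v` is square integrable, and its Fourier coefficients of negative index vanish. -/
theorem exists_projection (hG : IsSymbol G G' S) (b : BlockVec)
    (hb : Summable fun j : ℕ => ((j : ℝ) + 1) * ‖b j‖) :
    ∃ (v : CircL2) (c : BlockVec), v ∈ (hG.past 0)ᗮ ∧ hG.series b - v ∈ hG.past 0 ∧
      IsFourierSum c fun x => G' x (v x) := by
  have hb' : Summable fun j => ‖b j‖ := hb.of_nonneg_of_le (fun _ => norm_nonneg _) fun j =>
    le_mul_of_one_le_left (norm_nonneg _) (by linarith [Nat.cast_nonneg (α := ℝ) j])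
  set Q := (hG.past 0)ᗮ.starProjection with hQ
  set v := Q (hG.series b) with hv
  have hvQ : ∀ u, Q u = u - (hG.past 0).starProjection u := fun u => by
    rw [hQ, Submodule.starProjection_orthogonal_val]
  have hv0 : v ∈ (hG.past 0)ᗮ := Submodule.starProjection_apply_mem _ _
  set K := ‖hG.element 0‖ / Real.sqrt (2 * Real.pi) with hK
  have hterm : ∀ j : ℕ, ∀ᵐ x ∂circ, ‖Q (hG.element j (b j)) x‖ ≤ K * (((j : ℝ) + 1) * ‖b j‖) := by
    intro j
    have hmem : Q (hG.element j (b j)) ∈ hG.past ((j + 1 : ℕ) : ℤ) := by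
      rw [hvQ]
      exact Submodule.sub_mem _ (hG.element_mem_past (by push_cast; omega) _)
        (hG.past_mono (by positivity) (Submodule.starProjection_apply_mem _ _))
    filter_upwards [hG.norm_le_of_mem_past (j + 1) hmem (Submodule.starProjection_apply_mem _ _)]
      with x hx
    have h1 : ‖Q (hG.element j (b j))‖ ≤ ‖hG.element 0‖ * ‖b j‖ :=
      (Submodule.norm_starProjection_apply_le _ _).trans (hG.norm_element_le _ _)
    calc _ ≤ ((j + 1 : ℕ) : ℝ) * (‖Q (hG.element j (b j))‖ / Real.sqrt (2 * Real.pi)) := hx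
      _ ≤ ((j + 1 : ℕ) : ℝ) * ((‖hG.element 0‖ * ‖b j‖) / Real.sqrt (2 * Real.pi)) := by gcongr
      _ = _ := by rw [hK]; push_cast; ring
  set R := ∑' j : ℕ, K * (((j : ℝ) + 1) * ‖b j‖) with hR
  have hbound : ∀ᵐ x ∂circ, ‖v x‖ ≤ R := by
    have hsum : HasSum (fun j : ℕ => Q (hG.element j (b j))) v :=
      (hG.summable_element hb').hasSum.mapL Q
    obtain ⟨ns, -, hlim⟩ := exists_subseq_tendsto_ae hsum.tendsto_sum_nat
    filter_upwards [hlim, ae_all_iff.2 hterm, ae_all_iff.2 fun N : ℕ =>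
      Lp.coeFn_finsetSum (Finset.range N) fun j : ℕ => Q (hG.element j (b j))] with x h1 h2 h3
    refine le_of_tendsto h1.norm (Eventually.of_forall fun i => ?_)
    rw [h3, Finset.sum_apply]
    refine (norm_sum_le _ _).trans ((Finset.sum_le_sum fun j _ => h2 j).trans ?_)
    exact (hb.mul_left K).sum_le_tsum _ fun j _ => by positivity
  have hXm : AEStronglyMeasurable (fun x => G' x (v x)) circ := hG.meas_adj _ (Lp.memLp v).1
  have hX : MemLp (fun x => G' x (v x)) 2 circ := by
    rw [memLp_two_iff_integrable_sq_norm hXm]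
    refine (hG.integrable.norm.mul_const (R ^ 2)).mono' (hXm.norm.pow 2) ?_
    filter_upwards [hG.bound_adj, hbound] with x h1 h2
    rw [Real.norm_of_nonneg (by positivity)]
    have h3 : ‖v x‖ ^ 2 ≤ R ^ 2 := by gcongr
    calc _ ≤ S x * ‖v x‖ ^ 2 := h1 _
      _ ≤ ‖S x‖ * ‖v x‖ ^ 2 := by gcongr; exact le_abs_self _
      _ ≤ _ := by gcongr
  obtain ⟨c, hc⟩ := exists_isFourierSum (hX.toLp _) fun j k hj => by
    rw [← hG.inner_element_of_ae_eq hX (Eventually.of_forall fun _ => rfl)]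
    exact hG.mem_past_orthogonal_iff.1 hv0 j k hj
  refine ⟨v, c, hv0, ?_, ?_⟩
  · rw [hv, hvQ, sub_sub_cancel]
    exact Submodule.starProjection_apply_mem _ _
  · refine ⟨hXm, ?_⟩
    refine hc.tendsto.congr fun N => lintegral_congr_ae ?_
    filter_upwards [hX.coeFn_toLp] with x hx
    rw [hx]

end IsSymbol

end

section

/-! ### The symbol of the increment sequence -/

/-- The exceptional points `0` and `2πn/τ` form a countable set. -/
theorem ae_circ_regular (τ : ℕ) (hτ : 1 ≤ τ) :
    ∀ᵐ x : ℝ ∂circ, x ≠ 0 ∧ Complex.exp (Complex.I * x * τ) ≠ 1 := by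
  have hc : {x : ℝ | ¬ (x ≠ 0 ∧ Complex.exp (Complex.I * x * τ) ≠ 1)}.Countable := by
    refine (Set.countable_range fun n : ℤ => (n * (2 * Real.pi) / τ : ℝ)).mono ?_
    intro x hx
    have hτ0 : (τ : ℂ) ≠ 0 := by exact_mod_cast (by omega : τ ≠ 0)
    have hτ1 : (τ : ℝ) ≠ 0 := by exact_mod_cast (by omega : τ ≠ 0)
    rw [Set.mem_ofPred_eq, not_and_or, not_not, not_not] at hx
    rcases hx with rfl | hx
    · exact ⟨0, by simp⟩
    · obtain ⟨n, hn⟩ := Complex.exp_eq_one_iff.1 hx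
      refine ⟨n, ?_⟩
      have h1 : Complex.I * (x * τ : ℂ) = Complex.I * (n * (2 * Real.pi)) := by
        linear_combination hn
      have h2 := mul_left_cancel₀ Complex.I_ne_zero h1
      have h3 : x * τ = n * (2 * Real.pi) := by exact_mod_cast h2
      change (n * (2 * Real.pi) / τ : ℝ) = x
      rw [← h3]
      field_simp
  exact ae_restrict_of_ae (hc.ae_notMem volume |>.mono fun x hx => by
    simpa only [Set.mem_ofPred_eq, not_not] using hx)

theorem conj_phi (d τ : ℕ) (x : ℝ) : conj (phi d τ x) =
    (1 - Complex.exp (Complex.I * x * τ)) ^ d / (-(Complex.I * x)) ^ d := by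
  rw [phi, map_div₀, map_pow, map_pow, map_sub, map_one, ← Complex.exp_conj]
  simp

theorem ae_phi_ne_zero (d τ : ℕ) (hτ : 1 ≤ τ) : ∀ᵐ x ∂circ, phi d τ x ≠ 0 := by
  filter_upwards [ae_circ_regular τ hτ] with x ⟨h1, h2⟩
  intro h
  have h3 := congrArg conj h
  rw [conj_phi, map_zero] at h3
  have hx : (-(Complex.I * x) : ℂ) ≠ 0 := by simpa using h1
  rw [div_eq_zero_iff] at h3
  rcases h3 with h3 | h3
  · exact pow_ne_zero d (sub_ne_zero.2 h2.symm) h3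
  · exact pow_ne_zero _ hx h3

theorem phi_measurable (d τ : ℕ) : Measurable (phi d τ) := by
  unfold phi
  fun_prop

/-- `w = |φ|^{-2}`; both sides are zero where `φ` is, by the convention `0⁻¹ = 0`. -/
theorem weight_eq (d τ : ℕ) (x : ℝ) : weight d τ x = (‖phi d τ x‖ ^ 2)⁻¹ := by
  have h : ‖phi d τ x‖ = ‖1 - Complex.exp (Complex.I * x * τ)‖ ^ d / |x| ^ d := by
    rw [← RCLike.norm_conj, conj_phi]
    simp
  rw [h, weight, div_pow, ← pow_mul, ← pow_mul, mul_comm d 2, inv_div, pow_mul |x|, sq_abs,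
    ← pow_mul]

/-- `φ(λ) f(λ)^{1/2}`. -/
def symbol (d τ : ℕ) (f : ℝ → Vec →L[ℂ] Vec) (x : ℝ) : Vec →L[ℂ] Vec :=
  phi d τ x • sqrtOp (f x)

/-- The adjoint of `φ(λ) f(λ)^{1/2}`. -/
def symbolAdj (d τ : ℕ) (f : ℝ → Vec →L[ℂ] Vec) (x : ℝ) : Vec →L[ℂ] Vec :=
  conj (phi d τ x) • sqrtOp (f x)

variable {d τ : ℕ} {f : ℝ → Vec →L[ℂ] Vec}

theorem IsMinimal.injective (hmin : IsMinimal d τ f) :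
    ∀ᵐ x ∂circ, Function.Injective (sqrtOp (f x)) := by
  choose y hy using hmin
  filter_upwards [ae_all_iff.2 fun k => (hy k).sqrt_eq] with x hx
  exact sqrtOp_injective fun k => ⟨y k x, hx k⟩

/-- Under the minimality condition the trace condition makes `φ f^{1/2}` a symbol. -/
theorem exists_isSymbol (hτ : 1 ≤ τ)
    (hm : ∀ k n, AEStronglyMeasurable (fun x => entry (f x) k n) circ)
    (hpos : ∀ᵐ x ∂circ, (f x).IsPositive)
    (hker : ∫⁻ x, ∑' k, ENNReal.ofReal (‖phi d τ x‖ ^ 2 * (entry (f x) k k).re) ∂circ < ∞)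
    (hmin : IsMinimal d τ f) : ∃ S, IsSymbol (symbol d τ f) (symbolAdj d τ f) S := by
  have hs : ActsMeasurably fun x => sqrtOp (f x) := (actsMeasurably_of_entry hm).sqrtOp hpos
  have hφ : AEStronglyMeasurable (phi d τ) circ := (phi_measurable d τ).aestronglyMeasurable
  have hg : ∀ k, AEMeasurable
      (fun x => ENNReal.ofReal (‖phi d τ x‖ ^ 2 * (entry (f x) k k).re)) circ := fun k =>
    (((hφ.norm.pow 2).mul (Complex.continuous_re.comp_aestronglyMeasurable
      (hm k k))).aemeasurable).ennreal_ofReal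
  -- `S` is the trace `Tr (|φ|² f)`
  refine ⟨fun x => (∑' k, ENNReal.ofReal (‖phi d τ x‖ ^ 2 * (entry (f x) k k).re)).toReal,
    ⟨?_, ?_, ?_, ?_, ?_, ?_⟩⟩
  · exact fun v hv => hφ.smul (hs v hv)
  · exact fun v hv => (Complex.continuous_conj.comp_aestronglyMeasurable hφ).smul (hs v hv)
  · refine Eventually.of_forall fun x v w => ?_
    simp only [symbol, symbolAdj, FunLike.coe_smul, Pi.smul_apply]
    rw [inner_smul_left, inner_smul_right, sqrtOp_symm]
  · filter_upwards [hmin.injective, ae_phi_ne_zero d τ hτ] with x hinj h0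
    intro v w hvw
    simp only [symbolAdj, FunLike.coe_smul, Pi.smul_apply] at hvw
    exact hinj (smul_right_injective _ ((map_ne_zero _).2 h0) hvw)
  · exact integrable_toReal_of_lintegral_ne_top (AEMeasurable.tsum hg) hker.ne
  · filter_upwards [ae_lt_top' (AEMeasurable.tsum hg) hker.ne, hpos,
      ae_phi_ne_zero d τ hτ] with x hx hp h0 v
    have hre : ∀ k, 0 ≤ (entry (f x) k k).re := fun k => by
      rw [← inner_sqrtOp_unitVec hp]
      exact inner_self_nonneg (𝕜 := ℂ)
    have h1 := ENNReal.hasSum_toReal hx.ne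
    rw [← ENNReal.tsum_toReal_eq fun k => ENNReal.ofReal_ne_top] at h1
    have hφ0 : 0 < ‖phi d τ x‖ ^ 2 := by positivity
    have h2 : ∀ k, (ENNReal.ofReal (‖phi d τ x‖ ^ 2 * (entry (f x) k k).re)).toReal =
        ‖phi d τ x‖ ^ 2 * (entry (f x) k k).re := fun k =>
      ENNReal.toReal_ofReal (mul_nonneg hφ0.le (hre k))
    simp only [h2] at h1
    have h3 := h1.mul_left (‖phi d τ x‖ ^ 2)⁻¹
    simp only [inv_mul_cancel_left₀ hφ0.ne'] at h3
    have h4 := norm_sqrtOp_sq_le hp h3 v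
    simp only [symbol, FunLike.coe_smul, Pi.smul_apply]
    rw [norm_smul, mul_pow]
    calc _ ≤ ‖phi d τ x‖ ^ 2 * ((‖phi d τ x‖ ^ 2)⁻¹ * _ * ‖v‖ ^ 2) := by gcongr
      _ = _ := by field_simp

/-! ### The form of `F_τ` -/

variable {S : ℝ → ℝ}

/-- The substitution `y = conj φ · z` turns the form of `F_τ` into the inner product of
`L₂([-π, π); ℓ₂)`. -/
theorem IsFormElement.exists_circL2 (hτ : 1 ≤ τ) {c : BlockVec} {y : ℝ → Vec}
    (h : IsFormElement d τ f c y) : ∃ (z : CircL2) (X : ℝ → Vec), IsFourierSum c X ∧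
      (∀ᵐ x ∂circ, symbolAdj d τ f x (z x) = X x) ∧
      ∀ᵐ x ∂circ, y x = conj (phi d τ x) • z x := by
  obtain ⟨X, hX, hy⟩ := h
  have hm : AEStronglyMeasurable (fun x => (conj (phi d τ x))⁻¹ • y x) circ :=
    ((Complex.continuous_conj.measurable.comp (phi_measurable d τ)).inv.aestronglyMeasurable).smul
      hy.measurable
  have hz : MemLp (fun x => (conj (phi d τ x))⁻¹ • y x) 2 circ := by
    refine (memLp_two_iff hm).2 (lt_of_eq_of_lt (lintegral_congr fun x => ?_) hy.finite)
    rw [enorm_smul, mul_pow, weight_eq, ← ofReal_norm, ← ofReal_norm, ← ENNReal.ofReal_pow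
      (norm_nonneg _), ← ENNReal.ofReal_pow (norm_nonneg _), ← ENNReal.ofReal_mul (by positivity)]
    congr 2
    rw [norm_inv, RCLike.norm_conj, inv_pow]
  have hy' : ∀ᵐ x ∂circ, y x = conj (phi d τ x) • hz.toLp _ x := by
    filter_upwards [hz.coeFn_toLp, ae_phi_ne_zero d τ hτ] with x h1 h2
    rw [h1, smul_smul, mul_inv_cancel₀ ((map_ne_zero _).2 h2), one_smul]
  refine ⟨hz.toLp _, X, hX, ?_, hy'⟩
  filter_upwards [hy', hy.sqrt_eq] with x h1 h2
  rw [← h2, h1, map_smul]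
  rfl

theorem isFormElement_of_circL2 (hτ : 1 ≤ τ) {c : BlockVec} {z : CircL2}
    (h : IsFourierSum c fun x => symbolAdj d τ f x (z x)) :
    IsFormElement d τ f c fun x => conj (phi d τ x) • z x := by
  refine ⟨_, h, ?_, ?_, ?_⟩
  · exact ((Complex.continuous_conj.measurable.comp
      (phi_measurable d τ)).aestronglyMeasurable).smul (Lp.memLp z).1
  · exact Eventually.of_forall fun x => map_smul _ _ _
  · have h1 := (memLp_two_iff (Lp.memLp z).1).1 (Lp.memLp z)
    refine lt_of_eq_of_lt (lintegral_congr_ae ?_) h1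
    filter_upwards [ae_phi_ne_zero d τ hτ] with x h0
    have h2 : ‖phi d τ x‖ ≠ 0 := norm_ne_zero_iff.2 h0
    rw [weight_eq, norm_smul, RCLike.norm_conj, mul_pow, inv_mul_cancel_left₀ (pow_ne_zero 2 h2),
      ENNReal.ofReal_pow (norm_nonneg _), ofReal_norm]

theorem formPairing_eq (hτ : 1 ≤ τ) {y y' : ℝ → Vec} {z z' : CircL2}
    (h : ∀ᵐ x ∂circ, y x = conj (phi d τ x) • z x)
    (h' : ∀ᵐ x ∂circ, y' x = conj (phi d τ x) • z' x) :
    formPairing d τ y y' = (1 / (2 * Real.pi) : ℂ) * inner ℂ z' z := by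
  rw [formPairing, L2.inner_def]
  congr 1
  refine integral_congr_ae ?_
  filter_upwards [h, h', ae_phi_ne_zero d τ hτ] with x h1 h2 h0
  rw [h1, h2, inner_smul_left, inner_smul_right, weight_eq, RingHomCompTriple.comp_apply,
    RingHom.id_apply, ← mul_assoc (phi d τ x), Complex.mul_conj, ← mul_assoc,
    Complex.normSq_eq_norm_sq, ← Complex.ofReal_mul,
    inv_mul_cancel₀ (pow_ne_zero 2 (norm_ne_zero_iff.2 h0)), Complex.ofReal_one, one_mul]

/-- `F_τ c = b` in terms of the projection of `φ f^{1/2} B` on the orthogonal complement of the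
past. -/
theorem isFApply_of_projection (hτ : 1 ≤ τ) (hG : IsSymbol (symbol d τ f) (symbolAdj d τ f) S)
    {b c : BlockVec} (hb : Summable fun j => ‖b j‖) {v : CircL2}
    (hv : hG.series b - v ∈ hG.past 0)
    (hc : IsFourierSum c fun x => symbolAdj d τ f x (v x)) : IsFApply d τ f c b := by
  refine ⟨_, isFormElement_of_circL2 hτ hc, fun x y hy => ?_⟩
  obtain ⟨z, X, hX, hz, hyz⟩ := hy.exists_circL2 hτ
  rw [formPairing_eq hτ (Eventually.of_forall fun _ => rfl) hyz]
  have h1 : inner ℂ z v = inner ℂ z (hG.series b) := by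
    have h2 := (Submodule.mem_orthogonal' _ _).1
      (hG.mem_past_orthogonal_of_isFourierSum hX hz) _ hv
    rw [inner_sub_right, sub_eq_zero] at h2
    exact h2.symm
  rw [h1, hG.inner_series_right hb hX hz, ← mul_assoc]
  have : (Real.pi : ℂ) ≠ 0 := by exact_mod_cast Real.pi_ne_zero
  field_simp

theorem IsFourierSum.unique {c : BlockVec} {C C' : ℝ → Vec} (h : IsFourierSum c C)
    (h' : IsFourierSum c C') : C =ᵐ[circ] C' := by
  obtain ⟨h1, ht⟩ := isFourierSum_iff.1 h
  obtain ⟨h2, ht'⟩ := isFourierSum_iff.1 h'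
  exact (MemLp.toLp_eq_toLp_iff h1 h2).1 (tendsto_nhds_unique ht ht')

theorem IsFourierSum.sub {c c' : BlockVec} {C C' : ℝ → Vec} (h : IsFourierSum c C)
    (h' : IsFourierSum c' C') : IsFourierSum (c - c') (C - C') := by
  obtain ⟨h1, ht⟩ := isFourierSum_iff.1 h
  obtain ⟨h2, ht'⟩ := isFourierSum_iff.1 h'
  refine isFourierSum_iff.2 ⟨h1.sub h2, ?_⟩
  rw [MemLp.toLp_sub h1 h2]
  refine (ht.sub ht').congr fun N => ?_
  rw [← Finset.sum_sub_distrib]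
  exact Finset.sum_congr rfl fun j _ => (map_sub _ _ _).symm

theorem IsFourierSum.eq_zero {c : BlockVec} {C : ℝ → Vec} (h : IsFourierSum c C)
    (h0 : C =ᵐ[circ] 0) : c = 0 := by
  obtain ⟨h1, -⟩ := isFourierSum_iff.1 h
  have h2 : h1.toLp C = 0 := by
    rw [Lp.eq_zero_iff_ae_eq_zero]
    exact h1.coeFn_toLp.trans h0
  refine lp.ext (funext fun j => vec_ext fun k => ?_)
  have h3 := h.inner_charVec h1 (unitVec k) j
  rw [h2, inner_zero_right, if_pos (Int.natCast_nonneg j), Int.toNat_natCast] at h3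
  have : (Real.pi : ℂ) ≠ 0 := by exact_mod_cast Real.pi_ne_zero
  rw [lp.coeFn_zero, Pi.zero_apply, inner_zero_right]
  simpa [this] using h3.symm

/-- The function `f^{-1/2} C` of a form element is unique. -/
theorem IsFormElement.unique (hinj : ∀ᵐ x ∂circ, Function.Injective (sqrtOp (f x)))
    {c : BlockVec} {y y' : ℝ → Vec} (h : IsFormElement d τ f c y)
    (h' : IsFormElement d τ f c y') : y =ᵐ[circ] y' := by
  obtain ⟨C, hC, hy⟩ := h
  obtain ⟨C', hC', hy'⟩ := h'
  filter_upwards [hinj, hC.unique hC', hy.sqrt_eq, hy'.sqrt_eq] with x h1 h2 h3 h4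
  exact h1 (by rw [h3, h4, h2])

theorem IsFormElement.sub (hτ : 1 ≤ τ) {c c' : BlockVec} {y y' : ℝ → Vec}
    (h : IsFormElement d τ f c y) (h' : IsFormElement d τ f c' y') :
    ∃ z : CircL2, IsFormElement d τ f (c - c') (fun x => conj (phi d τ x) • z x) ∧
      ∀ᵐ x ∂circ, y x - y' x = conj (phi d τ x) • z x := by
  obtain ⟨z, X, hX, hz, hy⟩ := h.exists_circL2 hτ
  obtain ⟨z', X', hX', hz', hy'⟩ := h'.exists_circL2 hτ
  have hsub := Lp.coeFn_sub z z'
  refine ⟨z - z', isFormElement_of_circL2 hτ ?_, ?_⟩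
  · have h1 := hX.sub hX'
    have h2 : (X - X') =ᵐ[circ] fun x => symbolAdj d τ f x ((z - z' : CircL2) x) := by
      filter_upwards [hz, hz', hsub] with x h3 h4 h5
      rw [h5, Pi.sub_apply, Pi.sub_apply, map_sub, h3, h4]
    refine ⟨h1.measurable.congr h2, h1.tendsto.congr fun N => lintegral_congr_ae ?_⟩
    filter_upwards [h2] with x hx
    rw [hx]
  · filter_upwards [hy, hy', hsub] with x h3 h4 h5
    rw [h5, Pi.sub_apply, smul_sub, h3, h4]

/-- The form is positive definite, so its value at the difference of two solutions shows that they
coincide. -/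
theorem IsFApply.unique (hτ : 1 ≤ τ) {b c c' : BlockVec} (h : IsFApply d τ f c b)
    (h' : IsFApply d τ f c' b) : c = c' := by
  obtain ⟨y, hy, hF⟩ := h
  obtain ⟨y', hy', hF'⟩ := h'
  obtain ⟨z, hz, hyz⟩ := hy.sub hτ hy'
  obtain ⟨u, -, -, -, hu⟩ := hy.exists_circL2 hτ
  obtain ⟨u', -, -, -, hu'⟩ := hy'.exists_circL2 hτ
  have h1 := (hF _ _ hz).trans (hF' _ _ hz).symm
  rw [formPairing_eq hτ hu (Eventually.of_forall fun _ => rfl),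
    formPairing_eq hτ hu' (Eventually.of_forall fun _ => rfl)] at h1
  have hpi : (1 / (2 * Real.pi) : ℂ) ≠ 0 := by simp
  have h2 := mul_left_cancel₀ hpi h1
  rw [← sub_eq_zero, ← inner_sub_right] at h2
  have h3 : u - u' = z := by
    refine Lp.ext ?_
    filter_upwards [hu, hu', hyz, Lp.coeFn_sub u u', ae_phi_ne_zero d τ hτ] with x a1 a2 a3 a4 a5
    rw [a4, Pi.sub_apply]
    refine smul_right_injective _ ((map_ne_zero (starRingEnd ℂ)).2 a5) ?_
    change conj (phi d τ x) • (u x - u' x) = _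
    rw [smul_sub, ← a1, ← a2, a3]
  rw [h3, inner_self_eq_zero] at h2
  subst h2
  obtain ⟨X, hX, hyX⟩ := hz
  refine sub_eq_zero.1 (hX.eq_zero ?_)
  filter_upwards [hyX.sqrt_eq, Lp.coeFn_zero Vec 2 circ] with x h4 h5
  rw [← h4, h5, Pi.zero_apply, smul_zero, map_zero]

/-! ### The matrix of the form -/

theorem isFourierSum_unitBlock (j k : ℕ) :
    IsFourierSum (unitBlock j k) fun x => char j x • unitVec k := by
  refine ⟨(char_aestronglyMeasurable j).smul_const _, ?_⟩
  refine tendsto_const_nhds.congr' ?_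
  filter_upwards [eventually_gt_atTop j] with N hN
  have : ∀ x : ℝ, ∑ i ∈ Finset.range N, Complex.exp (Complex.I * i * x) • unitBlock j k i =
      char j x • unitVec k := by
    intro x
    rw [Finset.sum_eq_single j]
    · rw [unitBlock, lp.single_apply_self, char_natCast]
    · intro i _ hi
      rw [unitBlock, lp.single_apply_ne _ _ _ hi, smul_zero]
    · intro hj
      exact absurd (Finset.mem_range.2 hN) hj
  simp [this]

theorem isFormElement_unitBlock {k : ℕ} {y : ℝ → Vec}
    (hy : IsInvSqrt d τ f (fun _ => unitVec k) y) (j : ℕ) :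
    IsFormElement d τ f (unitBlock j k) fun x => char j x • y x := by
  refine ⟨_, isFourierSum_unitBlock j k, ?_, ?_, ?_⟩
  · exact (char_aestronglyMeasurable j).smul hy.measurable
  · filter_upwards [hy.sqrt_eq] with x hx
    rw [map_smul, hx]
  · simpa only [norm_smul, norm_char, one_mul] using hy.finite

theorem formPairing_unitBlock (hmin : IsMinimal d τ f) {j l k n : ℕ} {y z : ℝ → Vec}
    (hy : IsFormElement d τ f (unitBlock l n) y) (hz : IsFormElement d τ f (unitBlock j k) z) :
    formPairing d τ y z = fMatrix d τ f j l k n := by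
  have hinj := hmin.injective
  choose q hq using hmin
  rw [formPairing, fMatrix]
  congr 1
  refine integral_congr_ae ?_
  filter_upwards [hinj, hy.unique hinj (isFormElement_unitBlock (hq n) l),
    hz.unique hinj (isFormElement_unitBlock (hq k) j), (hq n).sqrt_eq, (hq k).sqrt_eq]
    with x h0 h1 h2 h3 h4
  have hinv : ∀ {v w : Vec}, sqrtOp (f x) w = v → invSqrtVec (f x) v = w := fun {v w} h => by
    have hex : ∃ y, sqrtOp (f x) y = v := ⟨w, h⟩
    rw [invSqrtVec, dif_pos hex]
    exact h0 (hex.choose_spec.trans h.symm)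
  rw [h1, h2, hinv h3, hinv h4, inner_smul_left, inner_smul_right, conj_char, ← mul_assoc (char _ _),
    ← char_add, char]
  have : Complex.I * ((-(j : ℤ) + (l : ℤ) : ℤ) : ℂ) * x = -(Complex.I * x * ((j : ℂ) - l)) := by
    push_cast
    ring
  rw [this]
  ring

end

section

/-! ### Step functions and the spectral stochastic process -/

/-- A function with zero primitive vanishes almost everywhere, by Lebesgue differentiation. -/
theorem ae_eq_zero_of_intervalIntegral_eq_zero {g : ℝ → ℂ} {a b : ℝ} (hab : a ≤ b)
    (hg : IntervalIntegrable g volume a b)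
    (h : ∀ t ∈ Set.Icc a b, ∫ x in a..t, g x = 0) : ∀ᵐ x, x ∈ Set.Ioo a b → g x = 0 := by
  filter_upwards [hg.ae_hasDerivAt_integral] with x hx hxab
  have h1 := hx (by rw [Set.uIcc_of_le hab]; exact Set.Ioo_subset_Icc_self hxab) a
    Set.left_mem_uIcc
  have h2 : HasDerivAt (fun t => ∫ x in a..t, g x) 0 x := by
    refine (hasDerivAt_const x (0 : ℂ)).congr_of_eventuallyEq ?_
    filter_upwards [isOpen_Ioo.mem_nhds hxab] with t ht
    exact h t (Set.Ioo_subset_Icc_self ht)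
  exact h1.unique h2

/-- The function `f^{1/2} δ_k (1_{λ < t} - 1_{λ < s})`; for `s ≤ t` it is `f^{1/2} 1_{[s,t)} δ_k`. -/
def cut (f : ℝ → Vec →L[ℂ] Vec) (k : ℕ) (s t x : ℝ) : Vec :=
  ((Set.Iio t).indicator 1 x - (Set.Iio s).indicator 1 x : ℂ) • sqrtOp (f x) (unitVec k)

open Classical in
/-- The function `cut` as an element of `L₂([-π, π); ℓ₂)`, zero if it is not square integrable. -/
def cutElem (f : ℝ → Vec →L[ℂ] Vec) (k : ℕ) (s t : ℝ) : CircL2 :=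
  if h : MemLp (cut f k s t) 2 circ then h.toLp _ else 0

theorem cut_of_le (f : ℝ → Vec →L[ℂ] Vec) (k : ℕ) {s t : ℝ} (hst : s ≤ t) (x : ℝ) :
    cut f k s t x = (Set.Ico s t).indicator (1 : ℝ → ℂ) x • sqrtOp (f x) (unitVec k) := by
  rw [cut]
  congr 1
  simp only [Set.indicator_apply, Set.mem_Iio, Set.mem_Ico, Pi.one_apply]
  grind

theorem cut_add (f : ℝ → Vec →L[ℂ] Vec) (k : ℕ) (r s t x : ℝ) :
    cut f k r s x + cut f k s t x = cut f k r t x := by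
  rw [cut, cut, cut, ← add_smul]
  congr 1
  ring

variable {d τ : ℕ} {f : ℝ → Vec →L[ℂ] Vec}

theorem norm_sqrtOp_unitVec_sq {A : Vec →L[ℂ] Vec} (hA : A.IsPositive) (k : ℕ) :
    ‖sqrtOp A (unitVec k)‖ ^ 2 = ‖entry A k k‖ := by
  rw [← inner_sqrtOp_unitVec hA, inner_self_eq_norm_sq_to_K]
  simp

theorem memLp_cut (hs : ActsMeasurably fun x => sqrtOp (f x))
    (hpos : ∀ᵐ x ∂circ, (f x).IsPositive) {k : ℕ} {s t : ℝ}
    (h : IntervalIntegrable (fun x => entry (f x) k k) volume s t) :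
    MemLp (cut f k s t) 2 circ := by
  have hm : AEStronglyMeasurable (cut f k s t) circ := by
    refine AEStronglyMeasurable.smul
      (f := fun x => ((Set.Iio t).indicator 1 x - (Set.Iio s).indicator 1 x : ℂ)) ?_
      (hs _ aestronglyMeasurable_const)
    exact ((measurable_one.indicator measurableSet_Iio).sub
      (measurable_one.indicator measurableSet_Iio)).aestronglyMeasurable
  rw [memLp_two_iff_integrable_sq_norm hm]
  have hI : Integrable ((Set.uIcc s t).indicator fun x => ‖entry (f x) k k‖) circ := by
    rw [integrable_indicator_iff measurableSet_uIcc]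
    rw [intervalIntegrable_iff'] at h
    exact h.norm.mono_measure
      (Measure.restrict_mono le_rfl Measure.restrict_le_self)
  refine hI.mono' (hm.norm.pow 2) ?_
  filter_upwards [hpos] with x hx
  rw [Real.norm_of_nonneg (by positivity), cut, norm_smul, mul_pow, norm_sqrtOp_unitVec_sq hx]
  by_cases hxm : x ∈ Set.uIcc s t
  · rw [Set.indicator_of_mem hxm]
    simp only [Set.indicator_apply, Set.mem_Iio, Pi.one_apply]
    split_ifs <;> simp
  · rw [Set.indicator_of_notMem hxm]
    have hst : x < t ↔ x < s := by
      rw [Set.mem_uIcc] at hxm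
      grind
    simp [Set.indicator_apply, hst]

theorem IsAdmissible.intervalIntegrable {k : ℕ} {α β : ℝ} (h : IsAdmissible f k α β) :
    IntervalIntegrable (fun x => entry (f x) k k) volume α β :=
  (intervalIntegrable_iff_integrableOn_Ico_of_le h.2.1).2 h.2.2.2

theorem coeFn_cutElem {k : ℕ} {s t : ℝ} (h : MemLp (cut f k s t) 2 circ) :
    ∀ᵐ x ∂circ, cutElem f k s t x = cut f k s t x := by
  rw [cutElem, dif_pos h]
  exact h.coeFn_toLp

theorem inner_cutElem_cutElem (hs : ActsMeasurably fun x => sqrtOp (f x))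
    (hpos : ∀ᵐ x ∂circ, (f x).IsPositive) {k n : ℕ} {α β α' β' : ℝ}
    (h : IsAdmissible f k α β) (h' : IsAdmissible f n α' β') :
    inner ℂ (cutElem f n α' β') (cutElem f k α β) =
      ∫ x in Set.Ico α β ∩ Set.Ico α' β', entry (f x) k n := by
  have hsub : Set.Ico α β ∩ Set.Ico α' β' ⊆ Set.Ico (-Real.pi) Real.pi := fun x hx =>
    ⟨h.1.trans hx.1.1, hx.1.2.trans_le h.2.2.1⟩
  have hms : MeasurableSet (Set.Ico α β ∩ Set.Ico α' β') := measurableSet_Ico.inter measurableSet_Ico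
  have h1 : ∫ x in Set.Ico α β ∩ Set.Ico α' β', entry (f x) k n =
      ∫ x, (Set.Ico α β ∩ Set.Ico α' β').indicator (fun x => entry (f x) k n) x ∂circ := by
    rw [integral_indicator hms, circ, Measure.restrict_restrict hms,
      Set.inter_eq_left.2 hsub]
  rw [h1, L2.inner_def]
  refine integral_congr_ae ?_
  filter_upwards [coeFn_cutElem (memLp_cut hs hpos h.intervalIntegrable),
    coeFn_cutElem (memLp_cut hs hpos h'.intervalIntegrable), hpos] with x h2 h3 h4
  rw [h2, h3, cut_of_le f k h.2.1, cut_of_le f n h'.2.1, inner_smul_left, inner_smul_right,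
    inner_sqrtOp_unitVec h4]
  simp only [Set.indicator_apply, Set.mem_inter_iff, Pi.one_apply]
  split_ifs <;> simp_all

/-- Almost every point has a neighbourhood in which `f_{kk}` is integrable, because `|φ|² f_{kk}` is
integrable and `φ` is continuous and different from zero away from finitely many points. -/
theorem ae_exists_admissible (hτ : 1 ≤ τ) {S : ℝ → ℝ}
    (hG : IsSymbol (symbol d τ f) (symbolAdj d τ f) S)
    (hm : ∀ k n, AEStronglyMeasurable (fun x => entry (f x) k n) circ)
    (hpos : ∀ᵐ x ∂circ, (f x).IsPositive) (k : ℕ) :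
    ∀ᵐ x ∂circ, ∃ q₁ q₂ : ℚ, (q₁ : ℝ) < x ∧ x < q₂ ∧ IsAdmissible f k q₁ q₂ := by
  have hIoo : ∀ᵐ x ∂circ, x ∈ Set.Ioo (-Real.pi) Real.pi := by
    rw [circ, ← restrict_Ioo_eq_restrict_Ico]
    exact ae_restrict_mem measurableSet_Ioo
  filter_upwards [hIoo, ae_circ_regular τ hτ, ae_phi_ne_zero d τ hτ] with x hx ⟨hx0, _⟩ hφ
  have hcont : ContinuousAt (fun y => ‖phi d τ y‖ ^ 2) x := by
    have : ContinuousAt (phi d τ) x := by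
      unfold phi
      refine ContinuousAt.div (by fun_prop) (by fun_prop) (pow_ne_zero _ ?_)
      simpa using hx0
    exact this.norm.pow 2
  have hpos0 : 0 < ‖phi d τ x‖ ^ 2 := by positivity
  have hev : ∀ᶠ y in 𝓝 x, ‖phi d τ x‖ ^ 2 / 2 < ‖phi d τ y‖ ^ 2 ∧ y ∈ Set.Ioo (-Real.pi) Real.pi :=
    (hcont.eventually_const_lt (by linarith)).and (isOpen_Ioo.mem_nhds hx)
  obtain ⟨l, u, ⟨hl, hu⟩, hlu⟩ := mem_nhds_iff_exists_Ioo_subset.1 hev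
  obtain ⟨q₁, hq₁, hq₁'⟩ := exists_rat_btwn hl
  obtain ⟨q₂, hq₂, hq₂'⟩ := exists_rat_btwn hu
  refine ⟨q₁, q₂, hq₁', hq₂, ?_, (hq₁'.trans hq₂).le, ?_, ?_⟩
  · exact (hlu ⟨hq₁, hq₁'.trans hu⟩).2.1.le
  · exact (hlu ⟨hl.trans hq₂, hq₂'⟩).2.2.le
  · have hsub : Set.Ico (q₁ : ℝ) q₂ ⊆ Set.Ico (-Real.pi) Real.pi := fun y hy =>
      Set.Ioo_subset_Ico_self (hlu ⟨hq₁.trans_le hy.1, hy.2.trans hq₂'⟩).2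
    have hr : volume.restrict (Set.Ico (q₁ : ℝ) q₂) = circ.restrict (Set.Ico (q₁ : ℝ) q₂) := by
      rw [circ, Measure.restrict_restrict measurableSet_Ico, Set.inter_eq_left.2 hsub]
    change Integrable _ (volume.restrict (Set.Ico (q₁ : ℝ) q₂))
    rw [hr]
    refine ((hG.integrable.const_mul (2 / ‖phi d τ x‖ ^ 2)).restrict (s := Set.Ico (q₁ : ℝ) q₂)).mono'
      (hm k k).restrict ?_
    filter_upwards [ae_restrict_of_ae hG.bound, ae_restrict_of_ae hpos,
      ae_restrict_mem measurableSet_Ico] with y hy1 hy2 hy3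
    have h1 := hy1 (unitVec k)
    have h2 := (hlu ⟨hq₁.trans_le hy3.1, hy3.2.trans hq₂'⟩).1
    simp only [symbol, FunLike.coe_smul, Pi.smul_apply] at h1
    rw [norm_smul, mul_pow, norm_sqrtOp_unitVec_sq hy2, norm_unitVec, one_pow, mul_one] at h1
    rw [div_mul_eq_mul_div, le_div_iff₀ hpos0]
    nlinarith [norm_nonneg (entry (f y) k k)]

/-- The step functions are total in `L₂(f)`. -/
theorem span_cutElem_eq_top (hτ : 1 ≤ τ) {S : ℝ → ℝ}
    (hG : IsSymbol (symbol d τ f) (symbolAdj d τ f) S)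
    (hm : ∀ k n, AEStronglyMeasurable (fun x => entry (f x) k n) circ)
    (hpos : ∀ᵐ x ∂circ, (f x).IsPositive)
    (hinj : ∀ᵐ x ∂circ, Function.Injective (sqrtOp (f x))) :
    (Submodule.span ℂ ((fun p : ℕ × ℝ × ℝ => cutElem f p.1 p.2.1 p.2.2) ''
      {p | IsAdmissible f p.1 p.2.1 p.2.2})).topologicalClosure = ⊤ := by
  have hs : ActsMeasurably fun x => sqrtOp (f x) := (actsMeasurably_of_entry hm).sqrtOp hpos
  rw [Submodule.topologicalClosure_eq_top_iff, Submodule.eq_bot_iff]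
  intro w hw
  -- an element orthogonal to the step functions has vanishing integrals `∫_α^β ⟨f^{1/2} δ_k, w⟩`
  have hzero : ∀ k α β, IsAdmissible f k α β →
      IntervalIntegrable (fun x => (inner ℂ (sqrtOp (f x) (unitVec k)) (w x) : ℂ)) volume α β ∧
      ∫ x in α..β, (inner ℂ (sqrtOp (f x) (unitVec k)) (w x) : ℂ) = 0 := by
    intro k α β h
    have h0 : inner ℂ (cutElem f k α β) w = 0 :=
      (Submodule.mem_orthogonal _ _).1 hw _ (Submodule.subset_span ⟨(k, α, β), h, rfl⟩)
    have hsub : Set.Ico α β ⊆ Set.Ico (-Real.pi) Real.pi := Set.Ico_subset_Ico h.1 h.2.2.1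
    have hr : volume.restrict (Set.Ico α β) = circ.restrict (Set.Ico α β) := by
      rw [circ, Measure.restrict_restrict measurableSet_Ico, Set.inter_eq_left.2 hsub]
    have hae : ∀ᵐ x ∂circ, (inner ℂ (cutElem f k α β x) (w x) : ℂ) =
        (Set.Ico α β).indicator (fun x => (inner ℂ (sqrtOp (f x) (unitVec k)) (w x) : ℂ)) x := by
      filter_upwards [coeFn_cutElem (memLp_cut hs hpos h.intervalIntegrable)] with x hx
      rw [hx, cut_of_le f k h.2.1, inner_smul_left]
      simp only [Set.indicator_apply, Pi.one_apply]
      split_ifs <;> simp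
    have hint := (L2.integrable_inner (𝕜 := ℂ) (cutElem f k α β) w).congr hae
    rw [integrable_indicator_iff measurableSet_Ico] at hint
    constructor
    · rw [intervalIntegrable_iff_integrableOn_Ico_of_le h.2.1]
      change Integrable _ (volume.restrict _)
      rw [hr]
      exact hint
    · rw [L2.inner_def, integral_congr_ae hae, integral_indicator measurableSet_Ico, ← hr] at h0
      rw [intervalIntegral.integral_of_le h.2.1, ← integral_Ico_eq_integral_Ioc, h0]
  have hk : ∀ k, ∀ᵐ x ∂circ, (inner ℂ (sqrtOp (f x) (unitVec k)) (w x) : ℂ) = 0 := by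
    intro k
    have hq : ∀ q : ℚ × ℚ, ∀ᵐ x ∂circ, IsAdmissible f k q.1 q.2 → x ∈ Set.Ioo (q.1 : ℝ) q.2 →
        (inner ℂ (sqrtOp (f x) (unitVec k)) (w x) : ℂ) = 0 := by
      intro q
      by_cases h : IsAdmissible f k q.1 q.2
      · have := ae_eq_zero_of_intervalIntegral_eq_zero h.2.1 (hzero k _ _ h).1 fun t ht =>
          (hzero k _ _ ⟨h.1, ht.1, ht.2.trans h.2.2.1,
            h.2.2.2.mono_set (Set.Ico_subset_Ico_right ht.2)⟩).2
        filter_upwards [ae_restrict_of_ae this] with x hx _ using hx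
      · exact Eventually.of_forall fun x hx => absurd hx h
    filter_upwards [ae_all_iff.2 hq, ae_exists_admissible hτ hG hm hpos k]
      with x h1 ⟨q₁, q₂, h2, h3, h4⟩
    exact h1 (q₁, q₂) h4 ⟨h2, h3⟩
  rw [Lp.eq_zero_iff_ae_eq_zero]
  filter_upwards [ae_all_iff.2 hk, hinj] with x h1 h2
  refine h2 (vec_ext fun k => ?_)
  rw [← sqrtOp_symm, h1, Pi.zero_apply, map_zero, inner_zero_right]

variable {Ω : Type*} [MeasurableSpace Ω] {P : Measure Ω}

theorem coeFn_linearCombination_cutElem (hs : ActsMeasurably fun x => sqrtOp (f x))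
    (hpos : ∀ᵐ x ∂circ, (f x).IsPositive) (s : (ℕ × ℝ × ℝ) →₀ ℂ)
    (hsupp : ∀ p ∈ s.support, IsAdmissible f p.1 p.2.1 p.2.2) :
    ∀ᵐ x ∂circ, Finsupp.linearCombination ℂ
      (fun p : ℕ × ℝ × ℝ => cutElem f p.1 p.2.1 p.2.2) s x = sqrtOp (f x) (stepFun s x) := by
  have h1 : ∀ᵐ x ∂circ, ∀ p ∈ s.support, (s p • cutElem f p.1 p.2.1 p.2.2 : CircL2) x =
      s p • cut f p.1 p.2.1 p.2.2 x := by
    rw [Filter.eventually_all_finset]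
    intro p hp
    filter_upwards [coeFn_cutElem (memLp_cut hs hpos (hsupp p hp).intervalIntegrable),
      Lp.coeFn_smul (s p) (cutElem f p.1 p.2.1 p.2.2)] with x hx hx2
    rw [hx2, Pi.smul_apply, hx]
  rw [Finsupp.linearCombination_apply, Finsupp.sum]
  filter_upwards [Lp.coeFn_finsetSum s.support fun p => s p • cutElem f p.1 p.2.1 p.2.2, h1]
    with x hx hx1
  rw [hx, Finset.sum_apply, stepFun, Finsupp.sum, map_sum]
  refine Finset.sum_congr rfl fun p hp => ?_
  rw [hx1 p hp, cut_of_le f _ (hsupp p hp).2.1]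
  simp only [Set.indicator_apply, Pi.one_apply]
  split_ifs <;> simp

theorem map_linearCombination_cutElem {Z : ℕ → ℝ → Lp ℂ 2 P} {J : CircL2 →L[ℂ] Lp ℂ 2 P}
    (hJ : ∀ k α β, IsAdmissible f k α β → J (cutElem f k α β) = Z k β - Z k α)
    (s : (ℕ × ℝ × ℝ) →₀ ℂ) (hsupp : ∀ p ∈ s.support, IsAdmissible f p.1 p.2.1 p.2.2) :
    J (Finsupp.linearCombination ℂ (fun p : ℕ × ℝ × ℝ => cutElem f p.1 p.2.1 p.2.2) s) =
      stepIntegral Z s := by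
  rw [Finsupp.linearCombination_apply, Finsupp.sum, map_sum, stepIntegral, Finsupp.sum]
  refine Finset.sum_congr rfl fun p hp => ?_
  rw [map_smul, hJ _ _ _ (hsupp p hp)]

/-- The integral with respect to `Z` is the bounded operator on `L₂(f)` with the given values on
step functions. -/
theorem isSpectralIntegral_apply (hs : ActsMeasurably fun x => sqrtOp (f x))
    (hpos : ∀ᵐ x ∂circ, (f x).IsPositive)
    (htop : (Submodule.span ℂ ((fun p : ℕ × ℝ × ℝ => cutElem f p.1 p.2.1 p.2.2) ''
      {p | IsAdmissible f p.1 p.2.1 p.2.2})).topologicalClosure = ⊤)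
    {Z : ℕ → ℝ → Lp ℂ 2 P} {J : CircL2 →L[ℂ] Lp ℂ 2 P}
    (hJ : ∀ k α β, IsAdmissible f k α β → J (cutElem f k α β) = Z k β - Z k α)
    {u : ℝ → Vec} {w : CircL2} (hu : ∀ᵐ x ∂circ, w x = u x) : IsSpectralIntegral f Z u (J w) := by
  refine ⟨(Lp.memLp w).1.congr hu, ?_⟩
  have hw : w ∈ (Submodule.span ℂ ((fun p : ℕ × ℝ × ℝ => cutElem f p.1 p.2.1 p.2.2) ''
      {p | IsAdmissible f p.1 p.2.1 p.2.2})).topologicalClosure := htop ▸ Submodule.mem_top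
  obtain ⟨g, hg, hgw⟩ := mem_closure_iff_seq_limit.1 hw
  have hex : ∀ n, ∃ s : (ℕ × ℝ × ℝ) →₀ ℂ, (∀ p ∈ s.support, IsAdmissible f p.1 p.2.1 p.2.2) ∧
      Finsupp.linearCombination ℂ (fun p : ℕ × ℝ × ℝ => cutElem f p.1 p.2.1 p.2.2) s = g n := by
    intro n
    obtain ⟨s, hs1, hs2⟩ := (Finsupp.mem_span_image_iff_linearCombination ℂ).1 (hg n)
    exact ⟨s, fun p hp => (Finsupp.mem_supported ℂ s).1 hs1 hp, hs2⟩
  choose s hs1 hs2 using hex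
  refine ⟨s, hs1, ?_, ?_⟩
  · refine (tendsto_lintegral_iff.2 hgw).congr fun n => lintegral_congr_ae ?_
    filter_upwards [hu, coeFn_linearCombination_cutElem hs hpos (s n) (hs1 n)] with x h1 h2
    rw [← h1, ← h2, hs2]
  · refine ((J.continuous.tendsto w).comp hgw).congr fun n => ?_
    rw [Function.comp_apply, ← hs2, map_linearCombination_cutElem hJ _ (hs1 n)]

/-- The spectral integral of an element of `L₂(f)` is unique. -/
theorem eq_of_isSpectralIntegral (hs : ActsMeasurably fun x => sqrtOp (f x))
    (hpos : ∀ᵐ x ∂circ, (f x).IsPositive)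
    {Z : ℕ → ℝ → Lp ℂ 2 P} {J : CircL2 →L[ℂ] Lp ℂ 2 P}
    (hJ : ∀ k α β, IsAdmissible f k α β → J (cutElem f k α β) = Z k β - Z k α)
    {u : ℝ → Vec} {w : CircL2} (hu : ∀ᵐ x ∂circ, w x = u x) {γ : Lp ℂ 2 P}
    (h : IsSpectralIntegral f Z u γ) : J w = γ := by
  obtain ⟨-, s, hs1, hs2, hs3⟩ := h
  have h1 : Tendsto (fun n => Finsupp.linearCombination ℂ
      (fun p : ℕ × ℝ × ℝ => cutElem f p.1 p.2.1 p.2.2) (s n)) atTop (𝓝 w) := by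
    refine tendsto_lintegral_iff.1 (hs2.congr fun n => lintegral_congr_ae ?_)
    filter_upwards [hu, coeFn_linearCombination_cutElem hs hpos (s n) (hs1 n)] with x h1 h2
    rw [h1, h2]
  refine tendsto_nhds_unique (((J.continuous.tendsto w).comp h1).congr fun n => ?_) hs3
  rw [Function.comp_apply, map_linearCombination_cutElem hJ _ (hs1 n)]

theorem coeFn_element_symbol {S : ℝ → ℝ} (hG : IsSymbol (symbol d τ f) (symbolAdj d τ f) S)
    (j : ℤ) (k : ℕ) : ∀ᵐ x ∂circ, hG.element j (unitVec k) x =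
      sqrtOp (f x) ((Complex.exp (Complex.I * j * x) * phi d τ x) • unitVec k) := by
  filter_upwards [hG.coeFn_element j (unitVec k)] with x hx
  rw [hx, map_smul, mul_smul]
  rfl

/-- The formula for the covariances as a relation between two Gram matrices. -/
theorem inner_element_element {ξ : ℝ → Lp ℂ 2 P} {T : ℝ} {S : ℝ → ℝ}
    (hf : IsSpectralDensity P d τ T ξ f)
    (hG : IsSymbol (symbol d τ f) (symbolAdj d τ f) S) (k n : ℕ) (l m : ℤ) :
    inner ℂ (comp d T ξ τ n m) (comp d T ξ τ k l) = ((1 / (2 * Real.pi) : ℝ) : ℂ) *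
      inner ℂ (hG.element m (unitVec n)) (hG.element l (unitVec k)) := by
  rw [hf.correlation, L2.inner_def]
  push_cast
  congr 1
  refine integral_congr_ae ?_
  filter_upwards [hG.coeFn_element m (unitVec n), hG.coeFn_element l (unitVec k), hf.positive]
    with x h1 h2 h3
  rw [h1, h2]
  simp only [symbol, FunLike.coe_smul, Pi.smul_apply]
  rw [inner_smul_left, inner_smul_right, inner_smul_left, inner_smul_right,
    inner_sqrtOp_unitVec h3, conj_char, conj_phi, phi]
  have e1 : Complex.exp (Complex.I * (l - m) * x) = char (-m) x * char l x := by
    rw [← char_add, char]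
    push_cast
    ring_nf
  have e2 : (-(Complex.I * x) : ℂ) ^ d * (Complex.I * x) ^ d = (x : ℂ) ^ (2 * d) := by
    rw [← mul_pow, pow_mul]
    congr 1
    linear_combination (-(x : ℂ) ^ 2) * Complex.I_sq
  rw [e1, ← e2, div_mul_eq_div_div_swap]
  have e3 : Complex.I * (τ : ℂ) * x = Complex.I * x * τ := by ring
  simp only [e3]
  ring

/-- The operator `J` that maps the sequence `e^{ijλ} φ f^{1/2} δ_k` to the increment sequence. -/
theorem exists_isometry {ξ : ℝ → Lp ℂ 2 P} {T : ℝ} {S : ℝ → ℝ}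
    (hf : IsSpectralDensity P d τ T ξ f)
    (hG : IsSymbol (symbol d τ f) (symbolAdj d τ f) S) :
    ∃ J : CircL2 →L[ℂ] Lp ℂ 2 P, (∀ k j, J (hG.element j (unitVec k)) = comp d T ξ τ k j) ∧
      ∀ a b, inner ℂ (J a) (J b) = ((1 / (2 * Real.pi) : ℝ) : ℂ) * inner ℂ a b := by
  obtain ⟨J, hJ, hJ2⟩ := exists_extension_of_gram
    (fun p : ℕ × ℤ => hG.element p.2 (unitVec p.1)) (fun p : ℕ × ℤ => comp d T ξ τ p.1 p.2)
    (1 / (2 * Real.pi)) (by positivity) hG.span_element_eq_top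
    (fun p q => inner_element_element hf hG q.1 p.1 q.2 p.2)
  exact ⟨J, fun k j => hJ (k, j), hJ2⟩

/-- Points are equivalent if `f_{kk}` is integrable between them. -/
def integrableSetoid (f : ℝ → Vec →L[ℂ] Vec) (k : ℕ) : Setoid ℝ where
  r s t := IntervalIntegrable (fun x => entry (f x) k k) volume s t
  iseqv := ⟨fun _ => IntervalIntegrable.refl, fun h => h.symm, fun h h' => h.trans h'⟩

/-- The base point of the equivalence class of `t`, the origin of the primitive `Z_k`. -/
def basePoint (f : ℝ → Vec →L[ℂ] Vec) (k : ℕ) (t : ℝ) : ℝ :=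
  (Quotient.mk (integrableSetoid f k) t).out

theorem intervalIntegrable_basePoint (f : ℝ → Vec →L[ℂ] Vec) (k : ℕ) (t : ℝ) :
    IntervalIntegrable (fun x => entry (f x) k k) volume (basePoint f k t) t :=
  Quotient.mk_out (s := integrableSetoid f k) t

theorem basePoint_eq {k : ℕ} {s t : ℝ}
    (h : IntervalIntegrable (fun x => entry (f x) k k) volume s t) :
    basePoint f k s = basePoint f k t := by
  rw [basePoint, basePoint, Quotient.sound (s := integrableSetoid f k) h]

/-- Existence of the spectral process: `Z_k(t)` is the image of the step function between `t` and
the base point of its class. If `f_{kk}` is integrable on `[α, β)`, both ends have the same base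
point, and the increment is the image of `1_{[α,β)} f^{1/2} δ_k`. -/
theorem exists_isSpectralProcess (hτ : 1 ≤ τ) {ξ : ℝ → Lp ℂ 2 P} {T : ℝ} {S : ℝ → ℝ}
    (hf : IsSpectralDensity P d τ T ξ f) (hmin : IsMinimal d τ f)
    (hG : IsSymbol (symbol d τ f) (symbolAdj d τ f) S) :
    ∃ Z : ℕ → ℝ → Lp ℂ 2 P, IsSpectralProcess d τ T ξ f Z := by
  have hs : ActsMeasurably fun x => sqrtOp (f x) :=
    (actsMeasurably_of_entry hf.measurable_entry).sqrtOp hf.positive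
  have htop := span_cutElem_eq_top hτ hG hf.measurable_entry hf.positive hmin.injective
  obtain ⟨J, hJ, hJ2⟩ := exists_isometry hf hG
  set Z : ℕ → ℝ → Lp ℂ 2 P := fun k t => J (cutElem f k (basePoint f k t) t) with hZ
  have hJZ : ∀ k α β, IsAdmissible f k α β → J (cutElem f k α β) = Z k β - Z k α := by
    intro k α β h
    have hb := basePoint_eq h.intervalIntegrable
    have hα := intervalIntegrable_basePoint f k α
    have hβ := intervalIntegrable_basePoint f k β
    rw [← hb] at hβ
    simp only [hZ]
    rw [← hb, ← map_sub]
    congr 1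
    refine Lp.ext ?_
    filter_upwards [coeFn_cutElem (memLp_cut hs hf.positive h.intervalIntegrable),
      coeFn_cutElem (memLp_cut hs hf.positive hα), coeFn_cutElem (memLp_cut hs hf.positive hβ),
      Lp.coeFn_sub (cutElem f k (basePoint f k α) β) (cutElem f k (basePoint f k α) α)]
      with x h1 h2 h3 h4
    rw [h4, Pi.sub_apply, h1, h2, h3, ← cut_add f k (basePoint f k α) α β, add_sub_cancel_left]
  refine ⟨Z, ⟨?_, ?_⟩⟩
  · intro k n α β α' β' h h'
    rw [← hJZ _ _ _ h, ← hJZ _ _ _ h', hJ2, inner_cutElem_cutElem hs hf.positive h h']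
    push_cast
    rfl
  · intro k j
    rw [← hJ k j]
    exact isSpectralIntegral_apply hs hf.positive htop hJZ (coeFn_element_symbol hG j k)

/-- The integral with respect to a spectral stochastic process, as an operator on `L₂(f)`. -/
theorem IsSpectralProcess.exists_isometry (hτ : 1 ≤ τ) {ξ : ℝ → Lp ℂ 2 P} {T : ℝ} {S : ℝ → ℝ}
    (hf : IsSpectralDensity P d τ T ξ f) (hmin : IsMinimal d τ f)
    (hG : IsSymbol (symbol d τ f) (symbolAdj d τ f) S) {Z : ℕ → ℝ → Lp ℂ 2 P}
    (hZ : IsSpectralProcess d τ T ξ f Z) :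
    ∃ J : CircL2 →L[ℂ] Lp ℂ 2 P, (∀ k j, J (hG.element j (unitVec k)) = comp d T ξ τ k j) ∧
      (∀ a b, inner ℂ (J a) (J b) = ((1 / (2 * Real.pi) : ℝ) : ℂ) * inner ℂ a b) ∧
      ∀ (u : ℝ → Vec) (w : CircL2), (∀ᵐ x ∂circ, w x = u x) → IsSpectralIntegral f Z u (J w) := by
  have hs : ActsMeasurably fun x => sqrtOp (f x) :=
    (actsMeasurably_of_entry hf.measurable_entry).sqrtOp hf.positive
  have htop := span_cutElem_eq_top hτ hG hf.measurable_entry hf.positive hmin.injective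
  obtain ⟨J, hJ, hJ2⟩ := exists_extension_of_gram
    (fun p : {p : ℕ × ℝ × ℝ // IsAdmissible f p.1 p.2.1 p.2.2} =>
      cutElem f p.1.1 p.1.2.1 p.1.2.2)
    (fun p => Z p.1.1 p.1.2.2 - Z p.1.1 p.1.2.1)
    (1 / (2 * Real.pi)) (by positivity)
    (by
      rw [← htop]
      congr 2
      ext w
      simp) (fun p q => by
      rw [hZ.increments _ _ _ _ _ _ q.2 p.2, inner_cutElem_cutElem hs hf.positive q.2 p.2]
      push_cast
      rfl)
  have hJZ : ∀ k α β, IsAdmissible f k α β → J (cutElem f k α β) = Z k β - Z k α :=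
    fun k α β h => hJ ⟨(k, α, β), h⟩
  refine ⟨J, fun k j => ?_, hJ2, fun u w hu => isSpectralIntegral_apply hs hf.positive htop hJZ hu⟩
  exact eq_of_isSpectralIntegral hs hf.positive hJZ (coeFn_element_symbol hG j k)
    (hZ.representation k j)

end

section

/-! ### The coefficients `d(k)`, `d_τ(k)` -/

theorem dCoef_cast (R : Type*) [CommRing R] (d k : ℕ) :
    (dCoef d k : R) = PowerSeries.coeff k ((PowerSeries.mk 1 : PowerSeries R) ^ d) := by
  have h : (PowerSeries.mk 1 : PowerSeries R) =
      PowerSeries.map (Nat.castRingHom R) (PowerSeries.mk fun _ => (1 : ℕ)) := by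
    ext n
    simp
  rw [h, ← map_pow, PowerSeries.coeff_map, dCoef]
  rfl

/-- `(1 - x)^d` and `(∑ x^j)^d` are inverse to each other. -/
theorem sum_binomial_dCoef (d m : ℕ) :
    ∑ l ∈ Finset.range (d + 1), ((-1 : ℂ) ^ l * (d.choose l : ℂ)) *
      (if l ≤ m then (dCoef d (m - l) : ℂ) else 0) = if m = 0 then 1 else 0 := by
  have h1 : ((1 : PowerSeries ℂ) - PowerSeries.X) ^ d =
      ∑ l ∈ Finset.range (d + 1),
        PowerSeries.C ((-1 : ℂ) ^ l * (d.choose l : ℂ)) * PowerSeries.X ^ l := by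
    rw [sub_eq_neg_add, add_pow]
    refine Finset.sum_congr rfl fun l _ => ?_
    rw [neg_pow, one_pow, map_mul, map_pow, map_neg, map_one, map_natCast]
    ring
  have h2 : ((1 : PowerSeries ℂ) - PowerSeries.X) ^ d * (PowerSeries.mk 1) ^ d = 1 := by
    rw [← mul_pow, mul_comm, PowerSeries.mk_one_mul_one_sub_eq_one, one_pow]
  have h3 := congrArg (PowerSeries.coeff m) h2
  rw [h1, Finset.sum_mul, map_sum, PowerSeries.coeff_one] at h3
  rw [← h3]
  refine Finset.sum_congr rfl fun l _ => ?_
  rw [mul_assoc, mul_assoc (PowerSeries.C _), PowerSeries.coeff_C_mul, PowerSeries.coeff_X_pow_mul']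
  simp only [dCoef_cast ℂ, mul_assoc]

/-- `d_τ(τ k) = d(k)`, and `d_τ` vanishes at the other indices. -/
theorem dTauCoef_cast (d τ : ℕ) (hτ : 1 ≤ τ) (k : ℕ) :
    (dTauCoef d τ k : ℤ) = if τ ∣ k then (dCoef d (k / τ) : ℤ) else 0 := by
  have h0 : τ ≠ 0 := by omega
  have h : PowerSeries.expand τ h0 (PowerSeries.mk 1 : PowerSeries ℤ) =
      PowerSeries.map (Nat.castRingHom ℤ)
        (PowerSeries.mk fun n => if τ ∣ n then (1 : ℕ) else 0) := by
    ext n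
    rw [PowerSeries.coeff_expand, PowerSeries.coeff_map, PowerSeries.coeff_mk,
      PowerSeries.coeff_mk]
    split_ifs <;> simp
  have h1 : (dTauCoef d τ k : ℤ) = PowerSeries.coeff k
      (PowerSeries.map (Nat.castRingHom ℤ)
        (PowerSeries.mk fun n => if τ ∣ n then (1 : ℕ) else 0) ^ d) := by
    rw [← map_pow, PowerSeries.coeff_map, dTauCoef]
    rfl
  rw [h1, ← h, ← map_pow, PowerSeries.coeff_expand]
  simp only [dCoef_cast ℤ]

/-! ### The decomposition `Aξ = Bξ - Vξ` -/

variable {d τ : ℕ} {T : ℝ} {a : ℝ → ℂ}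

theorem bFun_aestronglyMeasurable (ham : AEStronglyMeasurable a volume) :
    AEStronglyMeasurable (bFun d τ T a) volume := by
  refine (AEMeasurable.tsum fun k => ?_).aestronglyMeasurable
  exact ((ham.comp_quasiMeasurePreserving
    (measurePreserving_add_right volume (τ * T * k)).quasiMeasurePreserving).aemeasurable).mul_const _

theorem enorm_bFun_le (t : ℝ) : ‖bFun d τ T a t‖ₑ ≤ bAbs d τ T a t := by
  refine enorm_tsum_le_tsum_enorm.trans (le_of_eq (tsum_congr fun k => ?_))
  rw [enorm_mul]
  congr 1
  rw [← ofReal_norm, Complex.norm_natCast, ENNReal.ofReal_natCast]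

theorem ae_bAbs_lt_top (ham : AEStronglyMeasurable a volume)
    (haloc : ∀ R : ℝ, ∫⁻ t in Set.Icc 0 R, bAbs d τ T a t < ∞) :
    ∀ᵐ t : ℝ, 0 ≤ t → bAbs d τ T a t < ∞ := by
  have hm : AEMeasurable (bAbs d τ T a) volume := by
    refine AEMeasurable.tsum fun k => ?_
    exact ((ham.comp_quasiMeasurePreserving
      (measurePreserving_add_right volume (τ * T * k)).quasiMeasurePreserving).enorm).mul_const _
  have h : ∀ n : ℕ, ∀ᵐ t : ℝ, t ∈ Set.Icc (0 : ℝ) n → bAbs d τ T a t < ∞ := fun n => by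
    rw [← ae_restrict_iff' measurableSet_Icc]
    exact ae_lt_top' hm.restrict (haloc n).ne
  filter_upwards [ae_all_iff.2 h] with t ht h0
  exact ht ⌈t⌉₊ ⟨h0, Nat.le_ceil t⟩

theorem hasSum_bFun {t : ℝ} (h : bAbs d τ T a t < ∞) :
    HasSum (fun k : ℕ => a (t + τ * T * k) * dCoef d k) (bFun d τ T a t) := by
  refine Summable.hasSum (Summable.of_enorm ?_)
  refine ne_of_lt (lt_of_le_of_lt (le_of_eq (tsum_congr fun k => ?_)) h)
  rw [enorm_mul]
  congr 1
  rw [← ofReal_norm, Complex.norm_natCast, ENNReal.ofReal_natCast]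

/-- `a` is the `d`-th difference of `b^τ`. -/
theorem sum_binomial_bFun {t : ℝ} (h : ∀ l : ℕ, bAbs d τ T a (t + l * (τ * T)) < ∞) :
    ∑ l ∈ Finset.range (d + 1), ((-1 : ℂ) ^ l * (d.choose l : ℂ)) *
      bFun d τ T a (t + l * (τ * T)) = a t := by
  have h1 : ∀ l : ℕ, HasSum (fun m : ℕ => a (t + τ * T * m) *
      if l ≤ m then (dCoef d (m - l) : ℂ) else 0) (bFun d τ T a (t + l * (τ * T))) := by
    intro l
    rw [← (add_left_injective l).hasSum_iff]
    · have e : ((fun m : ℕ => a (t + τ * T * m) * if l ≤ m then (dCoef d (m - l) : ℂ) else 0) ∘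
          fun k => k + l) = fun k : ℕ => a (t + l * (τ * T) + τ * T * k) * dCoef d k := by
        funext k
        simp only [Function.comp_apply, if_pos (Nat.le_add_left l k), Nat.add_sub_cancel]
        congr 2
        push_cast
        ring
      rw [e]
      exact hasSum_bFun (h l)
    · intro m hm
      have : ¬ l ≤ m := fun hlm => hm ⟨m - l, Nat.sub_add_cancel hlm⟩
      rw [if_neg this, mul_zero]
  have h2 := hasSum_sum (s := Finset.range (d + 1)) fun l _ =>
    (h1 l).mul_left ((-1 : ℂ) ^ l * (d.choose l : ℂ))
  have h3 : (fun m : ℕ => ∑ l ∈ Finset.range (d + 1), ((-1 : ℂ) ^ l * (d.choose l : ℂ)) *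
      (a (t + τ * T * m) * if l ≤ m then (dCoef d (m - l) : ℂ) else 0)) =
      fun m => if m = 0 then a t else 0 := by
    funext m
    have h4 := congrArg (a (t + τ * T * m) * ·) (sum_binomial_dCoef d m)
    simp only [Finset.mul_sum] at h4
    have h5 : (a (t + τ * T * m) * if m = 0 then 1 else 0) = if m = 0 then a t else 0 := by
      split_ifs with hm
      · subst hm; simp
      · simp
    rw [h5] at h4
    rw [← h4]
    exact Finset.sum_congr rfl fun l _ => by ring
  rw [h3] at h2
  exact h2.unique (hasSum_ite_eq 0 (a t))

variable {E : Type*} [NormedAddCommGroup E] [NormedSpace ℂ E] {ξ : ℝ → E}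

theorem integrableOn_bFun_smul (ham : AEStronglyMeasurable a volume)
    (hξm : AEStronglyMeasurable ξ volume) (l : ℕ)
    (haξ : ∫⁻ t in Set.Ici (0 : ℝ), bAbs d τ T a t * ‖ξ (t - l * (τ * T))‖ₑ < ∞) :
    IntegrableOn (fun t => bFun d τ T a t • ξ (t - l * (τ * T))) (Set.Ici 0) := by
  have hξ' : AEStronglyMeasurable (fun t => ξ (t - l * (τ * T))) volume := by
    simp only [sub_eq_add_neg]
    exact hξm.comp_quasiMeasurePreserving
      (measurePreserving_add_right volume (-(l * (τ * T)))).quasiMeasurePreserving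
  refine ⟨((bFun_aestronglyMeasurable ham).smul hξ').restrict, lt_of_le_of_lt ?_ haξ⟩
  refine lintegral_mono fun t => ?_
  rw [enorm_smul]
  gcongr
  exact enorm_bFun_le t

theorem integrableOn_bFun_incr (ham : AEStronglyMeasurable a volume)
    (hξm : AEStronglyMeasurable ξ volume)
    (haξ : ∀ l ≤ d, ∫⁻ t in Set.Ici (0 : ℝ), bAbs d τ T a t * ‖ξ (t - l * (τ * T))‖ₑ < ∞) :
    IntegrableOn (fun t => bFun d τ T a t • incr d (τ * T) ξ t) (Set.Ici 0) := by
  have h := integrable_finsetSum (μ := volume.restrict (Set.Ici (0 : ℝ))) (Finset.range (d + 1))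
    fun l hl => (integrableOn_bFun_smul ham hξm l (haξ l (Nat.lt_succ_iff.1 (Finset.mem_range.1 hl)))).smul
      ((-1 : ℂ) ^ l * (d.choose l : ℂ))
  refine h.congr (Eventually.of_forall fun t => ?_)
  simp only [incr, Finset.smul_sum]
  exact Finset.sum_congr rfl fun l _ => smul_comm _ _ _

/-- Summation by parts under the integral: `Aξ = Bξ - Vξ`. -/
theorem funA_eq (hτ : 1 ≤ τ) (hT : 0 < T) (ham : AEStronglyMeasurable a volume)
    (hξm : AEStronglyMeasurable ξ volume)
    (haloc : ∀ R : ℝ, ∫⁻ t in Set.Icc 0 R, bAbs d τ T a t < ∞)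
    (haξ : ∀ l ≤ d, ∫⁻ t in Set.Ici (0 : ℝ), bAbs d τ T a t * ‖ξ (t - l * (τ * T))‖ₑ < ∞) :
    funA a ξ = funB d τ T a ξ - funV d τ T a ξ := by
  set s : ℝ := τ * T with hs
  have hs0 : 0 < s := mul_pos (by exact_mod_cast (by omega : 0 < τ)) hT
  set c : ℕ → ℂ := fun l => (-1 : ℂ) ^ l * (d.choose l : ℂ) with hc
  -- the term of index `l`, shifted to the argument of `ξ`
  set F : ℕ → ℝ → E := fun l u =>
    (Set.Ici (-(l * s))).indicator (fun u => bFun d τ T a (u + l * s) • ξ u) u with hF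
  have hFs : ∀ l u, F l u = (Set.Ici (0 : ℝ)).indicator
      (fun t => bFun d τ T a t • ξ (t - l * s)) (u + l * s) := by
    intro l u
    simp only [hF, Set.indicator_apply, Set.mem_Ici, add_sub_cancel_right]
    exact if_congr (by constructor <;> intro h <;> linarith) rfl rfl
  have hint : ∀ l ≤ d, Integrable (fun t => (Set.Ici (0 : ℝ)).indicator
      (fun t => bFun d τ T a t • ξ (t - l * s)) t) := fun l hl =>
    (integrable_indicator_iff measurableSet_Ici).2 (integrableOn_bFun_smul ham hξm l (haξ l hl))
  have hFi : ∀ l ≤ d, Integrable (F l) := fun l hl => by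
    simp only [funext (hFs l)]
    exact (hint l hl).comp_add_right _
  have hFint : ∀ l ≤ d, ∫ u, F l u = ∫ t in Set.Ici (0 : ℝ), bFun d τ T a t • ξ (t - l * s) := by
    intro l _
    simp only [hFs]
    rw [integral_add_right_eq_self, integral_indicator measurableSet_Ici]
  have hB : funB d τ T a ξ = ∫ u, ∑ l ∈ Finset.range (d + 1), c l • F l u := by
    rw [integral_finsetSum (f := fun l u => c l • F l u) _ fun l hl => (hFi l (Nat.lt_succ_iff.1 (Finset.mem_range.1 hl))).smul (c l)]
    have h1 : ∀ t, bFun d τ T a t • incr d s ξ t =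
        ∑ l ∈ Finset.range (d + 1), c l • (bFun d τ T a t • ξ (t - l * s)) := by
      intro t
      simp only [incr, Finset.smul_sum]
      exact Finset.sum_congr rfl fun l _ => smul_comm _ _ _
    rw [funB]
    simp only [← hs, h1]
    rw [integral_finsetSum (f := fun l t => c l • (bFun d τ T a t • ξ (t - l * s))) _ fun l hl =>
      ((integrableOn_bFun_smul ham hξm l (haξ l (Nat.lt_succ_iff.1 (Finset.mem_range.1 hl)))).smul (c l))]
    refine Finset.sum_congr rfl fun l hl => ?_
    rw [integral_smul, integral_smul, hFint l (Nat.lt_succ_iff.1 (Finset.mem_range.1 hl))]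
  have hKi : Integrable fun u => ∑ l ∈ Finset.range (d + 1), c l • F l u :=
    integrable_finsetSum _ fun l hl => (hFi l (Nat.lt_succ_iff.1 (Finset.mem_range.1 hl))).smul (c l)
  -- for `u ≥ 0` all terms are present and add up to `a`
  have hA : ∫ u in Set.Ici (0 : ℝ), ∑ l ∈ Finset.range (d + 1), c l • F l u = funA a ξ := by
    have hfin : ∀ᵐ u : ℝ, ∀ l : ℕ, 0 ≤ u + l * s → bAbs d τ T a (u + l * s) < ∞ :=
      ae_all_iff.2 fun l => (measurePreserving_add_right volume (l * s)).quasiMeasurePreserving.ae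
        (ae_bAbs_lt_top ham haloc)
    refine setIntegral_congr_ae measurableSet_Ici ?_
    filter_upwards [hfin] with u hu hu0
    have hu0' : (0 : ℝ) ≤ u := hu0
    rw [← sum_binomial_bFun (a := a) (t := u) (d := d) (τ := τ) (T := T) fun l =>
      hu l (by positivity), Finset.sum_smul]
    refine Finset.sum_congr rfl fun l _ => ?_
    have hmem : u ∈ Set.Ici (-(l * s)) := by
      have : 0 ≤ l * s := by positivity
      exact (neg_nonpos.2 this).trans hu0'
    simp only [hF, Set.indicator_of_mem hmem, hc, mul_smul]
    rfl
  -- for `u < 0` the terms present are those with `l ≥ -u / (τT)`, and they add up to `v^τ`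
  have hV : ∫ u in (Set.Ici (0 : ℝ))ᶜ, ∑ l ∈ Finset.range (d + 1), c l • F l u =
      funV d τ T a ξ := by
    have h1 : ∀ u, u < 0 → ∑ l ∈ Finset.range (d + 1), c l • F l u = vFun d τ T a u • ξ u := by
      intro u hu
      rw [vFun, Finset.sum_smul]
      symm
      refine Finset.sum_subset_zero_on_sdiff (fun l hl => ?_) (fun l hl => ?_) (fun l hl => ?_)
      · rw [Finset.mem_Icc] at hl
        exact Finset.mem_range.2 (by omega)
      · rw [Finset.mem_sdiff, Finset.mem_range, Finset.mem_Icc, not_and_or, Nat.ceil_le,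
          div_le_iff₀ hs0] at hl
        have : u ∉ Set.Ici (-(l * s)) := by
          intro hmem
          rcases hl.2 with h | h
          · exact h (by linarith [Set.mem_Ici.1 hmem])
          · omega
        simp only [hF, Set.indicator_of_notMem this, smul_zero]
      · rw [Finset.mem_Icc, Nat.ceil_le, div_le_iff₀ hs0] at hl
        have : u ∈ Set.Ici (-(l * s)) := by
          rw [Set.mem_Ici]; linarith [hl.1]
        simp only [hF, Set.indicator_of_mem this, hc, mul_smul]
        rfl
    rw [Set.compl_Ici, setIntegral_congr_fun measurableSet_Iio h1, funV]
    refine setIntegral_eq_of_subset_of_forall_sdiff_eq_zero measurableSet_Iio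
      (fun u hu => hu.2) fun u hu => ?_
    have hu2 : ¬ -(s * d) ≤ u := fun h => hu.2 ⟨h, hu.1⟩
    rw [vFun, Finset.Icc_eq_empty, Finset.sum_empty, zero_smul]
    rw [Nat.ceil_le, div_le_iff₀ hs0]
    intro h
    exact hu2 (by linarith)
  rw [hB, ← integral_add_compl measurableSet_Ici hKi, hA, hV, add_sub_cancel_right]

end

section

/-! ### The Fourier basis of a period -/

theorem freq_injective : Function.Injective freq := by
  intro m n h
  have key : ∀ k, freq k = if k % 2 = 1 then (((k + 1) / 2 : ℕ) : ℤ)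
      else -(((k + 1) / 2 : ℕ) : ℤ) := by
    intro k
    rw [freq]
    split_ifs with hk
    · rw [Even.neg_one_pow (by rw [Nat.even_iff]; omega), one_mul]
    · rw [Odd.neg_one_pow (by rw [Nat.odd_iff]; omega), neg_one_mul]
  rw [key, key] at h
  split_ifs at h <;> omega

theorem freq_surjective : Function.Surjective freq := by
  intro z
  rcases le_or_gt z 0 with hz | hz
  · refine ⟨2 * z.natAbs, ?_⟩
    rw [freq, Odd.neg_one_pow (by rw [Nat.odd_iff]; omega)]
    omega
  · refine ⟨2 * z.natAbs - 1, ?_⟩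
    rw [freq, Even.neg_one_pow (by rw [Nat.even_iff]; omega)]
    omega

theorem swapIdx_swapIdx (k : ℕ) : swapIdx (swapIdx k) = k := by
  simp only [swapIdx]
  grind

theorem freq_swapIdx (k : ℕ) : freq (swapIdx k) = -freq k := by
  simp only [swapIdx]
  split_ifs with h1 h2
  · subst h1; simp [freq]
  · rw [freq, freq, Odd.neg_one_pow (by rw [Nat.odd_iff]; omega),
      Even.neg_one_pow (by rw [Nat.even_iff]; omega)]
    omega
  · rw [freq, freq, Even.neg_one_pow (by rw [Nat.even_iff]; omega),
      Odd.neg_one_pow (by rw [Nat.odd_iff]; omega)]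
    omega

theorem conj_basisFun (T : ℝ) (k : ℕ) (u : ℝ) :
    conj (basisFun T k u) = basisFun T (swapIdx k) u := by
  rw [basisFun, basisFun, map_mul, Complex.conj_ofReal, ← Complex.exp_conj, freq_swapIdx]
  congr 2
  simp [map_ofNat]

theorem basisFun_continuous (T : ℝ) (k : ℕ) : Continuous (basisFun T k) := by
  unfold basisFun
  fun_prop

theorem norm_basisFun (T : ℝ) (k : ℕ) (u : ℝ) : ‖basisFun T k u‖ = 1 / Real.sqrt T := by
  rw [basisFun, norm_mul, Complex.norm_real, Real.norm_of_nonneg (by positivity)]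
  have : 2 * Real.pi * Complex.I * (freq k : ℂ) * u / T =
      ((2 * Real.pi * freq k * u / T : ℝ) : ℂ) * Complex.I := by
    push_cast
    ring
  rw [this, Complex.norm_exp_ofReal_mul_I, mul_one]

theorem integral_basisFun_mul {T : ℝ} (hT : 0 < T) (m n : ℕ) :
    ∫ u in Set.Ico 0 T, conj (basisFun T m u) * basisFun T n u = if m = n then 1 else 0 := by
  have hTc : (T : ℂ) ≠ 0 := by exact_mod_cast hT.ne'
  have hs : ((1 / Real.sqrt T : ℝ) : ℂ) * ((1 / Real.sqrt T : ℝ) : ℂ) = 1 / T := by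
    rw [← Complex.ofReal_mul, div_mul_div_comm, one_mul, Real.mul_self_sqrt hT.le]
    push_cast
    rfl
  have h : ∀ u : ℝ, conj (basisFun T m u) * basisFun T n u =
      (1 / T : ℂ) * Complex.exp ((2 * Real.pi * Complex.I * ((freq n - freq m : ℤ) : ℂ) / T) * u) := by
    intro u
    rw [conj_basisFun, basisFun, basisFun, mul_mul_mul_comm, hs, ← Complex.exp_add, freq_swapIdx]
    congr 2
    push_cast
    ring
  simp only [h]
  rw [integral_const_mul]
  split_ifs with hmn
  · subst hmn
    simp [hT.le, hTc]
  · have hz : (2 * Real.pi * Complex.I * ((freq n - freq m : ℤ) : ℂ) / T) ≠ 0 := by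
      have : freq n - freq m ≠ 0 := sub_ne_zero.2 fun h => hmn (freq_injective h).symm
      have hpi : (Real.pi : ℂ) ≠ 0 := by exact_mod_cast Real.pi_ne_zero
      have h2 : ((freq n - freq m : ℤ) : ℂ) ≠ 0 := by exact_mod_cast this
      simp only [ne_eq, div_eq_zero_iff, mul_eq_zero, hpi, h2, hTc, Complex.I_ne_zero]
      norm_num
    rw [integral_Ico_eq_integral_Ioc, ← intervalIntegral.integral_of_le hT.le,
      integral_exp_mul_complex hz]
    have he : Complex.exp ((2 * Real.pi * Complex.I * ((freq n - freq m : ℤ) : ℂ) / T) * T) = 1 := by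
      rw [Complex.exp_eq_one_iff]
      exact ⟨freq n - freq m, by field_simp⟩
    rw [he]
    simp

theorem memLp_basisFun (T : ℝ) (k : ℕ) :
    MemLp (basisFun T k) 2 (volume.restrict (Set.Ico 0 T)) :=
  MemLp.of_bound (basisFun_continuous T k).aestronglyMeasurable (1 / Real.sqrt T)
    (Eventually.of_forall fun u => (norm_basisFun T k u).le)

theorem orthonormal_basisFun {T : ℝ} (hT : 0 < T) :
    Orthonormal ℂ fun k => (memLp_basisFun T k).toLp _ := by
  rw [orthonormal_iff_ite]
  intro m n
  rw [L2.inner_def, ← integral_basisFun_mul hT m n]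
  refine integral_congr_ae ?_
  filter_upwards [(memLp_basisFun T m).coeFn_toLp, (memLp_basisFun T n).coeFn_toLp] with u h1 h2
  rw [h1, h2, RCLike.inner_apply, mul_comm]

theorem ae_eq_zero_of_basisFun {T : ℝ} (hT : 0 < T) {g : ℝ → ℂ}
    (hg : IntegrableOn g (Set.Ico 0 T))
    (h : ∀ k, ∫ u in Set.Ico 0 T, g u * conj (basisFun T k u) = 0) :
    ∀ᵐ u ∂volume.restrict (Set.Ico 0 T), g u = 0 := by
  have hs : ((1 / Real.sqrt T : ℝ) : ℂ) ≠ 0 := by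
    exact_mod_cast (by positivity : (1 / Real.sqrt T) ≠ 0)
  have := ae_eq_zero_of_fourier_eq_zero (a := 0) (T := T) (g := g) hT (by rwa [zero_add]) (by
    intro n
    obtain ⟨k, rfl⟩ := freq_surjective n
    have h1 := h (swapIdx k)
    simp only [conj_basisFun, swapIdx_swapIdx] at h1
    simp only [basisFun] at h1
    rw [zero_add]
    have h2 : ∀ u : ℝ, g u * (((1 / Real.sqrt T : ℝ) : ℂ) *
        Complex.exp (2 * Real.pi * Complex.I * (freq k : ℂ) * u / T)) =
        ((1 / Real.sqrt T : ℝ) : ℂ) *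
          (Complex.exp (2 * Real.pi * Complex.I * (freq k : ℂ) * u / T) * g u) := fun u => by ring
    simp only [h2] at h1
    rw [integral_const_mul] at h1
    exact (mul_eq_zero.1 h1).resolve_left hs)
  rwa [zero_add] at this

/-- Parseval's formula for the pairing of a scalar function with a square integrable function with
values in a Hilbert space. The scalar function is only assumed to be integrable; it is square
integrable because its Fourier coefficients are square summable. -/
theorem hasSum_integral_basisFun {T : ℝ} (hT : 0 < T) {E : Type*} [NormedAddCommGroup E]
    [InnerProductSpace ℂ E] [CompleteSpace E] {g : ℝ → ℂ} (hg : IntegrableOn g (Set.Ico 0 T))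
    {X : ℝ → E} (hX : MemLp X 2 (volume.restrict (Set.Ico 0 T))) (β : lp (fun _ : ℕ => ℂ) 2)
    (hβ : ∀ k, β k = ∫ u in Set.Ico 0 T, g u * conj (basisFun T k u)) :
    HasSum (fun k => β k • ∫ u in Set.Ico 0 T, basisFun T k u • X u)
      (∫ u in Set.Ico 0 T, g u • X u) := by
  set μ := volume.restrict (Set.Ico 0 T) with hμ
  set e : ℕ → Lp ℂ 2 μ := fun k => (memLp_basisFun T k).toLp _ with he
  have hon : Orthonormal ℂ e := orthonormal_basisFun hT
  obtain ⟨G, hG⟩ : ∃ G : Lp ℂ 2 μ, HasSum (fun k => β k • e k) G := by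
    have := hon.orthogonalFamily.summable_of_lp β
    exact ⟨_, this.hasSum⟩
  have hGc : ∀ k, ∫ u, G u * conj (basisFun T k u) ∂μ = β k := by
    intro k
    have h1 : inner ℂ (e k) G = β k := by
      have h2 := hG.mapL (innerSL ℂ (e k))
      simp only [innerSL_apply_apply, inner_smul_right, orthonormal_iff_ite.1 hon k] at h2
      refine h2.unique ?_
      have h3 := hasSum_ite_eq k (β k)
      have h4 : (fun i => β i * if k = i then (1 : ℂ) else 0) = fun i => if i = k then β k else 0 := by
        funext i
        by_cases hi : i = k
        · subst hi; simp
        · rw [if_neg hi, if_neg (Ne.symm hi), mul_zero]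
      rw [h4]
      exact h3
    rw [← h1, L2.inner_def]
    refine integral_congr_ae ?_
    filter_upwards [(memLp_basisFun T k).coeFn_toLp] with u hu
    rw [RCLike.inner_apply, hu]
  have hGi : Integrable G μ := (Lp.memLp G).integrable (by norm_num)
  have hbm : ∀ k, ∀ {h : ℝ → ℂ}, Integrable h μ →
      Integrable (fun u => h u * conj (basisFun T k u)) μ := fun k h hh =>
    hh.mul_bdd (c := 1 / Real.sqrt T)
      (Complex.continuous_conj.comp (basisFun_continuous T k)).aestronglyMeasurable
      (Eventually.of_forall fun u => by rw [RCLike.norm_conj, norm_basisFun])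
  -- the square integrable function `G` with the coefficients `β` coincides with `g`
  have hae : ∀ᵐ u ∂μ, g u - G u = 0 := ae_eq_zero_of_basisFun hT (g := fun u => g u - G u)
    (Integrable.sub hg hGi) fun k => by
      simp only [sub_mul]
      rw [integral_sub (hbm k hg) (hbm k hGi), hGc, hβ, sub_self]
  let B := ContinuousLinearMap.lpPairing μ 2 2 (ContinuousLinearMap.lsmul ℂ ℂ : ℂ →L[ℂ] E →L[ℂ] E)
  have h1 := hG.mapL (B.flip (hX.toLp X))
  have hB : ∀ {p : ℝ → ℂ} {q : Lp ℂ 2 μ}, (∀ᵐ u ∂μ, q u = p u) →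
      B.flip (hX.toLp X) q = ∫ u, p u • X u ∂μ := by
    intro p q hpq
    rw [ContinuousLinearMap.flip_apply, ContinuousLinearMap.lpPairing_eq_integral]
    refine integral_congr_ae ?_
    filter_upwards [hpq, hX.coeFn_toLp] with u h2 h3
    rw [h2, h3]
    rfl
  rw [hB (p := g) (by filter_upwards [hae] with u hu using (sub_eq_zero.1 hu).symm)] at h1
  simp only [map_smul] at h1
  simpa only [he, hB (memLp_basisFun T _).coeFn_toLp] using h1

/-! ### The functional `Bξ` in the frequency domain -/

variable {d τ : ℕ} {T : ℝ} {a : ℝ → ℂ}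

theorem lintegral_shift_lt_top (hT : 0 < T)
    (haloc : ∀ R : ℝ, ∫⁻ t in Set.Icc 0 R, bAbs d τ T a t < ∞) (j : ℕ) :
    ∫⁻ u in Set.Ico 0 T, bAbs d τ T a (u + j * T) < ∞ := by
  refine lt_of_le_of_lt ?_ (haloc ((j + 1) * T))
  rw [← lintegral_indicator measurableSet_Ico, ← lintegral_indicator measurableSet_Icc,
    ← lintegral_add_right_eq_self ((Set.Icc (0 : ℝ) _).indicator _) ((j : ℝ) * T)]
  refine lintegral_mono fun u => ?_
  simp only [Set.indicator_apply, Set.mem_Ico, Set.mem_Icc]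
  split_ifs with h1 h2
  · exact le_rfl
  · refine absurd ⟨?_, ?_⟩ h2
    · have : 0 ≤ j * T := by positivity
      linarith [h1.1]
    · linarith [h1.2]
  · exact zero_le
  · exact le_rfl

/-- The components of `D^τ a` are the Fourier coefficients of `b^τ` on the periods. -/
theorem dTauVec_eq (hτ : 1 ≤ τ) (hT : 0 < T) (ham : AEStronglyMeasurable a volume)
    (haloc : ∀ R : ℝ, ∫⁻ t in Set.Icc 0 R, bAbs d τ T a t < ∞) (j k : ℕ) :
    dTauVec d τ T a j k =
      ∫ u in Set.Ico 0 T, bFun d τ T a (u + j * T) * conj (basisFun T (swapIdx k) u) := by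
  have hshift : ∀ c : ℝ, AEStronglyMeasurable (fun u => a (u + c)) volume := fun c =>
    ham.comp_quasiMeasurePreserving (measurePreserving_add_right volume c).quasiMeasurePreserving
  have h1 : ∀ u, bFun d τ T a (u + j * T) * conj (basisFun T (swapIdx k) u) =
      ∑' m : ℕ, (a (u + (j * T + τ * T * m)) * dCoef d m) * conj (basisFun T (swapIdx k) u) := by
    intro u
    rw [bFun, tsum_mul_right]
    simp only [add_assoc]
  simp only [h1]
  rw [integral_tsum]
  · rw [dTauVec, ← (mul_right_injective₀ (by omega : τ ≠ 0)).tsum_eq]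
    · refine tsum_congr fun m => ?_
      have h2 : dTauCoef d τ (τ * m) = dCoef d m := by
        have := dTauCoef_cast d τ hτ (τ * m)
        rw [if_pos (dvd_mul_right _ _), Nat.mul_div_cancel_left _ (by omega)] at this
        exact_mod_cast this
      rw [h2, aVec, ← integral_const_mul]
      refine integral_congr_ae (Eventually.of_forall fun u => ?_)
      have h3 : ((j + τ * m : ℕ) : ℝ) * T = j * T + τ * T * m := by push_cast; ring
      simp only [h3]
      ring
    · intro m hm
      rw [Function.mem_support] at hm
      by_contra hmr
      have h2 := dTauCoef_cast d τ hτ m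
      rw [if_neg fun h => hmr (by obtain ⟨n, rfl⟩ := h; exact ⟨n, rfl⟩)] at h2
      have h3 : dTauCoef d τ m = 0 := by exact_mod_cast h2
      exact hm (by rw [h3]; simp)
  · intro m
    exact (((hshift _).mul aestronglyMeasurable_const).mul
      (Complex.continuous_conj.comp (basisFun_continuous T _)).aestronglyMeasurable).restrict
  · have h2 : ∀ m : ℕ, ∫⁻ u in Set.Ico 0 T,
        ‖(a (u + (j * T + τ * T * m)) * dCoef d m) * conj (basisFun T (swapIdx k) u)‖ₑ =
        ∫⁻ u in Set.Ico 0 T, ENNReal.ofReal (1 / Real.sqrt T) *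
          (‖a (u + j * T + τ * T * m)‖ₑ * dCoef d m) := by
      intro m
      refine lintegral_congr fun u => ?_
      rw [enorm_mul, enorm_mul, ← ofReal_norm (conj _), RCLike.norm_conj, norm_basisFun,
        ← ofReal_norm (dCoef d m : ℂ), Complex.norm_natCast, ENNReal.ofReal_natCast, mul_comm,
        add_assoc]
    simp only [h2]
    rw [← lintegral_tsum]
    · simp only [ENNReal.tsum_mul_left]
      rw [lintegral_const_mul' _ _ ENNReal.ofReal_ne_top]
      exact (ENNReal.mul_lt_top ENNReal.ofReal_lt_top
        (lintegral_shift_lt_top hT haloc j)).ne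
    · intro m
      simp only [add_assoc]
      exact (((hshift _).enorm).mul_const _).const_mul _ |>.restrict

theorem integrableOn_bFun_shift (hT : 0 < T) (ham : AEStronglyMeasurable a volume)
    (haloc : ∀ R : ℝ, ∫⁻ t in Set.Icc 0 R, bAbs d τ T a t < ∞) (j : ℕ) :
    IntegrableOn (fun u => bFun d τ T a (u + j * T)) (Set.Ico 0 T) := by
  refine ⟨((bFun_aestronglyMeasurable ham).comp_quasiMeasurePreserving
    (measurePreserving_add_right volume (j * T)).quasiMeasurePreserving).restrict, ?_⟩
  exact lt_of_le_of_lt (lintegral_mono fun u => enorm_bFun_le _)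
    (lintegral_shift_lt_top hT haloc j)

variable {E : Type*} [NormedAddCommGroup E] [InnerProductSpace ℂ E] {ξ : ℝ → E}

theorem memLp_incr_shift (hT : 0 < T) (hξm : AEStronglyMeasurable ξ volume)
    (hξ2 : ∀ R : ℝ, ∫⁻ t in Set.Icc (-R) R, ‖ξ t‖ₑ ^ 2 < ∞) (s c : ℝ) :
    MemLp (fun u => incr d s ξ (u + c)) 2 (volume.restrict (Set.Ico 0 T)) := by
  unfold incr
  refine memLp_finsetSum _ fun l _ => MemLp.const_smul ?_ _
  have hm : AEStronglyMeasurable (fun u => ξ (u + c - l * s)) volume := by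
    have : (fun u => ξ (u + c - l * s)) = fun u => ξ (u + (c - l * s)) := by
      funext u; ring_nf
    rw [this]
    exact hξm.comp_quasiMeasurePreserving
      (measurePreserving_add_right volume _).quasiMeasurePreserving
  refine ⟨hm.restrict, ?_⟩
  have h := eLpNorm_nnreal_pow_eq_lintegral (p := 2) (μ := volume.restrict (Set.Ico 0 T))
    (f := fun u => ξ (u + c - l * s)) (by norm_num)
  have h2 : eLpNorm (fun u => ξ (u + c - l * s)) 2 (volume.restrict (Set.Ico 0 T)) ^ 2 =
      ∫⁻ u in Set.Ico 0 T, ‖ξ (u + c - l * s)‖ₑ ^ 2 := by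
    simpa using h
  refine (ENNReal.pow_lt_top_iff.1 (lt_of_eq_of_lt h2 ?_)).resolve_right (by norm_num)
  refine lt_of_le_of_lt ?_ (hξ2 (T + |c - l * s|))
  rw [← lintegral_indicator measurableSet_Ico, ← lintegral_indicator measurableSet_Icc,
    ← lintegral_add_right_eq_self ((Set.Icc _ _).indicator _) (c - l * s)]
  refine lintegral_mono fun u => ?_
  simp only [Set.indicator_apply, Set.mem_Ico, Set.mem_Icc]
  split_ifs with h1 h2
  · rw [add_sub_assoc]
  · refine absurd ⟨?_, ?_⟩ h2
    · linarith [h1.1, neg_abs_le (c - l * s)]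
    · linarith [h1.2, le_abs_self (c - l * s)]
  · exact zero_le
  · exact le_rfl

/-- One period of the functional `Bξ` as a series in the components of the increment sequence. -/
theorem hasSum_comp [CompleteSpace E] (hτ : 1 ≤ τ) (hT : 0 < T)
    (hξm : AEStronglyMeasurable ξ volume)
    (hξ2 : ∀ R : ℝ, ∫⁻ t in Set.Icc (-R) R, ‖ξ t‖ₑ ^ 2 < ∞)
    (ham : AEStronglyMeasurable a volume)
    (haloc : ∀ R : ℝ, ∫⁻ t in Set.Icc 0 R, bAbs d τ T a t < ∞)
    (j : ℕ) (v : Vec) (hv : ∀ k, v k = dTauVec d τ T a j k) :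
    HasSum (fun k => v k • comp d T ξ τ k j)
      (∫ u in Set.Ico 0 T, bFun d τ T a (u + j * T) • incr d (τ * T) ξ (u + j * T)) := by
  have hinv : Function.Involutive swapIdx := swapIdx_swapIdx
  -- the order of the components of `b_j` differs from that of the basis by the involution
  let β : lp (fun _ : ℕ => ℂ) 2 := ⟨fun k => v (swapIdx k), by
    have h := lp.memℓp v
    change Memℓp (fun k => v (swapIdx k)) 2
    rw [memℓp_gen_iff (by norm_num)] at h ⊢
    exact (Equiv.summable_iff hinv.toPerm).2 h⟩
  have h := hasSum_integral_basisFun hT (integrableOn_bFun_shift (d := d) (τ := τ) hT ham haloc j)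
    (memLp_incr_shift (d := d) hT hξm hξ2 (τ * T) (j * T)) β fun k => by
      change v (swapIdx k) = _
      rw [hv, dTauVec_eq hτ hT ham haloc, swapIdx_swapIdx]
  rw [← (Equiv.hasSum_iff hinv.toPerm)] at h
  have h2 : ((fun k => β k • ∫ u in Set.Ico 0 T, basisFun T k u • incr d (τ * T) ξ (u + j * T)) ∘
      hinv.toPerm) = fun k => v k • comp d T ξ τ k j := by
    funext k
    change v (swapIdx (swapIdx k)) • ∫ u in Set.Ico 0 T, basisFun T (swapIdx k) u •
      incr d (τ * T) ξ (u + j * T) = _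
    rw [swapIdx_swapIdx, comp]
    simp only [conj_basisFun, Int.cast_natCast]
  rwa [h2] at h

/-- The functional `Bξ` is the sum of its parts over the periods. -/
theorem hasSum_funB (hT : 0 < T) (ham : AEStronglyMeasurable a volume)
    (hξm : AEStronglyMeasurable ξ volume)
    (haξ : ∀ l ≤ d, ∫⁻ t in Set.Ici (0 : ℝ), bAbs d τ T a t * ‖ξ (t - l * (τ * T))‖ₑ < ∞) :
    HasSum (fun j : ℕ =>
      ∫ u in Set.Ico 0 T, bFun d τ T a (u + j * T) • incr d (τ * T) ξ (u + j * T))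
      (funB d τ T a ξ) := by
  set F : ℝ → E := fun t => bFun d τ T a t • incr d (τ * T) ξ t with hF
  have hU : ⋃ j : ℕ, Set.Ico ((j : ℝ) * T) ((j + 1) * T) = Set.Ici 0 := by
    ext t
    simp only [Set.mem_iUnion, Set.mem_Ico, Set.mem_Ici]
    constructor
    · rintro ⟨j, h1, _⟩
      exact le_trans (by positivity) h1
    · intro ht
      refine ⟨⌊t / T⌋₊, ?_, ?_⟩
      · rw [← le_div_iff₀ hT]
        exact Nat.floor_le (by positivity)
      · rw [← div_lt_iff₀ hT]
        exact Nat.lt_floor_add_one _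
  have hdisj : Pairwise (Function.onFun Disjoint
      fun j : ℕ => Set.Ico ((j : ℝ) * T) ((j + 1) * T)) := by
    intro i j hij
    refine Set.disjoint_left.2 fun t hi hj => hij ?_
    have h1 : (i : ℝ) < j + 1 := lt_of_mul_lt_mul_right (hi.1.trans_lt hj.2) hT.le
    have h2 : (j : ℝ) < i + 1 := lt_of_mul_lt_mul_right (hj.1.trans_lt hi.2) hT.le
    have h3 : i < j + 1 := by exact_mod_cast h1
    have h4 : j < i + 1 := by exact_mod_cast h2
    omega
  have h := hasSum_integral_iUnion (f := F) (μ := volume)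
    (s := fun j : ℕ => Set.Ico ((j : ℝ) * T) ((j + 1) * T)) (fun _ => measurableSet_Ico) hdisj
    (by rw [hU]; exact integrableOn_bFun_incr ham hξm haξ)
  rw [hU] at h
  have h2 : ∀ j : ℕ, ∫ t in Set.Ico ((j : ℝ) * T) ((j + 1) * T), F t =
      ∫ u in Set.Ico 0 T, F (u + j * T) := by
    intro j
    rw [← integral_indicator measurableSet_Ico, ← integral_indicator measurableSet_Ico,
      ← integral_add_right_eq_self _ ((j : ℝ) * T)]
    congr 1
    funext u
    simp only [Set.indicator_apply, Set.mem_Ico]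
    refine if_congr ?_ rfl rfl
    constructor <;> rintro ⟨h1, h2⟩ <;> constructor <;> linarith
  simp only [h2] at h
  exact h

/-! ### Integrals with values in closed subspaces -/

/-- The integral of a function with values in a closed subspace lies in it (also when the function
is not integrable, since the integral is then zero). -/
theorem integral_mem_of_isClosed [CompleteSpace E] {α : Type*} [MeasurableSpace α] {μ : Measure α}
    (K : Submodule ℂ E) (hK : IsClosed (K : Set E)) {F : α → E} (hF : ∀ᵐ x ∂μ, F x ∈ K) :
    ∫ x, F x ∂μ ∈ K := by
  by_cases hi : Integrable F μ
  · have : CompleteSpace K := hK.completeSpace_coe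
    rw [← K.starProjection_eq_self_iff, ← ContinuousLinearMap.integral_comp_comm _ hi]
    refine integral_congr_ae ?_
    filter_upwards [hF] with x hx
    exact K.starProjection_eq_self_iff.2 hx
  · rw [integral_undef hi]
    exact K.zero_mem

theorem isClosed_obsSpace : IsClosed (obsSpace ξ : Set E) :=
  Submodule.isClosed_topologicalClosure _

theorem mem_obsSpace {t : ℝ} (ht : t < 0) : ξ t ∈ obsSpace ξ :=
  Submodule.le_topologicalClosure _ (Submodule.subset_span ⟨t, ht, rfl⟩)

theorem pastSpace_le_obsSpace [CompleteSpace E] (hT : 0 < T) :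
    pastSpace d T ξ τ ≤ obsSpace ξ := by
  refine Submodule.topologicalClosure_minimal _ ?_ isClosed_obsSpace
  rw [Submodule.span_le]
  rintro _ ⟨k, j, hj, rfl⟩
  refine integral_mem_of_isClosed _ isClosed_obsSpace ?_
  filter_upwards [ae_restrict_mem measurableSet_Ico] with u hu
  refine Submodule.smul_mem _ _ (Submodule.sum_mem _ fun l _ => Submodule.smul_mem _ _
    (mem_obsSpace ?_))
  have h1 : (j : ℝ) ≤ -1 := by exact_mod_cast hj
  have h2 : 0 ≤ (l : ℝ) * (τ * T) := by positivity
  nlinarith [hu.2]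

theorem funV_mem_obsSpace [CompleteSpace E] : funV d τ T a ξ ∈ obsSpace ξ := by
  refine integral_mem_of_isClosed _ isClosed_obsSpace ?_
  filter_upwards [ae_restrict_mem measurableSet_Ico] with u hu
  exact Submodule.smul_mem _ _ (mem_obsSpace hu.2)

end

section

/-! ### The optimal estimates -/

variable {d τ : ℕ} {T : ℝ} {a : ℝ → ℂ} {f : ℝ → Vec →L[ℂ] Vec} {S : ℝ → ℝ}
  {E : Type*} [NormedAddCommGroup E] [InnerProductSpace ℂ E] {ξ : ℝ → E}

/-- `Bξ` corresponds to `φ f^{1/2} B_τ` in the frequency domain. -/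
theorem map_series_eq_funB [CompleteSpace E] (hτ : 1 ≤ τ) (hT : 0 < T)
    (hG : IsSymbol (symbol d τ f) (symbolAdj d τ f) S)
    (hξm : AEStronglyMeasurable ξ volume)
    (hξ2 : ∀ R : ℝ, ∫⁻ t in Set.Icc (-R) R, ‖ξ t‖ₑ ^ 2 < ∞)
    (ham : AEStronglyMeasurable a volume)
    (haloc : ∀ R : ℝ, ∫⁻ t in Set.Icc 0 R, bAbs d τ T a t < ∞)
    (haξ : ∀ l ≤ d, ∫⁻ t in Set.Ici (0 : ℝ), bAbs d τ T a t * ‖ξ (t - l * (τ * T))‖ₑ < ∞)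
    {b : BlockVec} (hb : ∀ j k, b j k = dTauVec d τ T a j k) (hbs : Summable fun j => ‖b j‖)
    {J : CircL2 →L[ℂ] E} (hJ : ∀ k j, J (hG.element j (unitVec k)) = comp d T ξ τ k j) :
    J (hG.series b) = funB d τ T a ξ := by
  have h1 := (hG.summable_element hbs).hasSum.mapL J
  refine h1.unique ?_
  have h2 : ∀ j : ℕ, J (hG.element j (b j)) =
      ∫ u in Set.Ico 0 T, bFun d τ T a (u + j * T) • incr d (τ * T) ξ (u + j * T) := by
    intro j
    have h3 := (hG.hasSum_element j (b j)).mapL J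
    simp only [map_smul, hJ] at h3
    exact h3.unique (hasSum_comp hτ hT hξm hξ2 ham haloc j (b j) (hb j))
  simp only [h2]
  exact hasSum_funB hT ham hξm haξ

theorem map_mem_pastSpace (hG : IsSymbol (symbol d τ f) (symbolAdj d τ f) S)
    {J : CircL2 →L[ℂ] E} (hJ : ∀ k j, J (hG.element j (unitVec k)) = comp d T ξ τ k j)
    {w : CircL2} (hw : w ∈ hG.past 0) : J w ∈ pastSpace d T ξ τ := by
  refine map_mem_closure J.continuous hw fun u hu => ?_
  induction hu using Submodule.span_induction with
  | mem u hu =>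
    obtain ⟨k, j, hj, rfl⟩ := hu
    rw [hJ]
    exact Submodule.subset_span ⟨k, j, by omega, rfl⟩
  | zero => rw [map_zero]; exact Submodule.zero_mem _
  | add u v _ _ hu hv => rw [map_add]; exact Submodule.add_mem _ hu hv
  | smul c u _ hu => rw [map_smul]; exact Submodule.smul_mem _ c hu

theorem map_mem_fullSpace (hG : IsSymbol (symbol d τ f) (symbolAdj d τ f) S)
    {J : CircL2 →L[ℂ] E} (hJ : ∀ k j, J (hG.element j (unitVec k)) = comp d T ξ τ k j)
    (w : CircL2) : J w ∈ fullSpace d T ξ τ := by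
  have hw : w ∈ (Submodule.span ℂ
      (Set.range fun p : ℕ × ℤ => hG.element p.2 (unitVec p.1))).topologicalClosure :=
    hG.span_element_eq_top ▸ Submodule.mem_top
  refine map_mem_closure J.continuous hw fun u hu => ?_
  induction hu using Submodule.span_induction with
  | mem u hu =>
    obtain ⟨⟨k, j⟩, rfl⟩ := hu
    rw [hJ]
    exact Submodule.subset_span ⟨k, j, rfl⟩
  | zero => rw [map_zero]; exact Submodule.zero_mem _
  | add u v _ _ hu hv => rw [map_add]; exact Submodule.add_mem _ hu hv
  | smul c u _ hu => rw [map_smul]; exact Submodule.smul_mem _ c hu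

theorem inner_pastSpace_eq_zero (hG : IsSymbol (symbol d τ f) (symbolAdj d τ f) S)
    {J : CircL2 →L[ℂ] E} (hJ : ∀ k j, J (hG.element j (unitVec k)) = comp d T ξ τ k j)
    {r : ℝ} (hJ2 : ∀ a b, inner ℂ (J a) (J b) = (r : ℂ) * inner ℂ a b)
    {v : CircL2} (hv : v ∈ (hG.past 0)ᗮ) :
    ∀ η ∈ pastSpace d T ξ τ, inner ℂ η (J v) = 0 := by
  have hle : pastSpace d T ξ τ ≤ (ℂ ∙ J v)ᗮ := by
    refine Submodule.topologicalClosure_minimal _ ?_ (Submodule.isClosed_orthogonal _)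
    rw [Submodule.span_le]
    rintro _ ⟨k, j, hj, rfl⟩
    rw [SetLike.mem_coe, Submodule.mem_orthogonal_singleton_iff_inner_left, ← hJ, hJ2,
      hG.mem_past_orthogonal_iff.1 hv j k (by omega), mul_zero]
  exact fun η hη => Submodule.mem_orthogonal_singleton_iff_inner_left.1 (hle hη)

/-- The orthogonality principle: an element of a subspace with orthogonal error is the best
approximation. -/
theorem isBestApprox_of_inner_eq_zero (K : Submodule ℂ E) {X Y : E} (hY : Y ∈ K)
    (h : ∀ W ∈ K, inner ℂ W (X - Y) = 0) : IsBestApprox (K : Set E) X Y := by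
  refine ⟨hY, fun W hW => ?_⟩
  have h1 : inner ℂ (X - Y) (Y - W) = 0 := by
    rw [← inner_conj_symm, h _ (K.sub_mem hY hW), map_zero]
  have h2 := norm_add_sq_eq_norm_sq_add_norm_sq_of_inner_eq_zero (X - Y) (Y - W) h1
  rw [sub_add_sub_cancel] at h2
  nlinarith [norm_nonneg (X - Y), norm_nonneg (X - W), norm_nonneg (Y - W)]

/-- The class of estimates `η - V` is a translate of the past, and so is the problem. -/
theorem IsBestApprox.sub_const {K : Submodule ℂ E} {X Y : E} (h : IsBestApprox (K : Set E) X Y)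
    (V : E) : IsBestApprox {W | ∃ η ∈ K, W = η - V} (X - V) (Y - V) := by
  refine ⟨⟨Y, h.1, rfl⟩, ?_⟩
  rintro _ ⟨η, hη, rfl⟩
  rw [sub_sub_sub_cancel_right, sub_sub_sub_cancel_right]
  exact h.2 η hη

/-- The spectral characteristic is `φ f^{1/2} B_τ` minus `y / conj φ`. -/
theorem spectralChar_eq (d τ : ℕ) (f : ℝ → Vec →L[ℂ] Vec) (b : BlockVec) (y : ℝ → Vec) (x : ℝ) :
    spectralChar d τ f b y x =
      symbol d τ f x (∑' j : ℕ, Complex.exp (Complex.I * j * x) • b j) -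
        (conj (phi d τ x))⁻¹ • y x := by
  rw [spectralChar, conj_phi, inv_div]
  rfl

end

end PCIncrements

end

theorem mainTheorem1 {Ω : Type*} [MeasurableSpace Ω] (P : Measure Ω) [IsProbabilityMeasure P]
    (d τ : ℕ) (hd : 1 ≤ d) (hτ : 1 ≤ τ) (T : ℝ) (hT : 0 < T)
    -- the process, its increments and their spectral density
    (ξ : ℝ → Lp ℂ 2 P) (hξm : AEStronglyMeasurable ξ volume)
    (hξ2 : ∀ R : ℝ, ∫⁻ t in Set.Icc (-R) R, ‖ξ t‖ₑ ^ 2 < ∞)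
    (hper : HasPeriodicIncrements P d τ T ξ)
    (f : ℝ → Vec →L[ℂ] Vec) (hf : IsSpectralDensity P d τ T ξ f) (hmin : IsMinimal d τ f)
    -- the functional: its integrals and series converge absolutely
    (a : ℝ → ℂ) (ham : AEStronglyMeasurable a volume)
    (haloc : ∀ R : ℝ, ∫⁻ t in Set.Icc 0 R, bAbs d τ T a t < ∞)
    (haξ : ∀ l ≤ d, ∫⁻ t in Set.Ici (0 : ℝ), bAbs d τ T a t * ‖ξ (t - l * (τ * T))‖ₑ < ∞)
    -- the sequence `b = D^τ a`
    (b : BlockVec) (hb : ∀ j k, b j k = dTauVec d τ T a j k)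
    (hant : Summable fun j : ℕ => ((j : ℝ) + 1) * ‖b j‖) :
    -- `F_τ` has the matrix `F^τ_{j,l}` of Fourier coefficients
    (∀ j k, ∃ y, IsFormElement d τ f (unitBlock j k) y) ∧
    (∀ j l k n y z, IsFormElement d τ f (unitBlock l n) y → IsFormElement d τ f (unitBlock j k) z →
      formPairing d τ y z = fMatrix d τ f j l k n) ∧
    -- the spectral stochastic process exists
    (∃ Z : ℕ → ℝ → Lp ℂ 2 P, IsSpectralProcess d τ T ξ f Z) ∧
    -- `c = F_τ⁻¹ D^τ a` exists and is unique
    (∃! c : BlockVec, IsFApply d τ f c b) ∧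
    ∀ c : BlockVec, IsFApply d τ f c b →
      (∃ y, IsFormElement d τ f c y) ∧
      ∀ y, IsFormElement d τ f c y →
        ∀ Z : ℕ → ℝ → Lp ℂ 2 P, IsSpectralProcess d τ T ξ f Z →
          ∃ Bhat : Lp ℂ 2 P,
            IsSpectralIntegral f Z (spectralChar d τ f b y) Bhat ∧
            -- optimality of `Bhat` and of `Ahat = Bhat - V ξ`
            IsBestApprox (pastSpace d T ξ τ : Set (Lp ℂ 2 P)) (funB d τ T a ξ) Bhat ∧
            IsBestApprox {Y | ∃ η ∈ pastSpace d T ξ τ, Y = η - funV d τ T a ξ}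
              (funA a ξ) (Bhat - funV d τ T a ξ) ∧
            ((∀ t < 0, ∀ ζ ∈ fullSpace d T ξ τ,
                (∀ η ∈ pastSpace d T ξ τ, inner ℂ η ζ = 0) → inner ℂ (ξ t) ζ = 0) →
              IsBestApprox (obsSpace ξ : Set (Lp ℂ 2 P)) (funA a ξ)
                (Bhat - funV d τ T a ξ)) ∧
            -- the mean square error
            ‖funA a ξ - (Bhat - funV d τ T a ξ)‖ ^ 2 = ‖funB d τ T a ξ - Bhat‖ ^ 2 ∧
            ((‖funA a ξ - (Bhat - funV d τ T a ξ)‖ ^ 2 : ℝ) : ℂ) = formPairing d τ y y ∧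
            ((‖funA a ξ - (Bhat - funV d τ T a ξ)‖ ^ 2 : ℝ) : ℂ) = inner ℂ c b := by
  obtain ⟨S, hG⟩ := exists_isSymbol hτ hf.measurable_entry hf.positive hf.kernel hmin
  have hbs : Summable fun j => ‖b j‖ := hant.of_nonneg_of_le (fun _ => norm_nonneg _) fun j =>
    le_mul_of_one_le_left (norm_nonneg _) (by linarith [Nat.cast_nonneg (α := ℝ) j])
  obtain ⟨v, c₀, hv, hbv, hc₀⟩ := hG.exists_projection b hant
  have hF₀ : IsFApply d τ f c₀ b := isFApply_of_projection hτ hG hbs hbv hc₀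
  refine ⟨fun j k => ?_, fun j l k n y z hy hz => formPairing_unitBlock hmin hy hz,
    exists_isSpectralProcess hτ hf hmin hG, ⟨c₀, hF₀, fun c hc => hc.unique hτ hF₀⟩,
    fun c hc => ?_⟩
  · obtain ⟨y, hy⟩ := hmin k
    exact ⟨_, isFormElement_unitBlock hy j⟩
  obtain ⟨y₀, hy₀, hF⟩ := id hc
  refine ⟨⟨y₀, hy₀⟩, fun y hy Z hZ => ?_⟩
  obtain ⟨J, hJ, hJ2, hJZ⟩ := hZ.exists_isometry hτ hf hmin hG
  -- by uniqueness, `y` is the function `conj φ · v` given by the projection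
  have hcc : c = c₀ := hc.unique hτ hF₀
  have hyv : ∀ᵐ x ∂circ, y x = conj (phi d τ x) • v x := by
    subst hcc
    exact hy.unique hmin.injective (isFormElement_of_circL2 hτ hc₀)
  have hB : J (hG.series b) = funB d τ T a ξ :=
    map_series_eq_funB hτ hT hG hξm hξ2 ham haloc haξ hb hbs hJ
  have hA := funA_eq hτ hT ham hξm haloc haξ
  have herr : funB d τ T a ξ - J (hG.series b - v) = J v := by
    rw [← hB, map_sub, sub_sub_cancel]
  have herrA : funA a ξ - (J (hG.series b - v) - funV d τ T a ξ) = J v := by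
    rw [hA, sub_sub_sub_cancel_right, herr]
  have horth := inner_pastSpace_eq_zero hG hJ hJ2 hv
  have hbest : IsBestApprox (pastSpace d T ξ τ : Set (Lp ℂ 2 P)) (funB d τ T a ξ)
      (J (hG.series b - v)) :=
    isBestApprox_of_inner_eq_zero _ (map_mem_pastSpace hG hJ hbv) (by rwa [herr])
  have hnorm : ((‖J v‖ ^ 2 : ℝ) : ℂ) = formPairing d τ y y := by
    rw [formPairing_eq hτ hyv hyv]
    have h1 := hJ2 v v
    rw [inner_self_eq_norm_sq_to_K] at h1
    push_cast at h1 ⊢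
    exact h1
  refine ⟨J (hG.series b - v), hJZ _ _ ?_, hbest, ?_, fun hobs => ?_, ?_, ?_, ?_⟩
  · filter_upwards [hG.coeFn_series hbs, hyv, Lp.coeFn_sub (hG.series b) v,
      ae_phi_ne_zero d τ hτ] with x h1 h2 h3 h4
    rw [h3, Pi.sub_apply, h1, spectralChar_eq, h2, smul_smul,
      inv_mul_cancel₀ ((map_ne_zero _).2 h4), one_smul]
  · rw [hA]
    exact hbest.sub_const _
  · refine isBestApprox_of_inner_eq_zero _ (Submodule.sub_mem _
      (pastSpace_le_obsSpace hT hbest.1) funV_mem_obsSpace) ?_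
    rw [herrA]
    have hle : obsSpace ξ ≤ (ℂ ∙ J v)ᗮ := by
      refine Submodule.topologicalClosure_minimal _ ?_ (Submodule.isClosed_orthogonal _)
      rw [Submodule.span_le]
      rintro _ ⟨t, ht, rfl⟩
      rw [SetLike.mem_coe, Submodule.mem_orthogonal_singleton_iff_inner_left]
      exact hobs t ht _ (map_mem_fullSpace hG hJ v) horth
    exact fun W hW => Submodule.mem_orthogonal_singleton_iff_inner_left.1 (hle hW)
  · rw [herrA, herr]
  · rw [herrA, hnorm]
  · rw [herrA, hnorm]
    have hyy : y₀ =ᵐ[circ] y := hy₀.unique hmin.injective hy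
    rw [← hF c y hy, formPairing, formPairing]
    congr 1
    refine integral_congr_ae ?_
    filter_upwards [hyy] with x hx
    rw [hx]
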